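/- A strict partition is a finite sequence $\lambda=(\lambda_1>\lambda_2>\dots>\lambda_l>0)$ of positive integers (possibly empty); put $|\lambda|=\sum_i\lambda_i$. Spin characters. For each $r\ge 1$ let $p_r=\sum_i x_i^r$ be the power-sum symmetric function, $p_\rho=p_{\rho_1}p_{\rho_2}\cdots$ for a partition $\rho$, and let $P_\lambda$ be Schur's $P$-function, i.e. the symmetric function whose restriction to $x_1,\dots,x_N$ is $$P_\lambda(x_1,\dots,x_N)=\sum_{w\in S_N/S_{N-l}} w\Bigl(x_1^{\lambda_1}\cdots x_l^{\lambda_l}\prod_{i\le l,\ i<j\le N}\frac{x_i+x_j}{x_i-x_j}\Bigr)$$ for $N\ge l$, and $0$ for $N<l$. For a partition $\rho$ of $n$ with all parts odd, the numbers $X^\lambda_\rho$ are defined by $p_\rho=\sum_{\lambda\text{ strict},\,|\lambda|=n}X^\lambda_\rho P_\lambda$; put $g^\lambda=X^\lambda_{(1^n)}$. For $k\ge 1$ and a strict partition $\lambda$ of $n$ the normalized spin character is $$\mathfrak p_{2k-1}(\lambda)=n(n-1)\cdots(n-2k+2)\,\frac{X^\lambda_{(2k-1,1^{n-2k+1})}}{g^\lambda}\quad\text{if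 } 2k-1\le n,$$ and $\mathfrak p_{2k-1}(\lambda)=0$ if $2k-1>n$. Free cumulants. The double $D(\lambda)$ of a strict partition $\lambda$ is the Young diagram with modified Frobenius coordinates $[\lambda_1+\frac12,\dots,\lambda_l+\frac12\mid\lambda_1-\frac12,\dots,\lambda_l-\frac12]$; that is, the main diagonal of $D(\lambda)$ has $l$ boxes and, for $i\le l$, its $i$-th row has $\lambda_i+i$ boxes and its $i$-th column has $\lambda_i+i-1$ boxes. If $x_1<y_1<\dots<y_{r-1}<x_r$ are the abscissae of the local minima $x_i$ and the local maxima $y_i$ of the profile of a Young diagram $\mu$ drawn in Russian style, the transition measure $\mathfrak m_\mu$ is the probability measure on $\mathbb R$ with Cauchy transform $$\int_{\mathbb R}\frac{\mathfrak m_\mu(dx)}{z-x}=\frac{\prod_{i=1}^{r-1}(z-y_i)}{\prod_{i=1}^{r}(z-x_i)}.$$ Its free cumulants $R_1(\mu),R_2(\mu),\dots$ are determined by its moments through $\int x^m\,\mathfrak m_\mu(dx)=\sum_{\pi}\prod_{B\in\pi}R_{|B|}(\mu)$ for $m\ge 1$, the sum over all noncrossing partitions $\pi$ of $\{1,\dots,m\}$.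 For $j\ge 1$ put $\mathfrak R_{2j}(\lambda)=\frac12R_{2j}(D(\lambda))$. Theorem. For each $k\ge 1$ there exists a polynomial $K^{\mathrm{spin}}_{2k-1}$ in $k$ variables with rational coefficients such that $$\mathfrak p_{2k-1}(\lambda)=K^{\mathrm{spin}}_{2k-1}\bigl(\mathfrak R_2(\lambda),\mathfrak R_4(\lambda),\dots,\mathfrak R_{2k}(\lambda)\bigr)$$ for all strict partitions $\lambda$, and which is of the form $$K^{\mathrm{spin}}_{2k-1}(\mathfrak R_2,\dots,\mathfrak R_{2k})=\mathfrak R_{2k}+Q(\mathfrak R_2,\mathfrak R_4,\dots,\mathfrak R_{2k-2}),$$ where $Q$ is a polynomial with rational coefficients in $k-1$ variables of degree at most $2k-2$, the variable $\mathfrak R_{2j}$ having degree $2j-1$. -/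

import Mathlib

open scoped BigOperators

noncomputable section

namespace SpinKerov

/-! ### Strict partitions -/

/-- Strict partitions of `n`: partitions of `n` whose (nonzero) parts are distinct. -/
abbrev StrictPartition (n : ℕ) : Type := {lam : n.Partition // lam.parts.Nodup}

namespace StrictPartition

variable {n : ℕ}

/-- The parts in decreasing order. -/
def list (lam : StrictPartition n) : List ℕ := lam.1.parts.sort (· ≥ ·)

/-- The length `ℓ(λ)`, the number of nonzero parts. -/
def length (lam : StrictPartition n) : ℕ := lam.list.length

/-- The parts `λ₁ > λ₂ > ⋯ > λ_ℓ > 0 = 0 = ⋯`, indexed from `0`: `lam.part i` is `λ_{i+1}`. -/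
def part (lam : StrictPartition n) (i : ℕ) : ℕ := lam.list.getD i 0

theorem part_pos (lam : StrictPartition n) {i : ℕ} (hi : i < lam.length) : 0 < lam.part i := by
  have hi' : i < lam.list.length := hi
  have h : lam.part i ∈ lam.list := by
    rw [part, List.getD_eq_getElem _ _ hi']; exact List.getElem_mem hi'
  exact lam.1.parts_pos (by simpa [list] using h)

theorem part_lt (lam : StrictPartition n) {i j : ℕ} (hij : i < j) (hj : j < lam.length) :
    lam.part j < lam.part i := by
  have hj' : j < lam.list.length := hj
  have hs : lam.list.Pairwise (· ≥ ·) := Multiset.pairwise_sort _ _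
  have hn : lam.list.Nodup := by
    have h := lam.2
    rwa [← Multiset.sort_eq lam.1.parts (· ≥ ·), Multiset.coe_nodup] at h
  rw [part, part, List.getD_eq_getElem _ _ hj', List.getD_eq_getElem _ _ (hij.trans hj')]
  have h1 := List.pairwise_iff_getElem.1 hs i j (hij.trans hj') hj' hij
  have h2 : lam.list[i] ≠ lam.list[j] := fun h => hij.ne ((hn.getElem_inj_iff).1 h)
  omega

theorem part_add_le (lam : StrictPartition n) {i j : ℕ} (hij : i ≤ j) (hj : j < lam.length) :
    lam.part j + j ≤ lam.part i + i := by
  induction j, hij using Nat.le_induction with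
  | base => exact le_rfl
  | succ m hm ih =>
    have h1 := lam.part_lt (Nat.lt_succ_self m) hj
    have h2 := ih (by omega)
    simp only [Nat.succ_eq_add_one] at h1
    omega

end StrictPartition

/-! ### Symmetric functions and the numbers `X^λ_ρ` -/

/-- A symmetric function is handled through its restrictions to the variables `x₁, …, x_N`, for
every `N`; these restrictions are compared inside the fields of rational functions over `ℚ`.
Two symmetric functions are equal if and only if their restrictions are equal for every `N`. -/
abbrev SymFamily : Type := (N : ℕ) → FractionRing (MvPolynomial (Fin N) ℚ)

/-- The variable `x_i` among `x₁, …, x_N`. -/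
def var {N : ℕ} (i : Fin N) : FractionRing (MvPolynomial (Fin N) ℚ) :=
  algebraMap (MvPolynomial (Fin N) ℚ) _ (MvPolynomial.X i)

/-- The power sum `p_r = x₁^r + x₂^r + ⋯`. -/
def powerSum (r : ℕ) : SymFamily := fun N => ∑ i : Fin N, var i ^ r

/-- `p_ρ = p_{ρ₁} p_{ρ₂} ⋯`. -/
def powerSumPartition {n : ℕ} (rho : n.Partition) : SymFamily :=
  (rho.parts.map powerSum).prod

/-- Schur's `P`-function `P_λ`, the Hall-Littlewood function at `t = -1`. In `N` variables it is
`∑ w (x₁^{λ₁} ⋯ x_ℓ^{λ_ℓ} ∏_{i ≤ ℓ, i < j ≤ N} (x_i + x_j) / (x_i - x_j))`, the sum over the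
cosets `w` of `S_N / S_{N-ℓ}`. Such a coset is the same thing as an injection
`w : {1, …, ℓ} → {1, …, N}`; the pairs with `j ≤ ℓ` give the second product below and those
with `j > ℓ` (whose images are the elements outside the range of `w`) the third one.
For `N < ℓ` there is no injection and the function is zero. -/
def schurP {n : ℕ} (lam : StrictPartition n) : SymFamily := fun N =>
  ∑ w : Fin lam.length ↪ Fin N,
    (∏ i, var (w i) ^ lam.part i) *
    (∏ i, ∏ j ∈ Finset.univ.filter (fun j => i < j),
      (var (w i) + var (w j)) / (var (w i) - var (w j))) *
    (∏ i, ∏ m ∈ Finset.univ.filter (fun m => ∀ j, w j ≠ m),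
      (var (w i) + var m) / (var (w i) - var m))

/-- The numbers `X^λ_ρ`, for a strict partition `λ` and an odd partition `ρ` of the same `n`:
the coefficients in the expansion `p_ρ = ∑_{λ strict, |λ| = n} X^λ_ρ P_λ`. They exist and are
unique because the `P_λ` form a linear basis of the algebra generated by the odd power sums. -/
def spinX {n : ℕ} (rho : n.Partition) : StrictPartition n → ℚ :=
  Classical.epsilon fun X : StrictPartition n → ℚ =>
    powerSumPartition rho = ∑ lam : StrictPartition n, X lam • schurP lam

/-- The partition `ρ ∪ (1^{n-k})` of `n`, for a partition `ρ` of `k ≤ n`. -/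
def unionOnes {k n : ℕ} (rho : k.Partition) (h : k ≤ n) : n.Partition where
  parts := rho.parts + Multiset.replicate (n - k) 1
  parts_pos := by
    intro i hi
    rcases Multiset.mem_add.1 hi with hi | hi
    · exact rho.parts_pos hi
    · rw [Multiset.eq_of_mem_replicate hi]; exact Nat.one_pos
  parts_sum := by
    rw [Multiset.sum_add, rho.parts_sum, Multiset.sum_replicate, smul_eq_mul, mul_one]
    omega

/-- The partition `(1^n)`. -/
def onesPartition (n : ℕ) : n.Partition where
  parts := Multiset.replicate n 1
  parts_pos := by
    intro i hi
    rw [Multiset.eq_of_mem_replicate hi]; exact Nat.one_pos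
  parts_sum := by simp

/-- `g^λ = X^λ_{(1^n)}`. -/
def spinG {n : ℕ} (lam : StrictPartition n) : ℚ := spinX (onesPartition n) lam

/-- The normalized spin character `𝔭_ρ(λ) = n (n-1) ⋯ (n-k+1) X^λ_{ρ ∪ (1^{n-k})} / g^λ` for an
odd partition `ρ` of `k` and a strict partition `λ` of `n ≥ k`; it is `0` for `k > n`. -/
def spinCharacter {k n : ℕ} (rho : k.Partition) (lam : StrictPartition n) : ℚ :=
  if h : k ≤ n then
    (n.descFactorial k : ℚ) * spinX (unionOnes rho h) lam / spinG lam
  else 0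

/-- The one-row character `𝔭_r = 𝔭_{(r)}`. -/
def oneRowSpinCharacter {n : ℕ} (r : ℕ) (lam : StrictPartition n) : ℚ :=
  spinCharacter (Nat.Partition.indiscrete r) lam

/-! ### The double diagram -/

/-- The double diagram `D(λ)`: the shifted diagram of `λ` (row `i` consists of the cells
`(i, i+1), …, (i, i+λ_i)`), together with its reflection, which consists of the cells
`(j-1, i)` for `(i, j)` in the shifted diagram. -/
def doubleDiagram {n : ℕ} (lam : StrictPartition n) : YoungDiagram where
  cells :=
    (Finset.range (2 * n + 1) ×ˢ Finset.range (2 * n + 1)).filter fun c =>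
      (c.1 < lam.length ∧ c.1 < c.2 ∧ c.2 ≤ c.1 + lam.part c.1) ∨
      (c.2 < lam.length ∧ c.2 ≤ c.1 ∧ c.1 < c.2 + lam.part c.2)
  isLowerSet := by
    rintro ⟨i, j⟩ ⟨i', j'⟩ ⟨hi, hj⟩ h
    simp only [Finset.coe_filter, Set.mem_ofPred_eq, Finset.mem_product, Finset.mem_range] at h ⊢
    simp only at hi hj
    obtain ⟨⟨h1, h2⟩, h⟩ := h
    refine ⟨⟨by omega, by omega⟩, ?_⟩
    rcases h with ⟨a, b, c⟩ | ⟨a, b, c⟩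
    · rcases lt_or_ge i' j' with hlt | hge
      · have := lam.part_add_le hi a
        left; refine ⟨by omega, hlt, by omega⟩
      · have := lam.part_add_le (hge.trans hi) a
        have := lam.part_add_le hi a
        have := lam.part_pos (show j' < lam.length by omega)
        right; refine ⟨by omega, hge, ?_⟩
        rcases Nat.lt_or_ge j' i with h' | h'
        · have := lam.part_add_le (show j' ≤ i by omega) a
          have := lam.part_pos a
          omega
        · omega
    · rcases lt_or_ge i' j' with hlt | hge
      · have := lam.part_add_le (show i' ≤ j by omega) a
        have := lam.part_pos a
        left; refine ⟨by omega, hlt, by omega⟩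
      · have := lam.part_add_le hj a
        right; refine ⟨by omega, hge, by omega⟩

theorem sum_le_of_lt {n : ℕ} (lam : StrictPartition n) {i : ℕ} (hi : i < lam.length) :
    lam.part i + i ≤ n := by
  have hsum : lam.list.sum = n := by
    have h := lam.1.parts_sum
    rwa [← Multiset.sort_eq lam.1.parts (· ≥ ·), Multiset.sum_coe] at h
  have h0 : 0 < lam.length := by omega
  have h1 := lam.part_add_le (Nat.zero_le i) hi
  have h2 : lam.part 0 ∈ lam.list := by
    rw [StrictPartition.part, List.getD_eq_getElem _ _ h0]; exact List.getElem_mem _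
  have h3 := List.le_sum_of_mem h2
  omega

theorem mem_doubleDiagram {n : ℕ} (lam : StrictPartition n) (i j : ℕ) :
    (i, j) ∈ doubleDiagram lam ↔
      (i < lam.length ∧ i < j ∧ j ≤ i + lam.part i) ∨
      (j < lam.length ∧ j ≤ i ∧ i < j + lam.part j) := by
  rw [← YoungDiagram.mem_cells]
  simp only [doubleDiagram, Finset.mem_filter, Finset.mem_product, Finset.mem_range,
    and_iff_right_iff_imp]
  rintro (⟨a, b, c⟩ | ⟨a, b, c⟩)
  · have := sum_le_of_lt lam a
    omega
  · have := sum_le_of_lt lam a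
    omega

/-- The main diagonal of `D(λ)` has `ℓ(λ)` cells. -/
theorem diag_mem_doubleDiagram {n : ℕ} (lam : StrictPartition n) (i : ℕ) :
    (i, i) ∈ doubleDiagram lam ↔ i < lam.length := by
  rw [mem_doubleDiagram]
  refine ⟨by omega, fun h => ?_⟩
  have := lam.part_pos h
  omega

/-- The modified Frobenius coordinates `a_i = D(λ)_i - i + 1/2` are `λ_i + 1/2`. -/
theorem rowLen_doubleDiagram {n : ℕ} (lam : StrictPartition n) {i : ℕ} (hi : i < lam.length) :
    (doubleDiagram lam).rowLen i = lam.part i + i + 1 := by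
  have key : ∀ j, j < (doubleDiagram lam).rowLen i ↔ j < lam.part i + i + 1 := by
    intro j
    rw [← YoungDiagram.mem_iff_lt_rowLen, mem_doubleDiagram]
    constructor
    · rintro (h | h) <;> omega
    · intro h
      rcases lt_or_ge i j with h' | h'
      · left; omega
      · right
        have := lam.part_add_le h' hi
        have := lam.part_pos hi
        omega
  exact le_antisymm (le_of_not_gt fun h => by simpa using (key _).1 h)
    (le_of_not_gt fun h => by simpa using (key _).2 h)

/-- The modified Frobenius coordinates `b_i = D(λ)'_i - i + 1/2` are `λ_i - 1/2`. -/
theorem colLen_doubleDiagram {n : ℕ} (lam : StrictPartition n) {i : ℕ} (hi : i < lam.length) :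
    (doubleDiagram lam).colLen i = lam.part i + i := by
  have key : ∀ j, j < (doubleDiagram lam).colLen i ↔ j < lam.part i + i := by
    intro j
    rw [← YoungDiagram.mem_iff_lt_colLen, mem_doubleDiagram]
    constructor
    · rintro (⟨h1, h2, h3⟩ | h)
      · have := lam.part_add_le h2.le hi
        have := lam.part_pos hi
        omega
      · omega
    · intro h
      rcases lt_or_ge j i with h' | h'
      · left
        have := lam.part_add_le h'.le hi
        omega
      · right; omega
  exact le_antisymm (le_of_not_gt fun h => by simpa using (key _).1 h)
    (le_of_not_gt fun h => by simpa using (key _).2 h)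

/-! ### Kerov interlacing coordinates and the transition measure -/

/-- The profile at the integer point `u` of a Young diagram drawn in Russian style. The box `(i, j)`
is the square with lowest vertex `(j - i, i + j)` and highest vertex `(j - i, i + j + 2)`, so the
boxes of content `u` are stacked on the point `(u, |u|)`, each of height `2`. Between consecutive
integers the profile is linear, of slope `1` or `-1`. -/
def profile (mu : YoungDiagram) (u : ℤ) : ℤ :=
  |u| + 2 * ((mu.cells.filter fun c => (c.2 : ℤ) - (c.1 : ℤ) = u).card : ℤ)

/-- The local minima `x₁ < ⋯ < x_r` of the profile (they lie between `-|μ|` and `|μ|`). -/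
def minima (mu : YoungDiagram) : Finset ℤ :=
  (Finset.Icc (-(mu.card : ℤ)) mu.card).filter fun u =>
    profile mu u < profile mu (u - 1) ∧ profile mu u < profile mu (u + 1)

/-- The local maxima `y₁ < ⋯ < y_{r-1}` of the profile. -/
def maxima (mu : YoungDiagram) : Finset ℤ :=
  (Finset.Icc (-(mu.card : ℤ)) mu.card).filter fun u =>
    profile mu (u - 1) < profile mu u ∧ profile mu (u + 1) < profile mu u

/-- The residue at the local minimum `x` of `∏ (z - y_j) / ∏ (z - x_i)`. -/
def transitionWeight (mu : YoungDiagram) (x : ℤ) : ℝ :=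
  (∏ y ∈ maxima mu, ((x : ℝ) - (y : ℝ))) / ∏ x' ∈ (minima mu).erase x, ((x : ℝ) - (x' : ℝ))

/-- Kerov's transition measure: the probability measure on `ℝ` with Cauchy transform
`∏ (z - y_j) / ∏ (z - x_i)`, i.e. the measure on `{x₁, …, x_r}` whose masses are the residues. -/
def transitionMeasure (mu : YoungDiagram) : MeasureTheory.Measure ℝ :=
  ∑ x ∈ minima mu, ENNReal.ofReal (transitionWeight mu x) • MeasureTheory.Measure.dirac (x : ℝ)

/-- The number of boxes of content `u`. -/
def contentCount (mu : YoungDiagram) (u : ℤ) : ℕ :=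
  (mu.cells.filter fun c => (c.2 : ℤ) - (c.1 : ℤ) = u).card

theorem contentCount_bounds_nonneg (mu : YoungDiagram) {u : ℤ} (hu : 0 ≤ u) :
    contentCount mu (u + 1) ≤ contentCount mu u ∧
      contentCount mu u ≤ contentCount mu (u + 1) + 1 := by
  constructor
  · refine Finset.card_le_card_of_injOn (fun c => (c.1, c.2 - 1)) ?_ ?_
    · rintro ⟨i, j⟩ h
      simp only [Finset.coe_filter, Set.mem_ofPred_eq, YoungDiagram.mem_cells] at h ⊢
      exact ⟨mu.up_left_mem le_rfl (Nat.sub_le j 1) h.1, by omega⟩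
    · rintro ⟨i, j⟩ h ⟨i', j'⟩ h' e
      simp only [Finset.coe_filter, Set.mem_ofPred_eq, Prod.mk.injEq] at h h' e ⊢
      omega
  · refine (Nat.sub_le_iff_le_add.1 (Finset.pred_card_le_card_erase (a := ((0 : ℕ), u.toNat)))).trans ?_
    refine Nat.add_le_add_right (Finset.card_le_card_of_injOn (fun c => (c.1 - 1, c.2)) ?_ ?_) 1
    · rintro ⟨i, j⟩ h
      simp only [Finset.coe_erase, Finset.coe_filter, Set.mem_diff, Set.mem_singleton_iff,
        Set.mem_ofPred_eq, YoungDiagram.mem_cells, Prod.mk.injEq] at h ⊢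
      exact ⟨mu.up_left_mem (Nat.sub_le i 1) le_rfl h.1.1, by omega⟩
    · rintro ⟨i, j⟩ h ⟨i', j'⟩ h' e
      simp only [Finset.coe_erase, Finset.coe_filter, Set.mem_diff, Set.mem_singleton_iff,
        Set.mem_ofPred_eq, Prod.mk.injEq] at h h' e ⊢
      omega

theorem contentCount_bounds_neg (mu : YoungDiagram) {u : ℤ} (hu : u < 0) :
    contentCount mu u ≤ contentCount mu (u + 1) ∧
      contentCount mu (u + 1) ≤ contentCount mu u + 1 := by
  constructor
  · refine Finset.card_le_card_of_injOn (fun c => (c.1 - 1, c.2)) ?_ ?_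
    · rintro ⟨i, j⟩ h
      simp only [Finset.coe_filter, Set.mem_ofPred_eq, YoungDiagram.mem_cells] at h ⊢
      exact ⟨mu.up_left_mem (Nat.sub_le i 1) le_rfl h.1, by omega⟩
    · rintro ⟨i, j⟩ h ⟨i', j'⟩ h' e
      simp only [Finset.coe_filter, Set.mem_ofPred_eq, Prod.mk.injEq] at h h' e ⊢
      omega
  · refine (Nat.sub_le_iff_le_add.1 (Finset.pred_card_le_card_erase (a := ((-(u + 1)).toNat, (0 : ℕ))))).trans ?_
    refine Nat.add_le_add_right (Finset.card_le_card_of_injOn (fun c => (c.1, c.2 - 1)) ?_ ?_) 1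
    · rintro ⟨i, j⟩ h
      simp only [Finset.coe_erase, Finset.coe_filter, Set.mem_diff, Set.mem_singleton_iff,
        Set.mem_ofPred_eq, YoungDiagram.mem_cells, Prod.mk.injEq] at h ⊢
      exact ⟨mu.up_left_mem le_rfl (Nat.sub_le j 1) h.1.1, by omega⟩
    · rintro ⟨i, j⟩ h ⟨i', j'⟩ h' e
      simp only [Finset.coe_erase, Finset.coe_filter, Set.mem_diff, Set.mem_singleton_iff,
        Set.mem_ofPred_eq, Prod.mk.injEq] at h h' e ⊢
      omega

/-- The slope of the profile on `[u, u + 1]`. -/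
def slope (mu : YoungDiagram) (u : ℤ) : ℤ := profile mu (u + 1) - profile mu u

theorem slope_eq (mu : YoungDiagram) (u : ℤ) : slope mu u = 1 ∨ slope mu u = -1 := by
  have h : slope mu u = |u + 1| + 2 * (contentCount mu (u + 1) : ℤ) -
      (|u| + 2 * (contentCount mu u : ℤ)) := rfl
  rcases le_or_gt 0 u with hu | hu
  · have := contentCount_bounds_nonneg mu hu
    rw [abs_of_nonneg hu, abs_of_nonneg (by omega : 0 ≤ u + 1)] at h
    omega
  · have := contentCount_bounds_neg mu hu
    rw [abs_of_neg hu, abs_of_nonpos (by omega : u + 1 ≤ 0)] at h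
    omega

theorem contentCount_eq_zero (mu : YoungDiagram) {u : ℤ} (hu : (mu.card : ℤ) ≤ |u|) :
    contentCount mu u = 0 := by
  rw [contentCount, Finset.card_eq_zero, Finset.filter_eq_empty_iff]
  rintro ⟨i, j⟩ hc e
  rw [YoungDiagram.mem_cells] at hc
  simp only at e
  have h1 : j + 1 ≤ mu.card := by
    have := Finset.card_le_card_of_injOn (s := Finset.range (j + 1)) (t := mu.cells)
      (fun m => (i, m)) (by
        intro m hm
        simp only [Finset.coe_range, Set.mem_Iio] at hm
        exact mu.up_left_mem le_rfl (by omega) hc) (by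
        intro a _ b _ e
        simpa using e)
    simpa using this
  have h2 : i + 1 ≤ mu.card := by
    have := Finset.card_le_card_of_injOn (s := Finset.range (i + 1)) (t := mu.cells)
      (fun m => (m, j)) (by
        intro m hm
        simp only [Finset.coe_range, Set.mem_Iio] at hm
        exact mu.up_left_mem (by omega) le_rfl hc) (by
        intro a _ b _ e
        simpa using e)
    simpa using this
  rcases abs_cases u with ⟨h, _⟩ | ⟨h, _⟩ <;> omega

theorem slope_right (mu : YoungDiagram) : slope mu mu.card = 1 := by
  have h : slope mu mu.card = |(mu.card : ℤ) + 1| + 2 * (contentCount mu (mu.card + 1) : ℤ) -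
      (|(mu.card : ℤ)| + 2 * (contentCount mu mu.card : ℤ)) := rfl
  rw [contentCount_eq_zero mu (le_abs_self _),
    contentCount_eq_zero mu ((by omega : (mu.card : ℤ) ≤ mu.card + 1).trans (le_abs_self _)),
    abs_of_nonneg (by omega : (0 : ℤ) ≤ mu.card),
    abs_of_nonneg (by omega : (0 : ℤ) ≤ mu.card + 1)] at h
  omega

theorem slope_left (mu : YoungDiagram) : slope mu (-(mu.card : ℤ) - 1) = -1 := by
  have h : slope mu (-(mu.card : ℤ) - 1) =
      |-(mu.card : ℤ) - 1 + 1| + 2 * (contentCount mu (-(mu.card : ℤ) - 1 + 1) : ℤ) -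
      (|-(mu.card : ℤ) - 1| + 2 * (contentCount mu (-(mu.card : ℤ) - 1) : ℤ)) := rfl
  have e1 : |-(mu.card : ℤ) - 1 + 1| = mu.card := by
    rw [abs_of_nonpos (by omega)]; omega
  have e2 : |-(mu.card : ℤ) - 1| = mu.card + 1 := by
    rw [abs_of_nonpos (by omega)]; omega
  rw [contentCount_eq_zero mu (by rw [e1]), contentCount_eq_zero mu (by rw [e2]; omega), e1, e2] at h
  omega

theorem mem_minima (mu : YoungDiagram) (u : ℤ) :
    u ∈ minima mu ↔ u ∈ Finset.Icc (-(mu.card : ℤ)) mu.card ∧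
      slope mu (u - 1) = -1 ∧ slope mu u = 1 := by
  have h1 := slope_eq mu (u - 1)
  have h2 := slope_eq mu u
  rw [minima, Finset.mem_filter]
  simp only [slope, sub_add_cancel] at *
  refine and_congr_right fun _ => ?_
  omega

theorem mem_maxima (mu : YoungDiagram) (u : ℤ) :
    u ∈ maxima mu ↔ u ∈ Finset.Icc (-(mu.card : ℤ)) mu.card ∧
      slope mu (u - 1) = 1 ∧ slope mu u = -1 := by
  have h1 := slope_eq mu (u - 1)
  have h2 := slope_eq mu u
  rw [maxima, Finset.mem_filter]
  simp only [slope, sub_add_cancel] at *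
  refine and_congr_right fun _ => ?_
  omega

/-- Counting the extrema to the right of `v`. -/
theorem card_extrema (mu : YoungDiagram) {v : ℤ} (h1 : -(mu.card : ℤ) - 1 ≤ v)
    (h2 : v ≤ mu.card) :
    2 * (((minima mu).filter fun x => v < x).card : ℤ) -
      2 * (((maxima mu).filter fun y => v < y).card : ℤ) = 1 - slope mu v := by
  induction v, h2 using Int.leInductionDown with
  | base =>
    have e1 : ((minima mu).filter fun x => (mu.card : ℤ) < x) = ∅ := by
      rw [Finset.filter_eq_empty_iff]
      intro x hx
      have := Finset.mem_Icc.1 ((mem_minima mu x).1 hx).1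
      omega
    have e2 : ((maxima mu).filter fun x => (mu.card : ℤ) < x) = ∅ := by
      rw [Finset.filter_eq_empty_iff]
      intro x hx
      have := Finset.mem_Icc.1 ((mem_maxima mu x).1 hx).1
      omega
    rw [e1, e2, slope_right]
    simp
  | pred v hv ih =>
    have ih := ih (by omega)
    have hI : v ∈ Finset.Icc (-(mu.card : ℤ)) mu.card := Finset.mem_Icc.2 ⟨by omega, hv⟩
    have key : ∀ S : Finset ℤ, ((S.filter fun x => v - 1 < x).card : ℤ) =
        (S.filter fun x => v < x).card + if v ∈ S then 1 else 0 := by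
      intro S
      have : (S.filter fun x => v - 1 < x) =
          (S.filter fun x => v < x) ∪ (S.filter fun x => x = v) := by
        rw [← Finset.filter_or]
        refine Finset.filter_congr fun x _ => ?_
        omega
      rw [this, Finset.card_union_of_disjoint, Finset.filter_eq']
      · split_ifs <;> simp
      · rw [Finset.disjoint_filter]
        intro x _ hx
        omega
    rw [key, key]
    have m1 := mem_minima mu v
    have m2 := mem_maxima mu v
    simp only [hI, true_and] at m1 m2
    simp only [m1, m2]
    rcases slope_eq mu v with h | h <;> rcases slope_eq mu (v - 1) with h' | h' <;>
      simp [h, h'] <;> omega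

theorem card_minima (mu : YoungDiagram) : (minima mu).card = (maxima mu).card + 1 := by
  have h := card_extrema mu (v := -(mu.card : ℤ) - 1) le_rfl (by omega)
  rw [slope_left, Finset.filter_true_of_mem, Finset.filter_true_of_mem] at h
  · omega
  · intro x hx
    have := Finset.mem_Icc.1 ((mem_maxima mu x).1 hx).1
    omega
  · intro x hx
    have := Finset.mem_Icc.1 ((mem_minima mu x).1 hx).1
    omega

theorem prod_sub_sign (S : Finset ℤ) (x : ℤ) :
    ∏ y ∈ S, ((x : ℝ) - (y : ℝ)) =
      (-1) ^ (S.filter fun y => x < y).card * ∏ y ∈ S, |(x : ℝ) - (y : ℝ)| := by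
  rw [← Finset.prod_const, Finset.prod_filter, ← Finset.prod_mul_distrib]
  refine Finset.prod_congr rfl fun y _ => ?_
  split_ifs with h
  · rw [abs_of_neg (by rw [sub_neg]; exact_mod_cast h)]; ring
  · rw [abs_of_nonneg (by rw [sub_nonneg]; exact_mod_cast (not_lt.1 h))]; ring

/-- The masses of the transition measure are nonnegative. -/
theorem transitionWeight_nonneg (mu : YoungDiagram) {x : ℤ} (hx : x ∈ minima mu) :
    0 ≤ transitionWeight mu x := by
  obtain ⟨hI, -, hs⟩ := (mem_minima mu x).1 hx
  have hI := Finset.mem_Icc.1 hI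
  have h := card_extrema mu (v := x) (by omega) hI.2
  rw [hs] at h
  have e : ((minima mu).erase x).filter (fun y => x < y) =
      (minima mu).filter (fun y => x < y) := by
    ext y
    simp only [Finset.mem_filter, Finset.mem_erase]
    constructor
    · rintro ⟨⟨-, a⟩, b⟩; exact ⟨a, b⟩
    · rintro ⟨a, b⟩; exact ⟨⟨b.ne', a⟩, b⟩
  have hcard : ((maxima mu).filter fun y => x < y).card =
      ((minima mu).filter fun y => x < y).card := by omega
  rw [transitionWeight, prod_sub_sign, prod_sub_sign, e, hcard,
    mul_div_mul_left _ _ (pow_ne_zero _ (by norm_num))]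
  positivity

/-- The masses of the transition measure add up to one. -/
theorem sum_transitionWeight (mu : YoungDiagram) :
    ∑ x ∈ minima mu, transitionWeight mu x = 1 := by
  have h := Lagrange.leadingCoeff_eq_sum (s := minima mu) (v := fun x : ℤ => (x : ℝ))
    (fun a _ b _ e => by simpa using e)
    (P := Lagrange.nodal (maxima mu) (fun y : ℤ => (y : ℝ)))
    (by rw [Lagrange.degree_nodal, card_minima]; norm_cast)
  rw [(Lagrange.nodal_monic).leadingCoeff] at h
  rw [h]
  refine Finset.sum_congr rfl fun x _ => ?_
  rw [Lagrange.eval_nodal, transitionWeight]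

instance isProbabilityMeasure_transitionMeasure (mu : YoungDiagram) :
    MeasureTheory.IsProbabilityMeasure (transitionMeasure mu) := by
  refine ⟨?_⟩
  simp only [transitionMeasure, MeasureTheory.Measure.coe_finsetSum, Finset.sum_apply,
    MeasureTheory.Measure.smul_apply, MeasureTheory.measure_univ, smul_eq_mul, mul_one]
  rw [← ENNReal.ofReal_sum_of_nonneg fun x hx => transitionWeight_nonneg mu hx,
    sum_transitionWeight, ENNReal.ofReal_one]

/-- The Cauchy transform of the transition measure is `∏ (z - y_j) / ∏ (z - x_i)`. -/
theorem cauchyTransform_transitionMeasure (mu : YoungDiagram) {z : ℂ} (hz : z.im ≠ 0) :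
    ∫ t : ℝ, (z - (t : ℂ))⁻¹ ∂(transitionMeasure mu) =
      (∏ y ∈ maxima mu, (z - (y : ℂ))) / ∏ x ∈ minima mu, (z - (x : ℂ)) := by
  have hne : ∀ x : ℤ, z - (x : ℂ) ≠ 0 := by
    intro x h
    apply hz
    have := congrArg Complex.im h
    simpa using this
  rw [transitionMeasure, MeasureTheory.integral_finsetSum_measure]
  · simp only [MeasureTheory.integral_smul_measure, MeasureTheory.integral_dirac]
    rw [eq_div_iff (Finset.prod_ne_zero_iff.2 fun x _ => hne x)]
    have hinj : Set.InjOn (fun x : ℤ => (x : ℂ)) (minima mu) := fun a _ b _ e => by simpa using e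
    have hdeg : (Lagrange.nodal (maxima mu) (fun y : ℤ => (y : ℂ))).degree <
        (minima mu).card := by
      rw [Lagrange.degree_nodal, card_minima]; norm_cast; omega
    have h1 := Lagrange.eq_interpolate hinj hdeg
    have h2 := congrArg (Polynomial.eval z) h1
    rw [Lagrange.eval_interpolate_not_at_node _ (fun x _ => sub_ne_zero.1 (hne x)),
      Lagrange.eval_nodal, Lagrange.eval_nodal] at h2
    rw [h2, mul_comm]
    congr 1
    refine Finset.sum_congr rfl fun x hx => ?_
    rw [ENNReal.toReal_ofReal (transitionWeight_nonneg mu hx), Lagrange.eval_nodal,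
      Lagrange.nodalWeight, transitionWeight, Finset.prod_inv_distrib, Complex.real_smul]
    push_cast
    field_simp
  · intro x _
    exact (MeasureTheory.integrable_dirac (by simp)).smul_measure ENNReal.ofReal_ne_top

/-! ### Free cumulants -/

/-- A partition of `{0, …, n-1}` is noncrossing if there are no `a < b < c < d` with `a, c` in one
block and `b, d` in another. -/
def IsNoncrossing {n : ℕ} (P : Finpartition (Finset.univ : Finset (Fin n))) : Prop :=
  ∀ A ∈ P.parts, ∀ B ∈ P.parts, ∀ a b c d : Fin n, a < b → b < c → c < d →
    a ∈ A → c ∈ A → b ∈ B → d ∈ B → A = B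

open Classical in
/-- The noncrossing partitions of `{0, …, n-1}`. -/
def noncrossing (n : ℕ) : Finset (Finpartition (Finset.univ : Finset (Fin n))) :=
  Finset.univ.filter IsNoncrossing

/-- The noncrossing partitions of `{0, …, n-1}` with more than one block. -/
def noncrossingProper (n : ℕ) : Finset (Finpartition (Finset.univ : Finset (Fin n))) :=
  (noncrossing n).filter fun P => 1 < P.parts.card

theorem card_block_lt {n : ℕ} {P : Finpartition (Finset.univ : Finset (Fin n))}
    (hP : P ∈ noncrossingProper n) {B : Finset (Fin n)} (hB : B ∈ P.parts) : B.card < n := by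
  have h1 : 1 < P.parts.card := (Finset.mem_filter.1 hP).2
  obtain ⟨C, hC, hne⟩ := Finset.exists_mem_ne h1 B
  obtain ⟨c, hc⟩ := P.nonempty_of_mem_parts hC
  have hcB : c ∉ B := fun h => (Finset.disjoint_left.1 (P.disjoint hC hB hne)) hc h
  have := Finset.card_lt_card (Finset.ssubset_univ_iff.2 fun h : B = Finset.univ =>
    hcB (by rw [h]; exact Finset.mem_univ c))
  simpa using this

/-- The free cumulants `R_n` of a moment sequence `M`, i.e. the solution of the free
cumulant-moment formula `M_n = ∑_{P noncrossing} ∏_{B ∈ P} R_{|B|}`, solved for the term `R_n` of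
the partition with one block. -/
def freeCumulantOfMoments (M : ℕ → ℝ) (n : ℕ) : ℝ :=
  M n - ∑ P : {P // P ∈ noncrossingProper n}, ∏ B : {B // B ∈ P.1.parts},
    freeCumulantOfMoments M B.1.card
termination_by n
decreasing_by exact card_block_lt P.2 B.2

/-- The free cumulant-moment formula. -/
theorem moment_eq_sum_noncrossing (M : ℕ → ℝ) {n : ℕ} (hn : 0 < n) :
    M n = ∑ P ∈ noncrossing n, ∏ B ∈ P.parts, freeCumulantOfMoments M B.card := by
  classical
  have hne : (Finset.univ : Finset (Fin n)) ≠ ⊥ := by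
    intro h
    have h2 : (⟨0, hn⟩ : Fin n) ∈ (Finset.univ : Finset (Fin n)) := Finset.mem_univ _
    rw [h] at h2
    simp at h2
  have hone : (noncrossing n).filter (fun P => ¬ 1 < P.parts.card) =
      {Finpartition.indiscrete hne} := by
    ext P
    simp only [Finset.mem_filter, Finset.mem_singleton, noncrossing, Finset.mem_univ, true_and]
    constructor
    · rintro ⟨-, hc⟩
      have hpos : P.parts.card ≠ 0 := by
        intro h
        exact hne ((P.parts_eq_empty_iff).1 (Finset.card_eq_zero.1 h))
      obtain ⟨B, hB⟩ := Finset.card_eq_one.1 (show P.parts.card = 1 by omega)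
      have hs := P.sup_parts
      rw [hB, Finset.sup_singleton, id] at hs
      ext C
      simp [hB, hs]
    · rintro rfl
      refine ⟨?_, by simp⟩
      intro A hA B hB
      intros
      simp only [Finpartition.indiscrete_parts, Finset.mem_singleton] at hA hB
      rw [hA, hB]
  rw [← Finset.sum_filter_add_sum_filter_not (noncrossing n) (fun P => 1 < P.parts.card), hone,
    Finset.sum_singleton]
  simp only [Finpartition.indiscrete_parts, Finset.prod_singleton, Finset.card_univ,
    Fintype.card_fin]
  rw [freeCumulantOfMoments]
  have h1 : ∀ P : Finpartition (Finset.univ : Finset (Fin n)),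
      (∏ B : {B // B ∈ P.parts}, freeCumulantOfMoments M B.1.card) =
        ∏ B ∈ P.parts, freeCumulantOfMoments M B.card := fun P =>
    Finset.prod_coe_sort P.parts (fun B => freeCumulantOfMoments M B.card)
  simp only [h1]
  rw [Finset.sum_coe_sort (noncrossingProper n)
    (fun P => ∏ B ∈ P.parts, freeCumulantOfMoments M B.card)]
  simp only [noncrossingProper]
  ring

/-- The free cumulant `R_k[μ]` of a measure `μ` on `ℝ`. -/
def freeCumulant (μ : MeasureTheory.Measure ℝ) (k : ℕ) : ℝ :=
  freeCumulantOfMoments (fun j => ∫ x, x ^ j ∂μ) k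

/-- `ℜ_{2j}(λ) = (1/2) R_{2j}(D(λ))`, half the free cumulant of the transition measure of the
double diagram. The argument `k` is the full index `2j`. -/
def spinFreeCumulant {n : ℕ} (k : ℕ) (lam : StrictPartition n) : ℝ :=
  freeCumulant (transitionMeasure (doubleDiagram lam)) k / 2

end SpinKerov

end

noncomputable section

set_option linter.unusedSectionVars false

/-! Put `r = 2k - 1 = 2q + 1` and let `A` be the set of parts of `λ`. The character and the free
cumulants are both compared with the odd power sums of the parts: modulo lower degree, the character
of degree `r` and half of `R_{2k}(D(λ))` are both equal to `∑_{b ∈ A} b^r`.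

The character. In `N` variables `P_λ` is a sum over placements of the parts on the variables. After
multiplication by the constant `hookWeight λ` its terms become the values `weight x φ` at the
functions `φ` whose nonzero values are the parts. Multiplication by `p_r` acts on `∑_φ weight x φ`
through simple moves. On variables with `φ ≠ 0`, the factor `x_m^r` adds `r` to a value. On the
others, `p_r` is first expanded in one-row and two-row functions `P` (`sum_pow_eq`, by partial
fractions), which creates either a new part `r` or two new parts with sum `r`. Contributions to a
`ψ` with a repeated nonzero value cancel by antisymmetry; those to any other `ψ` add up to `weight x
ψ` times a rational number `barSum r` of the set of values (`bracket_eq_weight_mul`). For `r = 1`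
this number is `|λ|`, so the sum of all weights of size `n` is `p_1^n / n!`. Comparing coefficients,
which is legitimate because the `P_λ` are linearly independent, identifies the normalized character
with `barSum r A` (`oneRowSpinCharacter_eq_barSum`).

The bar sum as a residue. Since `v(v-r) - b(b+r) = (v-r-b)(v+b)` and `v(v-r) - b(b-r) =
(v-b)(v+b-r)`, the terms of `barSum` are, up to the factor `-2r`, the residues of the rational
function `∏_{j ≤ q} (z - j(j-r)) ∏_{b ∈ A} (z - b(b+r)) / (z - b(b-r))`. The first product is
designed for the parts below `r`: the map `b ↦ b(b-r)` identifies `j` with `r - j`, and a surviving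
pole there records a pair of parts with sum `r`. The sum of the residues is read off from the
expansion at infinity (`barSum_eq_coeff`).

The filtration. Logarithmic derivatives turn the coefficients of this expansion, and likewise the
moments of the transition measure, into polynomials in the odd power sums of the parts. For the
moments one uses that the zeros and poles attached to a part `b` are `1-b, b` and `1+b, -b`. Give
`R_{m+1}` and the `m`-th power sum degree `m`. Each product of at least two factors in Newton's
identities or in the cumulant formula loses a degree, so only the linear leading terms remain to be
compared. Induction on the degree (`moments_and_cumulants`, `barCoeff_add_mem`) expresses everything
through the spin free cumulants, with control both of the degree and of which cumulants occur. -/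

namespace SpinKerov
open Finset

/-! ### Products over unordered pairs of indices -/

section PairProducts

variable {ι M : Type*} [CommMonoid M]

/-- The product of `F i j` over the pairs of elements of `s` that are related by `R`. -/
def relProd (R : ι → ι → Prop) [DecidableRel R] (F : ι → ι → M) (s : Finset ι) : M :=
  ∏ i ∈ s, ∏ j ∈ s, if R i j then F i j else 1

/-- Up to factors equal to `1`, the relation `R` picks one orientation of every pair. -/
structure Orients (R : ι → ι → Prop) [DecidableRel R] (F : ι → ι → M) : Prop where
  irrefl : ∀ i, ¬ R i i
  mul_eq : ∀ i j, i ≠ j → (if R i j then F i j else 1) * (if R j i then F j i else 1) = F i j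

theorem relProd_empty (R : ι → ι → Prop) [DecidableRel R] (F : ι → ι → M) :
    relProd R F ∅ = 1 := by
  simp [relProd]

theorem relProd_insert [DecidableEq ι] {R : ι → ι → Prop} [DecidableRel R] {F : ι → ι → M}
    (h : Orients R F) {a : ι} {s : Finset ι} (ha : a ∉ s) :
    relProd R F (insert a s) = relProd R F s * ∏ j ∈ s, F a j := by
  rw [relProd, prod_insert ha, prod_insert ha, if_neg (h.irrefl a), one_mul]
  simp only [prod_insert ha]
  rw [prod_mul_distrib, ← mul_assoc, ← prod_mul_distrib, mul_comm, relProd]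
  congr 1
  refine prod_congr rfl fun i hi => h.mul_eq a i ?_
  rintro rfl
  exact ha hi

/-- Adjoining a point multiplies either product by the same factor, whatever the orientation. This
permits replacing the order of the variables by the order of the values placed on them. -/
theorem relProd_eq_relProd [DecidableEq ι] {R R' : ι → ι → Prop} [DecidableRel R]
    [DecidableRel R'] {F : ι → ι → M} (h : Orients R F) (h' : Orients R' F) (s : Finset ι) :
    relProd R F s = relProd R' F s := by
  induction s using Finset.induction_on with
  | empty => rw [relProd_empty, relProd_empty]
  | insert a s ha ih => rw [relProd_insert h ha, relProd_insert h' ha, ih]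

theorem orients_lt [LinearOrder ι] {F : ι → ι → M} (hF : ∀ i j, F i j = F j i) :
    Orients (fun i j : ι => i < j) F where
  irrefl := fun i => lt_irrefl i
  mul_eq := by
    intro i j hij
    rcases lt_or_gt_of_ne hij with h | h
    · rw [if_pos h, if_neg h.not_gt, mul_one]
    · rw [if_pos h, if_neg h.not_gt, one_mul, hF]

/-- The product of `F i j` over the pairs `i < j` of elements of `s`. -/
def pairProd [LinearOrder ι] (F : ι → ι → M) (s : Finset ι) : M :=
  relProd (fun i j : ι => i < j) F s

theorem pairProd_erase [LinearOrder ι] {F : ι → ι → M} (hF : ∀ i j, F i j = F j i) {a : ι}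
    {s : Finset ι} (ha : a ∈ s) :
    pairProd F s = pairProd F (s.erase a) * ∏ j ∈ s.erase a, F a j := by
  rw [pairProd, pairProd, ← relProd_insert (orients_lt hF) (notMem_erase a s), insert_erase ha]

theorem pairProd_congr [LinearOrder ι] {F G : ι → ι → M} {s : Finset ι}
    (h : ∀ i ∈ s, ∀ j ∈ s, F i j = G i j) : pairProd F s = pairProd G s :=
  prod_congr rfl fun i hi => prod_congr rfl fun j hj => by rw [h i hi j hj]

theorem pairProd_eq_zero [LinearOrder ι] {M₀ : Type*} [CommMonoidWithZero M₀] {F : ι → ι → M₀}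
    (hF : ∀ i j, F i j = F j i) {s : Finset ι} {a b : ι} (ha : a ∈ s) (hb : b ∈ s) (hab : a ≠ b)
    (h : F a b = 0) : pairProd F s = 0 := by
  rw [pairProd_erase hF ha, prod_eq_zero (mem_erase.2 ⟨hab.symm, hb⟩) h, mul_zero]

end PairProducts

/-! ### Partial fractions and the expansion of an odd power sum -/

section PartialFractions

variable {ι L : Type*} [Field L]

/-- The factor `(x_i + x_j) / (x_i - x_j)`. -/
def kap (x : ι → L) (i j : ι) : L := (x i + x j) / (x i - x j)

theorem kap_swap (x : ι → L) (i j : ι) : kap x j i = -kap x i j := by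
  rw [kap, kap, ← neg_sub (x i) (x j), div_neg, add_comm]

variable [DecidableEq ι]

/-- The numerator minus the denominator is a difference of two monic polynomials of the same degree,
so Lagrange interpolation at the `x s` recovers it. -/
theorem prod_add_div_sub_eq (x : ι → L) (S : Finset ι) (z : L) (hx : Set.InjOn x S)
    (hz : ∀ s ∈ S, z ≠ x s) :
    ∏ s ∈ S, (z + x s) / (z - x s) =
      1 + ∑ s ∈ S, 2 * x s / (z - x s) * ∏ t ∈ S.erase s, kap x s t := by
  have hdeg : (Lagrange.nodal S (fun s => -x s) - Lagrange.nodal S x).degree < S.card := by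
    have h := Polynomial.degree_sub_lt_left (p := Lagrange.nodal S (fun s => -x s))
      (q := Lagrange.nodal S x) (by rw [Lagrange.degree_nodal, Lagrange.degree_nodal])
      Lagrange.nodal_ne_zero (by
        rw [Lagrange.nodal_monic.leadingCoeff, Lagrange.nodal_monic.leadingCoeff])
    rwa [Lagrange.degree_nodal] at h
  have h2 := congrArg (Polynomial.eval z) (Lagrange.eq_interpolate hx hdeg)
  rw [Lagrange.eval_interpolate_not_at_node _ hz, Polynomial.eval_sub, Lagrange.eval_nodal,
    Lagrange.eval_nodal] at h2
  have hne : ∏ s ∈ S, (z - x s) ≠ 0 := prod_ne_zero_iff.2 fun s hs => sub_ne_zero.2 (hz s hs)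
  rw [prod_div_distrib, div_eq_iff hne]
  simp only [sub_neg_eq_add] at h2
  rw [sub_eq_iff_eq_add] at h2
  rw [h2, add_mul, one_mul, add_comm, mul_comm]
  congr 2
  refine sum_congr rfl fun s hs => ?_
  rw [Polynomial.eval_sub, Lagrange.eval_nodal_at_node hs, Lagrange.eval_nodal, sub_zero,
    ← mul_prod_erase S _ hs, Lagrange.nodalWeight]
  simp only [kap, prod_div_distrib, sub_neg_eq_add, prod_inv_distrib]
  ring

/-- At `z = -x m` the product in `prod_add_div_sub_eq` is the inverse of `∏ kap x m s`; multiply its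
expansion by `∏ kap x m s`. -/
theorem prod_kap_sub_sum (x : ι → L) (T : Finset ι) (m : ι) (hm : m ∉ T)
    (hx : Function.Injective x) (hx' : ∀ i j, x i + x j ≠ 0) :
    ∏ s ∈ T, kap x m s - ∑ m' ∈ T, 2 * x m' / (x m - x m') *
      ((∏ s ∈ T.erase m', kap x m s) * ∏ s ∈ T.erase m', kap x m' s) = 1 := by
  have hsub : ∀ s ∈ T, x m - x s ≠ 0 := fun s hs => sub_ne_zero.2 fun h => hm (hx h ▸ hs)
  have h := prod_add_div_sub_eq x T (-x m) hx.injOn fun s _ h => hx' m s (by rw [← h]; ring)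
  have e1 : (∏ s ∈ T, kap x m s) * ∏ s ∈ T, (-x m + x s) / (-x m - x s) = 1 := by
    rw [← prod_mul_distrib]
    refine prod_eq_one fun s hs => ?_
    have := hsub s hs
    have := hx' m s
    have : -x m - x s ≠ 0 := by intro h; apply hx' m s; linear_combination -h
    rw [kap]
    field_simp
    ring
  rw [h, mul_add, mul_one, mul_sum] at e1
  rw [← e1, sub_eq_add_neg, ← sum_neg_distrib]
  congr 1
  refine sum_congr rfl fun s hs => ?_
  rw [← mul_prod_erase T _ hs]
  have := hsub s hs
  have := hx' m s
  have : -x m - x s ≠ 0 := by intro h; apply hx' m s; linear_combination -h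
  generalize (∏ s_1 ∈ T.erase s, kap x m s_1) = P
  generalize (∏ s_1 ∈ T.erase s, kap x s s_1) = P'
  rw [kap]
  field_simp
  ring

theorem add_mul_alternating_sum (x y : L) (n : ℕ) (hn : Even n) :
    (x + y) * ∑ b ∈ range n, (-1) ^ (b + 1) * x ^ (n - b) * y ^ (b + 1) =
      -(x * y * (x ^ n - y ^ n)) := by
  have h := Commute.mul_geom_sum₂ (Commute.all x (-y)) n
  rw [Even.neg_pow hn, ← sum_range_reflect] at h
  rw [← h, sub_neg_eq_add, mul_left_comm, ← mul_neg]
  congr 1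
  rw [← neg_mul, mul_sum]
  refine sum_congr rfl fun b hb => ?_
  have hb := mem_range.1 hb
  rw [show n - b = (n - 1 - b) + 1 by omega, show n - 1 - (n - 1 - b) = b by omega,
    neg_pow y b]
  ring

/-- The power sum of odd degree in terms of the functions `P_{(a)}` and `P_{(a, b)}`. -/
theorem sum_pow_eq (x : ι → L) (S : Finset ι) (hx : Function.Injective x)
    (hx' : ∀ i j, x i + x j ≠ 0) {r : ℕ} (hr : Odd r) :
    ∑ m ∈ S, x m ^ r = ∑ m ∈ S, x m ^ r * ∏ s ∈ S.erase m, kap x m s +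
      ∑ m ∈ S, ∑ m' ∈ S.erase m, ∑ b ∈ range (r - 1),
        (-1) ^ (b + 1) * x m ^ (r - 1 - b) * x m' ^ (b + 1) * (kap x m m' *
          ((∏ s ∈ (S.erase m).erase m', kap x m s) *
            ∏ s ∈ (S.erase m).erase m', kap x m' s)) := by
  obtain ⟨q, rfl⟩ := hr
  -- Summing the alternating series over `b` leaves `-x y (x^{2q} - y^{2q}) / (x - y)`, which splits
  -- as `-G m m' - G m' m`. The double sum is therefore `-2 ∑ G`.
  set G : ι → ι → L := fun m m' => x m ^ (2 * q + 1) * x m' / (x m - x m') *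
    ((∏ s ∈ (S.erase m).erase m', kap x m s) * ∏ s ∈ (S.erase m).erase m', kap x m' s) with hG
  have h1 : ∀ m ∈ S, ∀ m' ∈ S.erase m, (∑ b ∈ range (2 * q + 1 - 1),
        (-1) ^ (b + 1) * x m ^ (2 * q + 1 - 1 - b) * x m' ^ (b + 1) * (kap x m m' *
          ((∏ s ∈ (S.erase m).erase m', kap x m s) *
            ∏ s ∈ (S.erase m).erase m', kap x m' s))) = -G m m' - G m' m := by
    intro m _ m' hm'
    have hne : x m - x m' ≠ 0 := sub_ne_zero.2 fun h => (mem_erase.1 hm').1 (hx h).symm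
    have hne' : x m' - x m ≠ 0 := by rw [← neg_sub]; exact neg_ne_zero.2 hne
    have h := add_mul_alternating_sum (x m) (x m') (2 * q) (even_two_mul q)
    rw [← sum_mul, add_tsub_cancel_right]
    simp only [hG, erase_right_comm (a := m') (b := m)]
    generalize (∏ s ∈ (S.erase m).erase m', kap x m s) = P
    generalize (∏ s ∈ (S.erase m).erase m', kap x m' s) = P'
    have e : ∀ T : L, T * (kap x m m' * (P * P')) =
        ((x m + x m') * T) / (x m - x m') * (P * P') := by
      intro T; rw [kap]; ring
    rw [e, h, mul_comm P' P, ← neg_sub (x m) (x m'), div_neg]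
    ring
  rw [sum_congr rfl fun m hm => sum_congr rfl (h1 m hm)]
  simp only [sum_sub_distrib, sum_neg_distrib]
  have h2 : ∑ m ∈ S, ∑ m' ∈ S.erase m, G m' m = ∑ m ∈ S, ∑ m' ∈ S.erase m, G m m' :=
    sum_comm' fun a b => by simp only [mem_erase]; tauto
  rw [h2, ← sub_eq_zero]
  -- Multiply the identity `prod_kap_sub_sum` for `T = S.erase m` by `x m ^ (2q+1)`.
  have h3 : ∀ m ∈ S, x m ^ (2 * q + 1) =
      x m ^ (2 * q + 1) * ∏ s ∈ S.erase m, kap x m s - 2 * ∑ m' ∈ S.erase m, G m m' := by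
    intro m _
    have h := prod_kap_sub_sum x (S.erase m) m (notMem_erase m S) hx hx'
    conv_lhs => rw [← mul_one (x m ^ (2 * q + 1)), ← h]
    rw [mul_sub, mul_sum, mul_sum]
    congr 1
    refine sum_congr rfl fun m' _ => ?_
    rw [hG]
    ring
  rw [sum_congr rfl h3, sum_sub_distrib, ← mul_sum]
  ring

end PartialFractions

/-! ### Weights and their multiplication by a power sum -/

section Weights

variable {ι L : Type*} [Field L]

/-- The factor of a pair of indices in the weight of `φ`. -/
def theta (x : ι → L) (φ : ι → ℕ) (i j : ι) : L :=
  if φ i = 0 ∧ φ j = 0 then 1 else ((φ i : L) - φ j) / ((φ i : L) + φ j) * kap x i j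

theorem theta_symm (x : ι → L) (φ : ι → ℕ) (i j : ι) : theta x φ i j = theta x φ j i := by
  simp only [theta, and_comm (a := φ j = 0)]
  rw [kap_swap x j i, ← neg_sub (φ j : L), add_comm (φ j : L), neg_div, neg_mul_neg]

theorem theta_of_ne_zero (x : ι → L) {φ : ι → ℕ} {i j : ι} (h : φ i ≠ 0) :
    theta x φ i j = ((φ i : L) - φ j) / ((φ i : L) + φ j) * kap x i j :=
  if_neg fun h' => h h'.1

variable [Fintype ι] [LinearOrder ι]

/-- The weight of a function `φ : ι → ℕ`; the sum of the weights of all `φ` with nonzero values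
`λ` is a multiple of `P_λ`. -/
def weight (x : ι → L) (φ : ι → ℕ) : L :=
  (∏ i, x i ^ φ i / ((φ i).factorial : L)) * pairProd (theta x φ) univ

/-- The contribution to `p_r ∑ weight` in which `r` is added to the value at `m`. -/
def addOne (r : ℕ) (x : ι → L) (ψ : ι → ℕ) (m : ι) : L :=
  (∏ i ∈ univ.erase m, x i ^ ψ i / ((ψ i).factorial : L)) *
    (x m ^ ψ m / ((ψ m - r).factorial : L)) * pairProd (theta x ψ) (univ.erase m) *
    ∏ s ∈ univ.erase m, (if ψ m = r ∧ ψ s = 0 then 1 else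
      ((ψ m : L) - r - ψ s) / ((ψ m : L) - r + ψ s)) * kap x m s

/-- The contribution to `p_r ∑ weight` in which the zero values at `m` and `m'` are replaced by
values with sum `r`. -/
def addTwo (x : ι → L) (ψ : ι → ℕ) (m m' : ι) : L :=
  (∏ i ∈ (univ.erase m).erase m', x i ^ ψ i / ((ψ i).factorial : L)) *
    ((-1) ^ ψ m' * x m ^ ψ m * x m' ^ ψ m') * pairProd (theta x ψ) ((univ.erase m).erase m') *
    (kap x m m' * ∏ s ∈ (univ.erase m).erase m', kap x m s * kap x m' s)

theorem mem_piAntidiag_univ {n : ℕ} {φ : ι → ℕ} : φ ∈ piAntidiag univ n ↔ ∑ i, φ i = n := by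
  simp

theorem sum_add_single (φ : ι → ℕ) (m : ι) (a : ℕ) :
    ∑ i, (φ + Pi.single m a : ι → ℕ) i = ∑ i, φ i + a := by
  simp [sum_add_distrib]

/-- Everything in `addOne` is written in terms of the new function `ψ`, with `ψ m - r` in the place
of the old value. If the old value is zero, the extra factors `kap` are those missing from `theta`,
which is `1` between two zeros; the conditional in `addOne` supplies `1` where the quotient would be
`0 / 0`. -/
theorem weight_mul_eq_addOne [CharZero L] (r : ℕ) (x : ι → L) (φ : ι → ℕ) (m : ι) :
    weight x φ * (x m ^ r * if φ m = 0 then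
      ∏ s ∈ (univ.filter fun s => φ s = 0).erase m, kap x m s else 1) =
      addOne r x (φ + Pi.single m r : ι → ℕ) m := by
  have hm : (φ + Pi.single m r : ι → ℕ) m = φ m + r := by simp
  have hs : ∀ s ∈ univ.erase m, (φ + Pi.single m r : ι → ℕ) s = φ s := by
    intro s hs
    simp [Pi.single_eq_of_ne (mem_erase.1 hs).1]
  have hθ : ∀ i ∈ univ.erase m, ∀ j ∈ univ.erase m,
      theta x (φ + Pi.single m r) i j = theta x φ i j := by
    intro i hi j hj
    simp only [theta, hs i hi, hs j hj]
  have hp : ∏ i ∈ univ.erase m, x i ^ (φ + Pi.single m r : ι → ℕ) i /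
      (((φ + Pi.single m r : ι → ℕ) i).factorial : L) =
      ∏ i ∈ univ.erase m, x i ^ φ i / ((φ i).factorial : L) :=
    prod_congr rfl fun i hi => by rw [hs i hi]
  rw [weight, addOne, pairProd_erase (theta_symm x φ) (mem_univ m), hm, add_tsub_cancel_right,
    pairProd_congr hθ, hp, ← mul_prod_erase univ _ (mem_univ m), pow_add]
  have h : (∏ s ∈ univ.erase m, theta x φ m s) * (if φ m = 0 then
      ∏ s ∈ (univ.filter fun s => φ s = 0).erase m, kap x m s else 1) =
      ∏ s ∈ univ.erase m, (if φ m + r = r ∧ (φ + Pi.single m r : ι → ℕ) s = 0 then 1 else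
      (((φ m + r : ℕ) : L) - r - (φ + Pi.single m r : ι → ℕ) s) /
        (((φ m + r : ℕ) : L) - r + (φ + Pi.single m r : ι → ℕ) s)) * kap x m s := by
    have e : (if φ m = 0 then ∏ s ∈ (univ.filter fun s => φ s = 0).erase m, kap x m s else 1) =
        ∏ s ∈ univ.erase m, if φ m = 0 ∧ φ s = 0 then kap x m s else 1 := by
      split_ifs with h0
      · simp only [h0, true_and]
        rw [← prod_filter, filter_erase]
      · simp [h0]
    rw [e, ← prod_mul_distrib]
    refine prod_congr rfl fun s h => ?_
    rw [hs s h, theta]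
    by_cases h0 : φ m = 0 <;> by_cases h1 : φ s = 0 <;> simp [h0, h1]
  rw [← h]
  ring

/-- The old values at `m` and `m'` vanish, so `theta x φ m s` is `kap x m s` for `φ s ≠ 0` and `1`
for `φ s = 0`. The given products over the zeros of `φ` complete it to `kap` everywhere. -/
theorem weight_mul_eq_addTwo (x : ι → L) (φ : ι → ℕ) (m m' : ι) (a b : ℕ) (hne : m' ≠ m)
    (hm : φ m = 0) (hm' : φ m' = 0) [CharZero L] :
    weight x φ * ((-1) ^ b * x m ^ a * x m' ^ b * (kap x m m' *
      ((∏ s ∈ ((univ.filter fun s => φ s = 0).erase m).erase m', kap x m s) *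
        ∏ s ∈ ((univ.filter fun s => φ s = 0).erase m).erase m', kap x m' s))) =
      addTwo x (φ + Pi.single m a + Pi.single m' b : ι → ℕ) m m' := by
  set T := (univ.erase m).erase m' with hT
  have hmT : m' ∈ univ.erase m := mem_erase.2 ⟨hne, mem_univ _⟩
  have e1 : (φ + Pi.single m a + Pi.single m' b : ι → ℕ) m = a := by
    simp [hm, Pi.single_eq_of_ne hne.symm]
  have e2 : (φ + Pi.single m a + Pi.single m' b : ι → ℕ) m' = b := by
    simp [hm', Pi.single_eq_of_ne hne]
  have hs : ∀ s ∈ T, (φ + Pi.single m a + Pi.single m' b : ι → ℕ) s = φ s := by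
    intro s hs
    have h1 := mem_erase.1 hs
    simp [Pi.single_eq_of_ne h1.1, Pi.single_eq_of_ne (mem_erase.1 h1.2).1]
  have hθ : ∀ i ∈ T, ∀ j ∈ T,
      theta x (φ + Pi.single m a + Pi.single m' b) i j = theta x φ i j := by
    intro i hi j hj
    simp only [theta, hs i hi, hs j hj]
  have hp : ∏ i ∈ T, x i ^ (φ + Pi.single m a + Pi.single m' b : ι → ℕ) i /
      (((φ + Pi.single m a + Pi.single m' b : ι → ℕ) i).factorial : L) =
      ∏ i ∈ T, x i ^ φ i / ((φ i).factorial : L) :=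
    prod_congr rfl fun i hi => by rw [hs i hi]
  have hprod : ∏ i, x i ^ φ i / ((φ i).factorial : L) =
      ∏ i ∈ T, x i ^ φ i / ((φ i).factorial : L) := by
    rw [← mul_prod_erase univ _ (mem_univ m), ← mul_prod_erase _ _ hmT, hm, hm', ← hT]
    simp
  rw [weight, hprod, addTwo, pairProd_erase (theta_symm x φ) (mem_univ m),
    pairProd_erase (theta_symm x φ) hmT, e1, e2, ← hT,
    pairProd_congr hθ, hp, ← mul_prod_erase _ (fun s => theta x φ m s) hmT, ← hT]
  have key : (∏ s ∈ T, theta x φ m s) * (∏ s ∈ T, theta x φ m' s) *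
      ((∏ s ∈ ((univ.filter fun s => φ s = 0).erase m).erase m', kap x m s) *
        ∏ s ∈ ((univ.filter fun s => φ s = 0).erase m).erase m', kap x m' s) =
      ∏ s ∈ T, kap x m s * kap x m' s := by
    have e : ((univ.filter fun s => φ s = 0).erase m).erase m' = T.filter fun s => φ s = 0 := by
      rw [hT, filter_erase, filter_erase]
    rw [e, prod_filter, prod_filter, ← prod_mul_distrib, ← prod_mul_distrib, ← prod_mul_distrib]
    refine prod_congr rfl fun s _ => ?_
    rw [theta, theta, hm, hm']
    by_cases h1 : φ s = 0
    · simp [h1]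
    · have : (φ s : L) ≠ 0 := Nat.cast_ne_zero.2 h1
      simp [h1, this]
  have e3 : theta x φ m m' = 1 := by simp [theta, hm, hm']
  rw [← key, e3]
  simp only [one_mul]
  ring

theorem sum_addOne (r n : ℕ) (f : (ι → ℕ) → ι → L) :
    ∑ φ ∈ piAntidiag univ n, ∑ m, f (φ + Pi.single m r : ι → ℕ) m =
      ∑ ψ ∈ piAntidiag univ (n + r), ∑ m, if r ≤ ψ m then f ψ m else 0 := by
  rw [sum_comm, sum_comm (s := piAntidiag univ (n + r))]
  refine sum_congr rfl fun m _ => ?_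
  rw [← sum_filter]
  refine sum_bij' (fun φ _ => φ + Pi.single m r) (fun ψ _ => ψ - Pi.single m r) ?_ ?_ ?_ ?_ ?_
  · intro φ hφ
    simp only [mem_piAntidiag_univ, mem_filter] at hφ ⊢
    rw [sum_add_single, hφ]
    exact ⟨rfl, by simp⟩
  · intro ψ hψ
    simp only [mem_piAntidiag_univ, mem_filter] at hψ ⊢
    have h : ∑ i, ((ψ - Pi.single m r : ι → ℕ) i + (Pi.single m r : ι → ℕ) i) = ∑ i, ψ i := by
      refine sum_congr rfl fun i _ => ?_
      rcases eq_or_ne i m with rfl | hi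
      · simp [hψ.2]
      · simp [Pi.single_eq_of_ne hi]
    rw [sum_add_distrib] at h
    simp only [sum_pi_single', mem_univ, if_true] at h
    omega
  · intro φ _
    ext i
    simp
  · intro ψ hψ
    ext i
    rcases eq_or_ne i m with rfl | hi
    · simp [(mem_filter.1 hψ).2]
    · simp [Pi.single_eq_of_ne hi]
  · intro φ _
    rfl

/-- The pair `(φ, b)` is recovered from `ψ`: erase the values at `m` and `m'`, and take `b = ψ m' -
1`. Positivity of both new values matches the range of `b`. -/
theorem sum_addTwo (r n : ℕ) (f : (ι → ℕ) → ι → ι → L) :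
    ∑ φ ∈ piAntidiag univ n, ∑ m ∈ univ.filter (fun s => φ s = 0),
      ∑ m' ∈ (univ.filter fun s => φ s = 0).erase m, ∑ b ∈ range (r - 1),
        f (φ + Pi.single m (r - 1 - b) + Pi.single m' (b + 1)) m m' =
      ∑ ψ ∈ piAntidiag univ (n + r), ∑ m, ∑ m', if m' ≠ m ∧ 0 < ψ m ∧ 0 < ψ m' ∧ ψ m + ψ m' = r
        then f ψ m m' else 0 := by
  have h1 : ∀ φ : ι → ℕ, ∑ m ∈ univ.filter (fun s => φ s = 0),
      ∑ m' ∈ (univ.filter fun s => φ s = 0).erase m, ∑ b ∈ range (r - 1),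
        f (φ + Pi.single m (r - 1 - b) + Pi.single m' (b + 1)) m m' =
      ∑ m, ∑ m', if m' ≠ m ∧ φ m = 0 ∧ φ m' = 0 then ∑ b ∈ range (r - 1),
        f (φ + Pi.single m (r - 1 - b) + Pi.single m' (b + 1)) m m' else 0 := by
    intro φ
    rw [sum_filter]
    refine sum_congr rfl fun m _ => ?_
    split_ifs with h
    · rw [← sum_filter]
      refine sum_congr ?_ fun _ _ => rfl
      ext m'
      simp [h]
    · simp [h]
  simp only [h1]
  rw [sum_comm, sum_comm (s := piAntidiag univ (n + r))]
  refine sum_congr rfl fun m _ => ?_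
  rw [sum_comm, sum_comm (s := piAntidiag univ (n + r))]
  refine sum_congr rfl fun m' _ => ?_
  rw [← sum_filter, ← sum_filter, ← sum_product']
  refine sum_bij' (fun p _ => p.1 + Pi.single m (r - 1 - p.2) + Pi.single m' (p.2 + 1))
    (fun ψ _ => (ψ - Pi.single m (ψ m) - Pi.single m' (ψ m'), ψ m' - 1)) ?_ ?_ ?_ ?_ ?_
  · rintro ⟨φ, b⟩ h
    simp only [mem_product, mem_piAntidiag_univ, mem_filter,
      mem_range] at h ⊢
    obtain ⟨⟨h1, h2, h3, h4⟩, h5⟩ := h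
    rw [sum_add_single, sum_add_single]
    simp only [Pi.add_apply, Pi.single_eq_same, Pi.single_eq_of_ne h2, Pi.single_eq_of_ne h2.symm]
    exact ⟨by omega, h2, by omega, by omega, by omega⟩
  · intro ψ h
    simp only [mem_product, mem_piAntidiag_univ, mem_filter,
      mem_range] at h ⊢
    obtain ⟨h1, h2, h3, h4, h5⟩ := h
    have h : ∑ i, ((ψ - Pi.single m (ψ m) - Pi.single m' (ψ m') : ι → ℕ) i +
        (Pi.single m (ψ m) : ι → ℕ) i + (Pi.single m' (ψ m') : ι → ℕ) i) = ∑ i, ψ i := by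
      refine sum_congr rfl fun i _ => ?_
      rcases eq_or_ne i m with rfl | hi
      · simp [Pi.single_eq_of_ne h2.symm]
      · rcases eq_or_ne i m' with rfl | hi'
        · simp [Pi.single_eq_of_ne h2]
        · simp [Pi.single_eq_of_ne hi, Pi.single_eq_of_ne hi']
    rw [sum_add_distrib, sum_add_distrib] at h
    simp only [sum_pi_single', mem_univ, if_true] at h
    refine ⟨⟨by omega, h2, ?_, ?_⟩, by omega⟩
    · simp
    · simp
  · rintro ⟨φ, b⟩ h
    simp only [mem_product, mem_filter, mem_range] at h
    obtain ⟨⟨h1, h2, h3, h4⟩, h5⟩ := h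
    ext i
    · rcases eq_or_ne i m with rfl | hi
      · simp [Pi.single_eq_of_ne h2.symm, h3]
      · rcases eq_or_ne i m' with rfl | hi'
        · simp [Pi.single_eq_of_ne h2, h4]
        · simp [Pi.single_eq_of_ne hi, Pi.single_eq_of_ne hi']
    · simp [Pi.single_eq_of_ne h2, h4]
  · intro ψ h
    simp only [mem_filter] at h
    obtain ⟨h1, h2, h3, h4, h5⟩ := h
    ext i
    rcases eq_or_ne i m with rfl | hi
    · simp [Pi.single_eq_of_ne h2.symm]
      omega
    · rcases eq_or_ne i m' with rfl | hi'
      · simp [Pi.single_eq_of_ne h2]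
        omega
      · simp [Pi.single_eq_of_ne hi, Pi.single_eq_of_ne hi']
  · rintro ⟨φ, b⟩ _
    rfl

/-- The coefficient of `x^ψ` in `p_r ∑ weight`, before simplification. -/
def bracket (r : ℕ) (x : ι → L) (ψ : ι → ℕ) : L :=
  (∑ m, if r ≤ ψ m then addOne r x ψ m else 0) +
    ∑ m, ∑ m', if m' ≠ m ∧ 0 < ψ m ∧ 0 < ψ m' ∧ ψ m + ψ m' = r then addTwo x ψ m m' else 0

/-- For each `φ` the variables are separated by whether `φ` vanishes. Only the partial power sum
over the zeros of `φ` is expanded by `sum_pow_eq`; elsewhere `x_m^r` already raises a part. -/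
theorem sum_pow_mul_sum_weight [CharZero L] (x : ι → L) (hx : Function.Injective x)
    (hx' : ∀ i j, x i + x j ≠ 0) {r : ℕ} (hr : Odd r) (n : ℕ) :
    (∑ m, x m ^ r) * ∑ φ ∈ piAntidiag univ n, weight x φ =
      ∑ ψ ∈ piAntidiag univ (n + r), bracket r x ψ := by
  simp only [bracket]
  rw [sum_add_distrib, ← sum_addOne r n (addOne r x), ← sum_addTwo r n (addTwo x),
    ← sum_add_distrib, mul_sum]
  refine sum_congr rfl fun φ _ => ?_
  rw [mul_comm, ← sum_filter_add_sum_filter_not univ (fun s => φ s = 0) fun m => x m ^ r,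
    sum_pow_eq x (univ.filter fun s => φ s = 0) hx hx' hr, mul_add, mul_add, add_right_comm]
  congr 1
  · have h := sum_filter_add_sum_filter_not univ (fun s => φ s = 0)
      (fun m => addOne r x (φ + Pi.single m r : ι → ℕ) m)
    rw [← h, mul_sum, mul_sum]
    congr 1
    · refine sum_congr rfl fun m hm => ?_
      rw [← weight_mul_eq_addOne, if_pos (mem_filter.1 hm).2]
    · refine sum_congr rfl fun m hm => ?_
      rw [← weight_mul_eq_addOne, if_neg (mem_filter.1 hm).2, mul_one]
  · rw [mul_sum]
    refine sum_congr rfl fun m hm => ?_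
    rw [mul_sum]
    refine sum_congr rfl fun m' hm' => ?_
    rw [mul_sum]
    refine sum_congr rfl fun b _ => ?_
    have h := mem_erase.1 hm'
    exact weight_mul_eq_addTwo x φ m m' _ _ h.1 (mem_filter.1 hm).2 (mem_filter.1 h.2).2

end Weights

/-! ### Cancellation at repeated values, and the bar sum -/

section Bracket

variable {ι L : Type*} [Field L] [Fintype ι] [LinearOrder ι]

/-- With equal values at `i` and `j`, the factors pairing them with the other indices agree on the
two sides; only `kap x i j` is left, and it changes sign. -/
theorem addOne_swap (r : ℕ) (x : ι → L) {ψ : ι → ℕ} {i j : ι} (hij : i ≠ j)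
    (h : ψ i = ψ j) (h0 : ψ i ≠ 0) : addOne r x ψ i = -addOne r x ψ j := by
  have hji : j ∈ univ.erase i := mem_erase.2 ⟨hij.symm, mem_univ _⟩
  have hij' : i ∈ univ.erase j := mem_erase.2 ⟨hij, mem_univ _⟩
  have h0' : ψ j ≠ 0 := h ▸ h0
  rw [addOne, addOne, ← mul_prod_erase _ _ hji, ← mul_prod_erase _ _ hij',
    pairProd_erase (theta_symm x ψ) hji, pairProd_erase (theta_symm x ψ) hij',
    ← mul_prod_erase _ (fun s => (if ψ i = r ∧ ψ s = 0 then (1 : L) else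
      ((ψ i : L) - r - ψ s) / ((ψ i : L) - r + ψ s)) * kap x i s) hji,
    ← mul_prod_erase _ (fun s => (if ψ j = r ∧ ψ s = 0 then (1 : L) else
      ((ψ j : L) - r - ψ s) / ((ψ j : L) - r + ψ s)) * kap x j s) hij',
    erase_right_comm (a := j) (b := i)]
  have key : (∏ s ∈ (univ.erase i).erase j, theta x ψ j s) *
      (∏ s ∈ (univ.erase i).erase j, (if ψ i = r ∧ ψ s = 0 then (1 : L) else
      ((ψ i : L) - r - ψ s) / ((ψ i : L) - r + ψ s)) * kap x i s) =
      (∏ s ∈ (univ.erase i).erase j, theta x ψ i s) *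
      (∏ s ∈ (univ.erase i).erase j, (if ψ j = r ∧ ψ s = 0 then (1 : L) else
      ((ψ j : L) - r - ψ s) / ((ψ j : L) - r + ψ s)) * kap x j s) := by
    rw [← prod_mul_distrib, ← prod_mul_distrib]
    refine prod_congr rfl fun s _ => ?_
    rw [theta_of_ne_zero x h0, theta_of_ne_zero x h0', h]
    ring
  rw [kap_swap x i j, h] at *
  linear_combination (x i ^ ψ j / ((ψ j).factorial : L)) *
    (x j ^ ψ j / ((ψ j - r).factorial : L)) *
    (∏ s ∈ (univ.erase i).erase j, x s ^ ψ s / ((ψ s).factorial : L)) *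
    (x j ^ 0) * pairProd (theta x ψ) ((univ.erase i).erase j) * ((if ψ j = r ∧ ψ j = 0 then (1 : L)
      else ((ψ j : L) - r - ψ j) / ((ψ j : L) - r + ψ j)) * kap x i j) * key

/-- As in `addOne_swap`, the pairings with the remaining indices agree. The three factors `kap`
among `i`, `j`, `l` produce the sign. -/
theorem addTwo_swap (x : ι → L) {ψ : ι → ℕ} {i j l : ι} (hij : i ≠ j) (hli : l ≠ i)
    (hlj : l ≠ j) (h : ψ i = ψ j) (h0 : ψ i ≠ 0) : addTwo x ψ i l = -addTwo x ψ j l := by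
  have hji : j ∈ (univ.erase i).erase l := by simp [hij.symm, hlj.symm]
  have hij' : i ∈ (univ.erase j).erase l := by simp [hij, hli.symm]
  have h0' : ψ j ≠ 0 := h ▸ h0
  have e : ((univ.erase j).erase l).erase i = ((univ.erase i).erase l).erase j := by
    ext s; simp only [mem_erase]; tauto
  rw [addTwo, addTwo, ← mul_prod_erase _ _ hji, ← mul_prod_erase _ _ hij',
    pairProd_erase (theta_symm x ψ) hji, pairProd_erase (theta_symm x ψ) hij',
    ← mul_prod_erase _ (fun s => kap x i s * kap x l s) hji,
    ← mul_prod_erase _ (fun s => kap x j s * kap x l s) hij', e]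
  set T := ((univ.erase i).erase l).erase j
  have key : (∏ s ∈ T, theta x ψ j s) * (∏ s ∈ T, kap x i s * kap x l s) =
      (∏ s ∈ T, theta x ψ i s) * (∏ s ∈ T, kap x j s * kap x l s) := by
    rw [← prod_mul_distrib, ← prod_mul_distrib]
    refine prod_congr rfl fun s _ => ?_
    rw [theta_of_ne_zero x h0, theta_of_ne_zero x h0', h]
    ring
  rw [kap_swap x i j, kap_swap x i l, kap_swap x j l, h]
  linear_combination (-(x i ^ ψ j / ((ψ j).factorial : L)) *
    (∏ s ∈ T, x s ^ ψ s / ((ψ s).factorial : L)) * ((-1) ^ ψ l * x j ^ ψ j * x l ^ ψ l) *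
    pairProd (theta x ψ) T * kap x i j * kap x i l * kap x j l) * key

/-- Two signs compensate: `kap` is antisymmetric, and `(-1)^(ψ i) = -(-1)^(ψ j)` by the parity of
the sum. This is one place where oddness of `r` enters. -/
theorem addTwo_symm (x : ι → L) {ψ : ι → ℕ} {i j : ι} (h : Odd (ψ i + ψ j)) :
    addTwo x ψ i j = addTwo x ψ j i := by
  rw [addTwo, addTwo, erase_right_comm (a := j) (b := i), kap_swap x i j]
  have h1 : (-1 : L) ^ ψ i = -(-1) ^ ψ j := by
    have := h.neg_one_pow (α := L)
    rw [pow_add] at this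
    rcases neg_one_pow_eq_or L (ψ j) with e | e <;> rw [e] at this ⊢
    · linear_combination this
    · linear_combination -this
  rw [h1, prod_congr rfl fun s _ => mul_comm (kap x j s) (kap x i s)]
  ring

theorem theta_eq_zero (x : ι → L) {ψ : ι → ℕ} {i j : ι} (h : ψ i = ψ j) (h0 : ψ i ≠ 0) :
    theta x ψ i j = 0 := by
  rw [theta_of_ne_zero x h0, h, sub_self, zero_div, zero_mul]

theorem weight_eq_zero (x : ι → L) {ψ : ι → ℕ} {i j : ι} (hij : i ≠ j) (h : ψ i = ψ j)
    (h0 : ψ i ≠ 0) : weight x ψ = 0 := by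
  rw [weight, pairProd_eq_zero (theta_symm x ψ) (mem_univ i) (mem_univ j) hij
    (theta_eq_zero x h h0), mul_zero]

theorem addOne_eq_zero (r : ℕ) (x : ι → L) {ψ : ι → ℕ} {i j m : ι} (hij : i ≠ j) (h : ψ i = ψ j)
    (h0 : ψ i ≠ 0) (hi : m ≠ i) (hj : m ≠ j) : addOne r x ψ m = 0 := by
  rw [addOne, pairProd_eq_zero (theta_symm x ψ) (mem_erase.2 ⟨hi.symm, mem_univ i⟩)
    (mem_erase.2 ⟨hj.symm, mem_univ j⟩) hij (theta_eq_zero x h h0), mul_zero, zero_mul]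

theorem addTwo_eq_zero (x : ι → L) {ψ : ι → ℕ} {i j m m' : ι} (hij : i ≠ j) (h : ψ i = ψ j)
    (h0 : ψ i ≠ 0) (hi : m ≠ i) (hj : m ≠ j) (hi' : m' ≠ i) (hj' : m' ≠ j) :
    addTwo x ψ m m' = 0 := by
  rw [addTwo, pairProd_eq_zero (theta_symm x ψ) (by simp [hi.symm, hi'.symm] :
    i ∈ (univ.erase m).erase m') (by simp [hj.symm, hj'.symm]) hij (theta_eq_zero x h h0),
    mul_zero, zero_mul]

theorem sum_eq_zero_of_pair (f : ι → L) {i j : ι} (hij : i ≠ j)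
    (h : ∀ m, m ≠ i → m ≠ j → f m = 0) (h' : f i + f j = 0) : ∑ m, f m = 0 := by
  rw [sum_eq_add_of_mem i j (mem_univ _) (mem_univ _) hij fun c _ hc => h c hc.1 hc.2, h']

/-- If neither `i` nor `j` is touched by the move, the factor `theta x ψ i j = 0` survives. The
moves that touch exactly one of them cancel in pairs, and a move touching both would need `2 ψ i =
r`, against parity. -/
theorem bracket_eq_zero {r : ℕ} (hr : Odd r) (x : ι → L) {ψ : ι → ℕ} {i j : ι} (hij : i ≠ j)
    (h : ψ i = ψ j) (h0 : ψ i ≠ 0) : bracket r x ψ = 0 := by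
  obtain ⟨q, hq⟩ := hr
  have e1 : (∑ m, if r ≤ ψ m then addOne r x ψ m else 0) = 0 := by
    refine sum_eq_zero_of_pair _ hij (fun m hi hj => ?_) ?_
    · rw [addOne_eq_zero r x hij h h0 hi hj, ite_self]
    · rw [addOne_swap r x hij h h0, h]
      split_ifs <;> ring
  set F : ι → ι → L := fun m m' =>
    if m' ≠ m ∧ 0 < ψ m ∧ 0 < ψ m' ∧ ψ m + ψ m' = r then addTwo x ψ m m' else 0 with hF
  have hsymm : ∀ m m', F m m' = F m' m := by
    intro m m'
    simp only [hF]
    by_cases hc : m' ≠ m ∧ 0 < ψ m ∧ 0 < ψ m' ∧ ψ m + ψ m' = r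
    · rw [if_pos hc, if_pos ⟨hc.1.symm, hc.2.2.1, hc.2.1, by omega⟩,
        addTwo_symm x (by rw [hc.2.2.2]; exact ⟨q, hq⟩)]
    · rw [if_neg hc, if_neg]
      rintro ⟨h1, h2, h3, h4⟩
      exact hc ⟨h1.symm, h3, h2, by omega⟩
  have hpair : ∀ l, F i l + F j l = 0 := by
    intro l
    simp only [hF]
    by_cases hli : l = i
    · subst hli
      rw [if_neg (by simp), if_neg (by omega), add_zero]
    by_cases hlj : l = j
    · subst hlj
      rw [if_neg (by omega), if_neg (by simp), add_zero]
    rw [addTwo_swap x hij hli hlj h h0, h]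
    simp only [ne_eq, hli, hlj, not_false_eq_true, true_and]
    split_ifs <;> ring
  have e2 : ∑ m, ∑ m', F m m' = 0 := by
    refine sum_eq_zero_of_pair _ hij (fun m hi hj => ?_) ?_
    · refine sum_eq_zero_of_pair _ hij (fun m' hi' hj' => ?_) ?_
      · simp only [hF]
        rw [addTwo_eq_zero x hij h h0 hi hj hi' hj', ite_self]
      · rw [hsymm, hsymm m j, hpair]
    · rw [← sum_add_distrib]
      exact sum_eq_zero fun l _ => hpair l
  rw [bracket, e1, e2, add_zero]

/-- The nonzero values of `ψ`. -/
def valueSet (ψ : ι → ℕ) : Finset ℕ := (univ.filter fun i => ψ i ≠ 0).image ψ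

/-- The relative weight of the term in which the part `a` of `A` arises by adding `r`. -/
def oneTerm (r : ℕ) (A : Finset ℕ) (a : ℕ) : ℚ :=
  (a.descFactorial r : ℚ) *
    ∏ b ∈ A.erase a, (((a : ℚ) - r - b) * (a + b)) / (((a : ℚ) - r + b) * (a - b))

/-- The relative weight of the term in which the parts `a` and `b` of `A` are new. -/
def twoTerm (A : Finset ℕ) (a b : ℕ) : ℚ :=
  (-1) ^ b * a.factorial * b.factorial * (((a : ℚ) + b) / (a - b)) *
    ∏ c ∈ (A.erase a).erase b, (((a : ℚ) + c) * (b + c)) / (((a : ℚ) - c) * (b - c))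

/-- The eigenvalue of the one-row character of degree `r` at the strict partition with parts `A`,
as a sum over the ways to remove an odd bar. -/
def barSum (r : ℕ) (A : Finset ℕ) : ℚ :=
  (∑ a ∈ A, if r ≤ a then oneTerm r A a else 0) +
    ∑ a ∈ A, if 0 < a ∧ a < r ∧ r - a ∈ A then twoTerm A a (r - a) else 0

theorem prod_valueSet {M : Type*} [CommMonoid M] {ψ : ι → ℕ}
    (hinj : ∀ i j, ψ i = ψ j → ψ i ≠ 0 → i = j) (g : ℕ → M) (h0 : g 0 = 1) :
    ∏ i, g (ψ i) = ∏ a ∈ valueSet ψ, g a := by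
  rw [valueSet, prod_image, prod_filter]
  · refine prod_congr rfl fun i _ => ?_
    split_ifs with h
    · rfl
    · rw [not_not.1 h, h0]
  · intro i hi j _ h
    exact hinj i j h (mem_filter.1 hi).2

theorem sum_valueSet {M : Type*} [AddCommMonoid M] {ψ : ι → ℕ}
    (hinj : ∀ i j, ψ i = ψ j → ψ i ≠ 0 → i = j) (g : ℕ → M) (h0 : g 0 = 0) :
    ∑ i, g (ψ i) = ∑ a ∈ valueSet ψ, g a :=
  prod_valueSet (M := Multiplicative M) hinj g h0

theorem mem_valueSet {ψ : ι → ℕ} {a : ℕ} : a ∈ valueSet ψ ↔ a ≠ 0 ∧ ∃ i, ψ i = a := by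
  simp only [valueSet, mem_image, mem_filter, mem_univ, true_and]
  constructor
  · rintro ⟨i, h, rfl⟩; exact ⟨h, i, rfl⟩
  · rintro ⟨h, i, rfl⟩; exact ⟨i, h, rfl⟩

/-- Zeros contribute `1` and a nonzero value determines its index; `B` is the set of values removed
along with the indices outside `U`. -/
theorem prod_erase_valueSet {M : Type*} [CommMonoid M] {ψ : ι → ℕ}
    (hinj : ∀ i j, ψ i = ψ j → ψ i ≠ 0 → i = j) (g : ℕ → M) (h0 : g 0 = 1) (U : Finset ι)
    (B : Finset ℕ) (hU : ∀ i, ψ i ≠ 0 → (i ∉ U ↔ ψ i ∈ B)) :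
    ∏ i ∈ U, g (ψ i) = ∏ a ∈ valueSet ψ \ B, g a := by
  have e : valueSet ψ \ B = (U.filter fun i => ψ i ≠ 0).image ψ := by
    ext a
    simp only [mem_sdiff, mem_valueSet, mem_image, mem_filter]
    constructor
    · rintro ⟨⟨h, i, rfl⟩, h'⟩
      exact ⟨i, ⟨not_not.1 fun hi => h' ((hU i h).1 hi), h⟩, rfl⟩
    · rintro ⟨i, ⟨hi, h⟩, rfl⟩
      exact ⟨⟨h, i, rfl⟩, fun h' => (hU i h).2 h' hi⟩
  rw [e, prod_image, prod_filter]
  · refine prod_congr rfl fun i _ => ?_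
    split_ifs with h
    · rfl
    · rw [not_not.1 h, h0]
  · intro i hi j _ h
    exact hinj i j h (mem_filter.1 hi).2

variable [CharZero L]

/-- The variables enter `addOne` and `weight` in the same way, so their ratio is a number: the
factorials give the falling factorial and the pairs give `oneTerm`. A zero of `ψ` contributes `1`,
including when `ψ m = r`. -/
theorem addOne_eq_weight_mul {r : ℕ} (hr : 0 < r) (x : ι → L) {ψ : ι → ℕ}
    (hinj : ∀ i j, ψ i = ψ j → ψ i ≠ 0 → i = j) {m : ι} (hm : r ≤ ψ m) :
    addOne r x ψ m = weight x ψ * (oneTerm r (valueSet ψ) (ψ m) : ℚ) := by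
  have hm0 : ψ m ≠ 0 := by omega
  set g : ℕ → L := fun b => if b = 0 then 1 else
    (((ψ m : L) - r - b) * (ψ m + b)) / (((ψ m : L) - r + b) * (ψ m - b)) with hg
  have h1 : ((oneTerm r (valueSet ψ) (ψ m) : ℚ) : L) =
      ((ψ m).descFactorial r : L) * ∏ s ∈ univ.erase m, g (ψ s) := by
    rw [prod_erase_valueSet hinj g (by simp [hg]) (univ.erase m) {ψ m}]
    · rw [oneTerm, sdiff_singleton_eq_erase]
      push_cast
      congr 1
      refine prod_congr rfl fun b hb => ?_
      have hb0 : b ≠ 0 := (mem_valueSet.1 (mem_erase.1 hb).2).1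
      simp only [hg, if_neg hb0]
    · intro i hi
      simp only [mem_erase, mem_univ, and_true, mem_singleton, not_not]
      exact ⟨fun h => h ▸ rfl, fun h => hinj i m h hi⟩
  have h2 : ∏ s ∈ univ.erase m, (if ψ m = r ∧ ψ s = 0 then (1 : L) else
      ((ψ m : L) - r - ψ s) / ((ψ m : L) - r + ψ s)) * kap x m s =
      (∏ s ∈ univ.erase m, theta x ψ m s) * ∏ s ∈ univ.erase m, g (ψ s) := by
    rw [← prod_mul_distrib]
    refine prod_congr rfl fun s hs => ?_
    rw [theta_of_ne_zero x hm0]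
    by_cases hs0 : ψ s = 0
    · have : (ψ m : L) ≠ 0 := Nat.cast_ne_zero.2 hm0
      by_cases hmr : ψ m = r
      · simp [hs0, hg, hmr, hr.ne']
      · have : (ψ m : L) - r ≠ 0 := sub_ne_zero.2 (by exact_mod_cast hmr)
        simp only [hs0, hg, hmr, and_true, if_true, if_false, Nat.cast_zero, sub_zero, add_zero,
          mul_one, div_self this, div_self ‹(ψ m : L) ≠ 0›]
    · have h3 : (ψ m : L) - ψ s ≠ 0 := by
        refine sub_ne_zero.2 fun h => (mem_erase.1 hs).1 ?_
        exact hinj s m (by exact_mod_cast h.symm) hs0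
      have h4 : (ψ m : L) + ψ s ≠ 0 := by
        have : ((ψ m + ψ s : ℕ) : L) ≠ 0 := Nat.cast_ne_zero.2 (by omega)
        exact_mod_cast this
      simp only [hg, hs0, and_false, if_false]
      field_simp
  have h3 : (1 : L) / ((ψ m - r).factorial : L) =
      1 / ((ψ m).factorial : L) * ((ψ m).descFactorial r : L) := by
    have h := Nat.factorial_mul_descFactorial hm
    have h5 : ((ψ m).factorial : L) ≠ 0 := Nat.cast_ne_zero.2 (Nat.factorial_ne_zero _)
    have h6 : ((ψ m - r).factorial : L) ≠ 0 := Nat.cast_ne_zero.2 (Nat.factorial_ne_zero _)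
    have h7 : ((ψ m - r).factorial : L) * ((ψ m).descFactorial r : L) = ((ψ m).factorial : L) := by
      exact_mod_cast h
    field_simp
    linear_combination -h7
  rw [addOne, weight, h1, h2, pairProd_erase (theta_symm x ψ) (mem_univ m),
    ← mul_prod_erase univ _ (mem_univ m), div_eq_mul_one_div, h3]
  ring

theorem addTwo_eq_weight_mul (x : ι → L) {ψ : ι → ℕ}
    (hinj : ∀ i j, ψ i = ψ j → ψ i ≠ 0 → i = j) {m m' : ι} (hne : m' ≠ m) (hm : 0 < ψ m)
    (hm' : 0 < ψ m') :
    addTwo x ψ m m' = weight x ψ * (twoTerm (valueSet ψ) (ψ m) (ψ m') : ℚ) := by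
  have hmT : m' ∈ univ.erase m := mem_erase.2 ⟨hne, mem_univ _⟩
  have pos : ∀ a b : ℕ, 0 < a → (a : L) + b ≠ 0 := by
    intro a b ha
    have : ((a + b : ℕ) : L) ≠ 0 := Nat.cast_ne_zero.2 (by omega)
    exact_mod_cast this
  have hsub : ∀ i j, i ≠ j → 0 < ψ i → (ψ i : L) - ψ j ≠ 0 := by
    intro i j hij h0
    refine sub_ne_zero.2 fun h => hij (hinj i j (by exact_mod_cast h) h0.ne')
  set T := (univ.erase m).erase m' with hT
  set g : ℕ → L := fun c =>
    (((ψ m : L) + c) * (ψ m' + c)) / (((ψ m : L) - c) * (ψ m' - c)) with hg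
  have h0 : g 0 = 1 := by
    have h1 : (ψ m : L) ≠ 0 := Nat.cast_ne_zero.2 hm.ne'
    have h2 : (ψ m' : L) ≠ 0 := Nat.cast_ne_zero.2 hm'.ne'
    simp only [hg, Nat.cast_zero, add_zero, sub_zero]
    exact div_self (mul_ne_zero h1 h2)
  have h1 : ((twoTerm (valueSet ψ) (ψ m) (ψ m') : ℚ) : L) =
      (-1) ^ ψ m' * (ψ m).factorial * (ψ m').factorial * (((ψ m : L) + ψ m') / (ψ m - ψ m')) *
        ∏ s ∈ T, g (ψ s) := by
    rw [prod_erase_valueSet hinj g h0 T {ψ m', ψ m}]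
    · rw [twoTerm, sdiff_insert, sdiff_singleton_eq_erase]
      push_cast
      simp only [hg]
    · intro i hi
      simp only [hT, mem_erase, mem_univ, and_true, mem_singleton, mem_insert, not_and, not_not]
      constructor
      · intro h
        by_cases h' : i = m'
        · exact Or.inl (h' ▸ rfl)
        · exact Or.inr (h h' ▸ rfl)
      · rintro (h | h) h'
        · exact absurd (hinj i m' h hi) h'
        · exact hinj i m h hi
  have h2 : ∏ s ∈ T, kap x m s * kap x m' s =
      (∏ s ∈ T, theta x ψ m s) * (∏ s ∈ T, theta x ψ m' s) * ∏ s ∈ T, g (ψ s) := by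
    rw [← prod_mul_distrib, ← prod_mul_distrib]
    refine prod_congr rfl fun s hs => ?_
    have hs' := mem_erase.1 hs
    rw [theta_of_ne_zero x hm.ne', theta_of_ne_zero x hm'.ne']
    have a1 := pos (ψ m) (ψ s) hm
    have a2 := pos (ψ m') (ψ s) hm'
    have a3 := hsub m s (mem_erase.1 hs'.2).1.symm hm
    have a4 := hsub m' s hs'.1.symm hm'
    simp only [hg]
    field_simp
  have h3 : kap x m m' = theta x ψ m m' * (((ψ m : L) + ψ m') / (ψ m - ψ m')) := by
    have a1 := pos (ψ m) (ψ m') hm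
    have a3 := hsub m m' hne.symm hm
    rw [theta_of_ne_zero x hm.ne']
    field_simp
  have h5 : ((ψ m).factorial : L) ≠ 0 := Nat.cast_ne_zero.2 (Nat.factorial_ne_zero _)
  have h6 : ((ψ m').factorial : L) ≠ 0 := Nat.cast_ne_zero.2 (Nat.factorial_ne_zero _)
  rw [addTwo, weight, h1, ← hT, h2, h3, pairProd_erase (theta_symm x ψ) (mem_univ m),
    pairProd_erase (theta_symm x ψ) hmT, ← mul_prod_erase univ _ (mem_univ m),
    ← mul_prod_erase _ _ hmT, ← mul_prod_erase _ (fun s => theta x ψ m s) hmT, ← hT]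
  have h7 := div_mul_cancel₀ (x m ^ ψ m) h5
  have h8 := div_mul_cancel₀ (x m' ^ ψ m') h6
  generalize x m ^ ψ m / ((ψ m).factorial : L) = u at *
  generalize x m' ^ ψ m' / ((ψ m').factorial : L) = v at *
  rw [← h7, ← h8]
  ring

/-- The multiplier depends only on the set of nonzero values. Thus multiplication by `p_r` keeps the
shape of the sum and multiplies the coefficient of each `P_λ` by a number. -/
theorem bracket_eq_weight_mul {r : ℕ} (hr : Odd r) (x : ι → L) (ψ : ι → ℕ) :
    bracket r x ψ = weight x ψ * (barSum r (valueSet ψ) : ℚ) := by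
  by_cases hinj : ∀ i j, ψ i = ψ j → ψ i ≠ 0 → i = j
  swap
  · push Not at hinj
    obtain ⟨i, j, h, h0, hij⟩ := hinj
    rw [bracket_eq_zero hr x hij h h0, weight_eq_zero x hij h h0, zero_mul]
  have hr0 := hr.pos
  rw [bracket, barSum]
  push_cast
  rw [mul_add, mul_sum, mul_sum]
  congr 1
  · rw [← sum_valueSet hinj (fun a => weight x ψ *
      (((if r ≤ a then oneTerm r (valueSet ψ) a else 0 : ℚ)) : L))]
    · refine sum_congr rfl fun m _ => ?_
      split_ifs with h
      · exact addOne_eq_weight_mul hr0 x hinj h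
      · simp
    · rw [if_neg (by omega)]; simp
  · rw [← sum_valueSet hinj (fun a => weight x ψ * (((if 0 < a ∧ a < r ∧ r - a ∈ valueSet ψ then
      twoTerm (valueSet ψ) a (r - a) else 0 : ℚ)) : L))]
    · refine sum_congr rfl fun m _ => ?_
      have h1 : ∀ m', (if m' ≠ m ∧ 0 < ψ m ∧ 0 < ψ m' ∧ ψ m + ψ m' = r then addTwo x ψ m m'
          else 0) = if 0 < ψ m ∧ 0 < ψ m' ∧ ψ m + ψ m' = r then
            weight x ψ * ((twoTerm (valueSet ψ) (ψ m) (ψ m') : ℚ) : L) else 0 := by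
        intro m'
        by_cases hc : 0 < ψ m ∧ 0 < ψ m' ∧ ψ m + ψ m' = r
        · have hne : m' ≠ m := by
            rintro rfl
            obtain ⟨q, hq⟩ := hr
            omega
          rw [if_pos ⟨hne, hc⟩, if_pos hc, addTwo_eq_weight_mul x hinj hne hc.1 hc.2.1]
        · rw [if_neg hc, if_neg fun h => hc h.2]
      simp only [h1]
      rw [sum_valueSet hinj (fun b => if 0 < ψ m ∧ 0 < b ∧ ψ m + b = r then
            weight x ψ * ((twoTerm (valueSet ψ) (ψ m) b : ℚ) : L) else 0) (by simp)]
      by_cases hc : 0 < ψ m ∧ ψ m < r ∧ r - ψ m ∈ valueSet ψ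
      · rw [sum_eq_single_of_mem _ hc.2.2, if_pos ⟨hc.1, by omega, by omega⟩, if_pos hc]
        intro b _ hb
        rw [if_neg (by omega)]
      · rw [if_neg hc, Rat.cast_zero, mul_zero]
        refine sum_eq_zero fun b hb => ?_
        rw [if_neg]
        rintro ⟨h1, h2, h3⟩
        exact hc ⟨h1, by omega, by rwa [show r - ψ m = b by omega]⟩
    · simp

theorem sum_pow_mul_sum_weight_eq (x : ι → L) (hx : Function.Injective x)
    (hx' : ∀ i j, x i + x j ≠ 0) {r : ℕ} (hr : Odd r) (n : ℕ) :
    (∑ m, x m ^ r) * ∑ φ ∈ piAntidiag univ n, weight x φ =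
      ∑ ψ ∈ piAntidiag univ (n + r), weight x ψ * (barSum r (valueSet ψ) : ℚ) := by
  rw [sum_pow_mul_sum_weight x hx hx' hr]
  exact sum_congr rfl fun ψ _ => bracket_eq_weight_mul hr x ψ

end Bracket

/-! ### From placements of parts to Schur's `P`-functions -/

namespace StrictPartition

variable {n : ℕ}

theorem part_lt_part_iff (lam : StrictPartition n) (i j : Fin lam.length) :
    lam.part j < lam.part i ↔ i < j := by
  constructor
  · intro h
    by_contra h'
    rcases (not_lt.1 h').lt_or_eq with h2 | h2
    · exact (lam.part_lt h2 i.2).not_gt h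
    · rw [h2] at h
      exact lt_irrefl _ h
  · intro h
    exact lam.part_lt h j.2

theorem part_injective (lam : StrictPartition n) :
    Function.Injective fun i : Fin lam.length => lam.part i := by
  intro i j h
  have h : lam.part i = lam.part j := h
  rcases lt_trichotomy i j with h' | h' | h'
  · exact absurd h ((lam.part_lt_part_iff i j).2 h').ne'
  · exact h'
  · exact absurd h ((lam.part_lt_part_iff j i).2 h').ne

theorem part_ne_zero (lam : StrictPartition n) (i : Fin lam.length) : lam.part i ≠ 0 :=
  (lam.part_pos i.2).ne'

theorem mem_parts_iff (lam : StrictPartition n) {a : ℕ} :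
    a ∈ lam.1.parts ↔ ∃ i : Fin lam.length, lam.part i = a := by
  have h : a ∈ lam.1.parts ↔ a ∈ lam.list := by simp [list]
  rw [h, List.mem_iff_getElem]
  constructor
  · rintro ⟨i, hi, rfl⟩
    exact ⟨⟨i, hi⟩, by rw [part, List.getD_eq_getElem _ _ hi]⟩
  · rintro ⟨⟨i, hi⟩, rfl⟩
    exact ⟨i, hi, by rw [part, List.getD_eq_getElem _ _ hi]⟩

/-- The set of parts. -/
def partSet (lam : StrictPartition n) : Finset ℕ := lam.1.parts.toFinset

theorem partSet_injective : Function.Injective (partSet : StrictPartition n → Finset ℕ) := by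
  intro lam mu h
  have h' := congrArg Finset.val h
  rw [partSet, partSet, Multiset.toFinset_val, Multiset.toFinset_val,
    Multiset.dedup_eq_self.2 lam.2, Multiset.dedup_eq_self.2 mu.2] at h'
  exact Subtype.ext (Nat.Partition.ext h')

theorem mem_partSet (lam : StrictPartition n) {a : ℕ} :
    a ∈ lam.partSet ↔ ∃ i : Fin lam.length, lam.part i = a := by
  rw [partSet, Multiset.mem_toFinset, mem_parts_iff]

theorem partSet_eq_image (lam : StrictPartition n) :
    lam.partSet = univ.image fun i : Fin lam.length => lam.part i := by
  ext a
  simp [mem_partSet]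

theorem sum_partSet {M : Type*} [AddCommMonoid M] (lam : StrictPartition n) (f : ℕ → M) :
    ∑ a ∈ lam.partSet, f a = ∑ i : Fin lam.length, f (lam.part i) := by
  rw [partSet_eq_image, sum_image fun i _ j _ h => lam.part_injective h]

theorem card_partSet (lam : StrictPartition n) : lam.partSet.card = lam.length := by
  rw [partSet_eq_image, card_image_of_injective _ lam.part_injective, card_univ, Fintype.card_fin]

theorem sum_id_partSet (lam : StrictPartition n) : ∑ a ∈ lam.partSet, a = n := by
  rw [partSet, Finset.sum, Multiset.toFinset_val, Multiset.dedup_eq_self.2 lam.2, Multiset.map_id']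
  exact lam.1.parts_sum

theorem sum_part (lam : StrictPartition n) : ∑ i : Fin lam.length, lam.part i = n := by
  rw [← lam.sum_partSet fun a => a, sum_id_partSet]

/-- The number `g^λ / n!`. -/
def hookWeight (lam : StrictPartition n) : ℚ :=
  (∏ i : Fin lam.length, ((lam.part i).factorial : ℚ)⁻¹) *
    ∏ i : Fin lam.length, ∏ j ∈ univ.filter (fun j => i < j),
      ((lam.part i : ℚ) - lam.part j) / ((lam.part i : ℚ) + lam.part j)

theorem hookWeight_ne_zero (lam : StrictPartition n) : lam.hookWeight ≠ 0 := by
  refine mul_ne_zero (prod_ne_zero_iff.2 fun i _ => inv_ne_zero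
    (Nat.cast_ne_zero.2 (Nat.factorial_ne_zero _))) (prod_ne_zero_iff.2 fun i _ =>
    prod_ne_zero_iff.2 fun j hj => div_ne_zero ?_ ?_)
  · have h := (lam.part_lt_part_iff i j).2 (mem_filter.1 hj).2
    exact sub_ne_zero.2 (by exact_mod_cast h.ne')
  · have h : ((lam.part i + lam.part j : ℕ) : ℚ) ≠ 0 :=
      Nat.cast_ne_zero.2 (by have := lam.part_pos i.2; omega)
    exact_mod_cast h

variable {N : ℕ}

/-- The function with value `λ_i` at `w i`, and zero elsewhere. -/
def place (lam : StrictPartition n) (w : Fin lam.length ↪ Fin N) : Fin N → ℕ :=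
  Function.extend w (fun i => lam.part i) 0

theorem place_apply (lam : StrictPartition n) (w : Fin lam.length ↪ Fin N) (i : Fin lam.length) :
    lam.place w (w i) = lam.part i :=
  w.injective.extend_apply _ _ _

theorem place_of_notMem (lam : StrictPartition n) (w : Fin lam.length ↪ Fin N) {m : Fin N}
    (hm : ∀ i, w i ≠ m) : lam.place w m = 0 :=
  Function.extend_apply' _ _ _ fun ⟨i, hi⟩ => hm i hi

theorem place_ne_zero_iff (lam : StrictPartition n) (w : Fin lam.length ↪ Fin N) {m : Fin N} :
    lam.place w m ≠ 0 ↔ ∃ i, w i = m := by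
  constructor
  · intro h
    by_contra h'
    push Not at h'
    exact h (lam.place_of_notMem w h')
  · rintro ⟨i, rfl⟩
    rw [place_apply]
    exact lam.part_ne_zero i

theorem place_inj (lam : StrictPartition n) (w : Fin lam.length ↪ Fin N) (m m' : Fin N)
    (h : lam.place w m = lam.place w m') (h0 : lam.place w m ≠ 0) : m = m' := by
  obtain ⟨i, rfl⟩ := (lam.place_ne_zero_iff w).1 h0
  obtain ⟨j, rfl⟩ := (lam.place_ne_zero_iff w).1 (h ▸ h0)
  rw [place_apply, place_apply] at h
  rw [lam.part_injective h]

theorem valueSet_place (lam : StrictPartition n) (w : Fin lam.length ↪ Fin N) :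
    valueSet (lam.place w) = lam.partSet := by
  ext a
  rw [mem_valueSet, mem_partSet]
  constructor
  · rintro ⟨h, m, rfl⟩
    obtain ⟨i, rfl⟩ := (lam.place_ne_zero_iff w).1 h
    exact ⟨i, (lam.place_apply w i).symm⟩
  · rintro ⟨i, rfl⟩
    exact ⟨lam.part_ne_zero i, w i, lam.place_apply w i⟩

theorem prod_eq_prod_embedding {M : Type*} [CommMonoid M] {l : ℕ} (w : Fin l ↪ Fin N)
    (f : Fin N → M) :
    ∏ m, f m = (∏ i, f (w i)) * ∏ m ∈ univ.filter (fun m => ∀ j, w j ≠ m), f m := by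
  rw [← prod_map univ w f, ← prod_mul_prod_compl (univ.map w)]
  congr 2
  ext m
  simp

theorem sum_place (lam : StrictPartition n) (w : Fin lam.length ↪ Fin N) :
    ∑ m, lam.place w m = n := by
  have h := prod_eq_prod_embedding (M := Multiplicative ℕ) w (lam.place w)
  change ∑ m, lam.place w m = ∑ i, lam.place w (w i) +
    ∑ m ∈ univ.filter (fun m => ∀ j, w j ≠ m), lam.place w m at h
  rw [h, sum_eq_zero (s := univ.filter _) fun m hm => lam.place_of_notMem w (mem_filter.1 hm).2,
    add_zero]
  simp only [place_apply]
  exact lam.sum_part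

variable {L : Type*} [Field L] [CharZero L]

/-- The term of the embedding `w` in `P_λ`. -/
def schurTerm (x : Fin N → L) (lam : StrictPartition n) (w : Fin lam.length ↪ Fin N) : L :=
  (∏ i, x (w i) ^ lam.part i) *
    (∏ i, ∏ j ∈ univ.filter (fun j => i < j), (x (w i) + x (w j)) / (x (w i) - x (w j))) *
    (∏ i, ∏ m ∈ univ.filter (fun m => ∀ j, w j ≠ m), (x (w i) + x m) / (x (w i) - x m))

/-- Orient each pair by the larger value instead of by the order of the variables; pairs of zeros
have `theta = 1`. The numerical parts of `theta` and the factorials then form `hookWeight`, while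
the factors `kap` and the monomial form the term of `P_λ`. -/
theorem hookWeight_mul_schurTerm (x : Fin N → L) (lam : StrictPartition n)
    (w : Fin lam.length ↪ Fin N) :
    (lam.hookWeight : L) * schurTerm x lam w = weight x (lam.place w) := by
  set φ := lam.place w with hφ
  have hor : Orients (fun m m' : Fin N => φ m' < φ m) (theta x φ) := by
    refine ⟨fun i => lt_irrefl _, fun i j hij => ?_⟩
    rcases lt_trichotomy (φ i) (φ j) with h | h | h
    · rw [if_pos h, if_neg h.not_gt, one_mul, theta_symm]
    · rw [if_neg h.not_lt, if_neg h.not_gt, one_mul]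
      by_cases h0 : φ i = 0
      · rw [theta, if_pos ⟨h0, h ▸ h0⟩]
      · exact absurd (lam.place_inj w i j h h0) hij
    · rw [if_pos h, if_neg h.not_gt, mul_one]
  have hw : ∀ i, φ (w i) = lam.part i := lam.place_apply w
  have hw' : ∀ m ∈ univ.filter (fun m => ∀ j, w j ≠ m), φ m = 0 := fun m hm =>
    lam.place_of_notMem w (mem_filter.1 hm).2
  rw [weight, pairProd, relProd_eq_relProd (orients_lt (theta_symm x φ)) hor, relProd,
    prod_eq_prod_embedding w, prod_eq_one (s := univ.filter _) (fun m hm => by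
      rw [hw' m hm, pow_zero, Nat.factorial_zero, Nat.cast_one, div_one]), mul_one,
    prod_eq_prod_embedding w, prod_eq_one (s := univ.filter _) (fun m hm =>
      prod_eq_one fun m' _ => by rw [hw' m hm, if_neg (Nat.not_lt_zero _)]), mul_one]
  have h1 : ∀ i, (∏ m', if φ m' < φ (w i) then theta x φ (w i) m' else 1) =
      (∏ j ∈ univ.filter (fun j => i < j), ((lam.part i : L) - lam.part j) /
        ((lam.part i : L) + lam.part j)) *
      (∏ j ∈ univ.filter (fun j => i < j), (x (w i) + x (w j)) / (x (w i) - x (w j))) *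
      ∏ m ∈ univ.filter (fun m => ∀ j, w j ≠ m), (x (w i) + x m) / (x (w i) - x m) := by
    intro i
    have hi := lam.part_ne_zero i
    rw [prod_eq_prod_embedding w, ← prod_mul_distrib]
    congr 1
    · rw [prod_filter]
      refine prod_congr rfl fun j _ => ?_
      rw [hw, hw]
      by_cases h : i < j
      · rw [if_pos ((lam.part_lt_part_iff i j).2 h), if_pos h,
          theta_of_ne_zero x (by rw [hw]; exact hi), hw, hw, kap]
      · rw [if_neg (fun h' => h ((lam.part_lt_part_iff i j).1 h')), if_neg h]
    · refine prod_congr rfl fun m hm => ?_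
      have : (lam.part i : L) ≠ 0 := Nat.cast_ne_zero.2 hi
      rw [hw' m hm, hw, if_pos (Nat.pos_of_ne_zero hi), theta_of_ne_zero x (by rw [hw]; exact hi),
        hw, hw' m hm, Nat.cast_zero, sub_zero, add_zero, div_self this, one_mul, kap]
  simp only [h1]
  simp only [hw, prod_mul_distrib, div_eq_mul_inv (x _ ^ _)]
  rw [hookWeight, schurTerm]
  push_cast
  ring

/-- A linear combination of `P`-functions as a sum over functions. -/
theorem sum_schurTerm (x : Fin N → L) (c : Finset ℕ → ℚ) :
    ∑ lam : StrictPartition n, ((c lam.partSet * lam.hookWeight : ℚ) : L) *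
      ∑ w : Fin lam.length ↪ Fin N, schurTerm x lam w =
    ∑ φ ∈ piAntidiag univ n, weight x φ * ((c (valueSet φ) : ℚ) : L) := by
  simp only [mul_sum]
  rw [sum_sigma' univ (fun _ => univ) fun (lam : StrictPartition n)
    (w : Fin lam.length ↪ Fin N) => ((c lam.partSet * lam.hookWeight : ℚ) : L) * schurTerm x lam w]
  refine sum_of_injOn (fun p => place p.1 p.2) ?_ ?_ ?_ ?_
  · rintro ⟨lam, w⟩ - ⟨mu, v⟩ - h
    have h : lam.place w = mu.place v := h
    have e : lam = mu := partSet_injective (by rw [← lam.valueSet_place w, h, mu.valueSet_place v])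
    subst e
    congr 1
    ext i
    have h2 := congrFun h (w i)
    rw [place_apply] at h2
    obtain ⟨j, hj⟩ := (lam.place_ne_zero_iff v).1 (h2 ▸ lam.part_ne_zero i)
    rw [← hj, place_apply] at h2
    rw [← hj, lam.part_injective h2]
  · rintro ⟨lam, w⟩ -
    exact mem_coe.2 (mem_piAntidiag_univ.2 (lam.sum_place w))
  · intro φ hφ hφ'
    -- A function outside the image of `place` must have a repeated nonzero value, hence weight
    -- zero; otherwise its nonzero values form a strict partition and it is a placement of it.
    by_cases hinj : ∀ i j, φ i = φ j → φ i ≠ 0 → i = j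
    swap
    · push Not at hinj
      obtain ⟨i, j, h, h0, hij⟩ := hinj
      rw [weight_eq_zero x hij h h0, zero_mul]
    refine absurd ?_ hφ'
    have hsum := mem_piAntidiag_univ.1 hφ
    let lam : StrictPartition n := ⟨⟨(univ.filter fun i => φ i ≠ 0).val.map φ, by
        intro a ha
        obtain ⟨i, hi, rfl⟩ := Multiset.mem_map.1 ha
        have hi : i ∈ univ.filter (fun i => φ i ≠ 0) := hi
        exact Nat.pos_of_ne_zero (mem_filter.1 hi).2, by
        rw [← hsum]
        exact sum_filter_ne_zero univ⟩, by
        refine Multiset.Nodup.map_on ?_ (univ.filter fun i => φ i ≠ 0).nodup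
        intro i hi j _ h
        have hi : i ∈ univ.filter (fun i => φ i ≠ 0) := hi
        exact hinj i j h (mem_filter.1 hi).2⟩
    have hparts : ∀ a, (∃ i : Fin lam.length, lam.part i = a) ↔ ∃ m, φ m ≠ 0 ∧ φ m = a := by
      intro a
      rw [← lam.mem_parts_iff]
      simp [lam]
    have hex : ∀ i : Fin lam.length, ∃ m, φ m = lam.part i := fun i => by
      obtain ⟨m, -, h⟩ := (hparts (lam.part i)).1 ⟨i, rfl⟩
      exact ⟨m, h⟩
    choose v hv using hex
    have hvinj : Function.Injective v := fun i j h =>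
      lam.part_injective (by change lam.part i = lam.part j; rw [← hv, ← hv, h])
    refine ⟨⟨lam, ⟨v, hvinj⟩⟩, by simp, ?_⟩
    ext m
    by_cases hm : φ m = 0
    · rw [hm]
      refine lam.place_of_notMem _ ?_
      rintro i rfl
      exact lam.part_ne_zero i (by rw [← hv]; exact hm)
    · obtain ⟨i, hi⟩ := (hparts (φ m)).2 ⟨m, hm, rfl⟩
      have e : v i = m := (hinj m (v i) (by rw [hv, hi]) hm).symm
      rw [← hi, ← e]
      exact lam.place_apply ⟨v, hvinj⟩ i
  · rintro ⟨lam, w⟩ -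
    rw [valueSet_place, ← hookWeight_mul_schurTerm]
    push_cast
    ring

end StrictPartition

/-! ### Linear independence of the `P_λ` and evaluation of the characters -/

theorem var_injective (N : ℕ) : Function.Injective (var : Fin N → _) := by
  intro i j h
  exact MvPolynomial.X_injective (IsFractionRing.injective (MvPolynomial (Fin N) ℚ) _ h)

theorem var_add_var_ne_zero {N : ℕ} (i j : Fin N) : var i + var j ≠ 0 := by
  intro h
  rw [var, var, ← map_add] at h
  have h2 := (map_eq_zero_iff _ (IsFractionRing.injective (MvPolynomial (Fin N) ℚ) _)).1 h
  have h3 := congrArg (MvPolynomial.eval fun _ => (1 : ℚ)) h2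
  simp at h3

theorem smul_schurP_apply {n : ℕ} (q : ℚ) (lam : StrictPartition n) (N : ℕ) :
    (q • schurP lam) N = (q : FractionRing (MvPolynomial (Fin N) ℚ)) *
      ∑ w : Fin lam.length ↪ Fin N, StrictPartition.schurTerm var lam w := by
  -- The scalar action on the fraction field is routed through the polynomial ring; it agrees with
  -- multiplication by the cast of `q`.
  have e : algebraMap (MvPolynomial (Fin N) ℚ) (FractionRing (MvPolynomial (Fin N) ℚ)) (q • 1) =
      (q : FractionRing (MvPolynomial (Fin N) ℚ)) := by
    rw [← Algebra.algebraMap_eq_smul_one, ← RingHom.comp_apply]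
    exact eq_ratCast _ q
  rw [Pi.smul_apply, ← one_smul (MvPolynomial (Fin N) ℚ) (schurP lam N), ← smul_assoc,
    Algebra.smul_def, e]
  rfl

theorem weight_eq_of_forall_ne_zero {ι L : Type*} [Fintype ι] [LinearOrder ι] [Field L]
    (x : ι → L) {φ : ι → ℕ} (h : ∀ i, φ i ≠ 0) :
    weight x φ = (∏ i, x i ^ φ i) * ((∏ i, ((φ i).factorial : L)⁻¹) *
      pairProd (fun i j => ((φ i : L) - φ j) / ((φ i : L) + φ j)) univ) *
      pairProd (kap x) univ := by
  have e : pairProd (theta x φ) univ =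
      pairProd (fun i j => ((φ i : L) - φ j) / ((φ i : L) + φ j)) univ * pairProd (kap x) univ := by
    simp only [pairProd, relProd, ← prod_mul_distrib]
    refine prod_congr rfl fun i _ => prod_congr rfl fun j _ => ?_
    rw [theta_of_ne_zero x (h i)]
    split_ifs <;> simp
  rw [weight, e]
  simp only [div_eq_mul_inv, prod_mul_distrib]
  ring

theorem pairProd_ne_zero {ι L : Type*} [LinearOrder ι] [Field L] {F : ι → ι → L} {s : Finset ι}
    (h : ∀ i j, i < j → F i j ≠ 0) : pairProd F s ≠ 0 := by
  refine prod_ne_zero_iff.2 fun i _ => prod_ne_zero_iff.2 fun j _ => ?_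
  split_ifs with hij
  · exact h i j hij
  · exact one_ne_zero

theorem cast_weightCoeff {ι L : Type*} [Fintype ι] [LinearOrder ι] [Field L] [CharZero L]
    (φ : ι → ℕ) :
    (((∏ i, ((φ i).factorial : ℚ)⁻¹) *
      pairProd (fun i j => ((φ i : ℚ) - φ j) / ((φ i : ℚ) + φ j)) univ : ℚ) : L) =
    (∏ i, ((φ i).factorial : L)⁻¹) *
      pairProd (fun i j => ((φ i : L) - φ j) / ((φ i : L) + φ j)) univ := by
  simp only [pairProd, relProd]
  push_cast
  congr 1
  refine prod_congr rfl fun i _ => prod_congr rfl fun j _ => ?_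
  split_ifs <;> simp

/-- In `ℓ` variables, a relation between weights of functions without zeros is trivial. -/
theorem coeff_eq_zero_of_sum_weight {l n : ℕ} (c : (Fin l → ℕ) → ℚ)
    (h0 : ∀ φ : Fin l → ℕ, ¬ (∀ i, φ i ≠ 0) → c φ = 0)
    (h : ∑ φ ∈ piAntidiag univ n, weight (var : Fin l → _) φ * (c φ : ℚ) = 0)
    {φ : Fin l → ℕ} (hφ : ∑ i, φ i = n) (hpos : ∀ i, φ i ≠ 0) (hinj : Function.Injective φ) :
    c φ = 0 := by
  set d : (Fin l → ℕ) → ℚ := fun φ => (∏ i, ((φ i).factorial : ℚ)⁻¹) *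
      pairProd (fun i j => ((φ i : ℚ) - φ j) / ((φ i : ℚ) + φ j)) univ with hd
  set P : MvPolynomial (Fin l) ℚ := ∑ φ ∈ piAntidiag univ n,
    MvPolynomial.monomial (Finsupp.equivFunOnFinite.symm φ) (d φ * c φ) with hP
  set L := FractionRing (MvPolynomial (Fin l) ℚ)
  have hK : pairProd (kap (var : Fin l → L)) univ ≠ 0 := by
    refine pairProd_ne_zero fun i j hij => div_ne_zero (var_add_var_ne_zero i j) ?_
    exact sub_ne_zero.2 fun h => hij.ne (var_injective l h)
  -- All weights without zeros share the nonzero factor `∏ kap`. What remains is a combination of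
  -- distinct monomials, so the relation becomes the polynomial identity `P = 0`.
  have h1 : algebraMap (MvPolynomial (Fin l) ℚ) L P * pairProd (kap (var : Fin l → L)) univ = 0 := by
    rw [← h, hP, map_sum, sum_mul]
    refine sum_congr rfl fun φ _ => ?_
    by_cases hp : ∀ i, φ i ≠ 0
    · rw [weight_eq_of_forall_ne_zero _ hp, MvPolynomial.monomial_eq, map_mul,
        Finsupp.prod_fintype _ (fun i k => (MvPolynomial.X i : MvPolynomial (Fin l) ℚ) ^ k)
          fun i => pow_zero _, map_prod]
      have e : algebraMap (MvPolynomial (Fin l) ℚ) L (MvPolynomial.C (d φ * c φ)) =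
          ((d φ * c φ : ℚ) : L) := by
        rw [← RingHom.comp_apply]
        exact eq_ratCast _ _
      have e2 : ((d φ : ℚ) : L) = (∏ i, ((φ i).factorial : L)⁻¹) *
          pairProd (fun i j => ((φ i : L) - φ j) / ((φ i : L) + φ j)) univ :=
        cast_weightCoeff φ
      rw [e, ← e2, Rat.cast_mul]
      simp only [map_pow, Finsupp.coe_equivFunOnFinite_symm, var]
      ring
    · rw [h0 φ hp, mul_zero, MvPolynomial.monomial_zero, map_zero, zero_mul, Rat.cast_zero, mul_zero]
  have h2 : P = 0 :=
    (map_eq_zero_iff _ (IsFractionRing.injective (MvPolynomial (Fin l) ℚ) L)).1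
      ((mul_eq_zero.1 h1).resolve_right hK)
  have h3 := congrArg (MvPolynomial.coeff (Finsupp.equivFunOnFinite.symm φ)) h2
  rw [hP, MvPolynomial.coeff_sum, MvPolynomial.coeff_zero, sum_eq_single φ,
    MvPolynomial.coeff_monomial, if_pos rfl] at h3
  · refine (mul_eq_zero.1 h3).resolve_left (mul_ne_zero (prod_ne_zero_iff.2 fun i _ => inv_ne_zero
      (Nat.cast_ne_zero.2 (Nat.factorial_ne_zero _))) (pairProd_ne_zero fun i j hij =>
      div_ne_zero ?_ ?_))
    · exact sub_ne_zero.2 fun h => hij.ne (hinj (by exact_mod_cast h))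
    · have h : ((φ i + φ j : ℕ) : ℚ) ≠ 0 := Nat.cast_ne_zero.2 (by have := hpos i; omega)
      exact_mod_cast h
  · intro ψ _ hψ
    rw [MvPolynomial.coeff_monomial, if_neg]
    exact fun h => hψ (Finsupp.equivFunOnFinite.symm.injective h)
  · intro h
    exact absurd (mem_piAntidiag_univ.2 hφ) h

/-- The functions `P_λ` are linearly independent. -/
theorem eq_zero_of_sum_smul_schurP {n : ℕ} (X : StrictPartition n → ℚ)
    (h : ∑ lam, X lam • schurP lam = 0) : X = 0 := by
  by_contra hne
  obtain ⟨lam0, hlam0⟩ := Function.ne_iff.1 hne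
  -- Restrict to as many variables as the shortest `λ` with nonzero coefficient has parts. A
  -- function with a zero value then has fewer nonzero values than this minimum, so its coefficient
  -- vanishes.
  obtain ⟨lam, hlam, hmin⟩ := exists_min_image (univ.filter fun lam => X lam ≠ 0)
    (fun lam => lam.length) ⟨lam0, by simpa using hlam0⟩
  classical
  set c : Finset ℕ → ℚ := fun A =>
    if hA : ∃ mu : StrictPartition n, mu.partSet = A then X hA.choose / hA.choose.hookWeight else 0
    with hc
  have hcl : ∀ mu : StrictPartition n, c mu.partSet = X mu / mu.hookWeight := by
    intro mu
    have hex : ∃ nu : StrictPartition n, nu.partSet = mu.partSet := ⟨mu, rfl⟩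
    have e : hex.choose = mu := StrictPartition.partSet_injective hex.choose_spec
    simp only [hc]
    rw [dif_pos hex, e]
  have h1 := StrictPartition.sum_schurTerm (n := n) (var : Fin lam.length → _) c
  have h2 := congrFun h lam.length
  rw [Finset.sum_apply] at h2
  simp only [smul_schurP_apply, Pi.zero_apply] at h2
  have h3 : ∀ mu : StrictPartition n, c mu.partSet * mu.hookWeight = X mu := fun mu => by
    rw [hcl, div_mul_cancel₀ _ mu.hookWeight_ne_zero]
  simp only [h3] at h1
  rw [h2] at h1
  have h4 := coeff_eq_zero_of_sum_weight (l := lam.length) (n := n) (fun φ => c (valueSet φ)) ?_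
    h1.symm lam.sum_part lam.part_ne_zero lam.part_injective
  · have e : valueSet (fun i : Fin lam.length => lam.part i) = lam.partSet := by
      rw [← lam.valueSet_place (Function.Embedding.refl _)]
      congr 1
      ext i
      exact (lam.place_apply (Function.Embedding.refl _) i).symm
    simp only [e, hcl] at h4
    exact (div_ne_zero (mem_filter.1 hlam).2 lam.hookWeight_ne_zero) h4
  · intro φ hφ
    push Not at hφ
    obtain ⟨i, hi⟩ := hφ
    simp only [hc]
    split_ifs with hA
    · rw [div_eq_zero_iff]
      left
      by_contra hX
      have h5 := hmin _ (mem_filter.2 ⟨mem_univ _, hX⟩)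
      rw [← hA.choose.card_partSet, hA.choose_spec, valueSet] at h5
      have h6 := h5.trans card_image_le
      have h7 : (univ.filter fun i => φ i ≠ 0).card < (univ : Finset (Fin lam.length)).card :=
        card_lt_card (filter_ssubset.2 ⟨i, mem_univ _, by simpa using hi⟩)
      rw [card_univ, Fintype.card_fin] at h7
      omega
    · rfl

/-- `spinX` is an arbitrary choice among solutions; once one expansion is exhibited, linear
independence makes the choice unique. -/
theorem spinX_eq {n : ℕ} {rho : n.Partition} {X : StrictPartition n → ℚ}
    (h : powerSumPartition rho = ∑ lam, X lam • schurP lam) : spinX rho = X := by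
  have h1 : powerSumPartition rho = ∑ lam, spinX rho lam • schurP lam :=
    Classical.epsilon_spec (p := fun X : StrictPartition n → ℚ =>
      powerSumPartition rho = ∑ lam : StrictPartition n, X lam • schurP lam) ⟨X, h⟩
  refine sub_eq_zero.1 (eq_zero_of_sum_smul_schurP (spinX rho - X) ?_)
  funext N
  have h2 := congrFun (h1.symm.trans h) N
  simp only [Finset.sum_apply, smul_schurP_apply, Pi.sub_apply, Pi.zero_apply, Rat.cast_sub,
    sub_mul, sum_sub_distrib] at h2 ⊢
  rw [h2, sub_self]

theorem powerSumPartition_onesPartition (n N : ℕ) :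
    powerSumPartition (onesPartition n) N = (∑ i : Fin N, var i ^ 1) ^ n := by
  rw [powerSumPartition, onesPartition, Multiset.map_replicate, Multiset.prod_replicate]
  rfl

theorem powerSumPartition_unionOnes {r n : ℕ} (hr : r ≠ 0) (h : r ≤ n) (N : ℕ) :
    powerSumPartition (unionOnes (Nat.Partition.indiscrete r) h) N =
      (∑ i : Fin N, var i ^ r) * (∑ i : Fin N, var i ^ 1) ^ (n - r) := by
  have e : (unionOnes (Nat.Partition.indiscrete r) h).parts =
      {r} + Multiset.replicate (n - r) 1 := by
    rw [← Nat.Partition.indiscrete_parts hr]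
    rfl
  rw [powerSumPartition, e, Multiset.map_add,
    Multiset.prod_add, Multiset.map_replicate, Multiset.prod_replicate, Multiset.map_singleton,
    Multiset.prod_singleton]
  rfl

/-- Multiplication by `p_1` scales every weight of size `n + 1` by the sum of its values, that is by
`n + 1`; induct on `n`. The hypothesis on `barSum 1` is discharged by `barSum_one`, as the case `q =
0` of the residue formula. -/
theorem sum_weight_eq {ι L : Type*} [Fintype ι] [LinearOrder ι] [Field L] [CharZero L]
    (hbar : ∀ A : Finset ℕ, 0 ∉ A → barSum 1 A = ∑ a ∈ A, (a : ℚ)) (x : ι → L)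
    (hx : Function.Injective x) (hx' : ∀ i j, x i + x j ≠ 0) (n : ℕ) :
    ∑ φ ∈ piAntidiag univ n, weight x φ = (∑ i, x i ^ 1) ^ n / (n.factorial : L) := by
  induction n with
  | zero => simp [weight, pairProd, relProd, theta]
  | succ n ih =>
    have h := sum_pow_mul_sum_weight_eq x hx hx' odd_one n
    have h2 : ∀ ψ ∈ piAntidiag univ (n + 1), weight x ψ * ((barSum 1 (valueSet ψ) : ℚ) : L) =
        weight x ψ * ((n + 1 : ℕ) : L) := by
      intro ψ hψ
      by_cases hinj : ∀ i j, ψ i = ψ j → ψ i ≠ 0 → i = j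
      · rw [hbar _ fun h => (mem_valueSet.1 h).1 rfl, ← Nat.cast_sum,
          ← sum_valueSet hinj (fun a => a) rfl, mem_piAntidiag_univ.1 hψ, Rat.cast_natCast]
      · push Not at hinj
        obtain ⟨i, j, h, h0, hij⟩ := hinj
        rw [weight_eq_zero x hij h h0, zero_mul, zero_mul]
    rw [sum_congr rfl h2, ← sum_mul, ih] at h
    have h3 : ((n + 1 : ℕ) : L) ≠ 0 := Nat.cast_ne_zero.2 n.succ_ne_zero
    rw [eq_comm, ← eq_div_iff h3] at h
    rw [h, Nat.factorial_succ, pow_succ]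
    push_cast
    field_simp

theorem spinX_onesPartition {n : ℕ}
    (hbar : ∀ A : Finset ℕ, 0 ∉ A → barSum 1 A = ∑ a ∈ A, (a : ℚ)) (lam : StrictPartition n) :
    spinX (onesPartition n) lam = n.factorial * lam.hookWeight := by
  refine congrFun (spinX_eq (X := fun lam => n.factorial * lam.hookWeight) ?_) lam
  funext N
  have h := StrictPartition.sum_schurTerm (n := n) (var : Fin N → _) fun _ => (n.factorial : ℚ)
  rw [← sum_mul, sum_weight_eq hbar _ (var_injective N) var_add_var_ne_zero, Rat.cast_natCast,
    div_mul_cancel₀ _ (Nat.cast_ne_zero.2 (Nat.factorial_ne_zero n))] at h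
  rw [powerSumPartition_onesPartition, Finset.sum_apply, ← h]
  simp only [smul_schurP_apply]

theorem spinX_unionOnes {r n : ℕ} (hr : Odd r) (hrn : r ≤ n)
    (hbar : ∀ A : Finset ℕ, 0 ∉ A → barSum 1 A = ∑ a ∈ A, (a : ℚ)) (lam : StrictPartition n) :
    spinX (unionOnes (Nat.Partition.indiscrete r) hrn) lam =
      (n - r).factorial * barSum r lam.partSet * lam.hookWeight := by
  refine congrFun (spinX_eq
    (X := fun lam => (n - r).factorial * barSum r lam.partSet * lam.hookWeight) ?_) lam
  funext N
  have h := StrictPartition.sum_schurTerm (n := n) (var : Fin N → _)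
    fun A => ((n - r).factorial : ℚ) * barSum r A
  have h2 := sum_pow_mul_sum_weight_eq (var : Fin N → _) (var_injective N) var_add_var_ne_zero hr
    (n - r)
  rw [Nat.sub_add_cancel hrn, sum_weight_eq hbar _ (var_injective N) var_add_var_ne_zero] at h2
  rw [powerSumPartition_unionOnes hr.pos.ne', Finset.sum_apply]
  simp only [smul_schurP_apply]
  rw [h]
  simp only [Rat.cast_mul, Rat.cast_natCast, mul_left_comm (weight _ _)]
  rw [← mul_sum, ← h2, mul_left_comm, mul_div_cancel₀ _
    (Nat.cast_ne_zero.2 (Nat.factorial_ne_zero (n - r)))]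

/-- The normalized one-row character as a sum over bars. -/
theorem oneRowSpinCharacter_eq_barSum {r n : ℕ} (hr : Odd r)
    (hbar : ∀ A : Finset ℕ, 0 ∉ A → barSum 1 A = ∑ a ∈ A, (a : ℚ)) (lam : StrictPartition n) :
    oneRowSpinCharacter r lam = barSum r lam.partSet := by
  rw [oneRowSpinCharacter, spinCharacter]
  split_ifs with h
  · rw [spinX_unionOnes hr h hbar, spinG, spinX_onesPartition hbar]
    have h1 := lam.hookWeight_ne_zero
    have h2 : (n.factorial : ℚ) ≠ 0 := Nat.cast_ne_zero.2 (Nat.factorial_ne_zero _)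
    have h3 : ((n - r).factorial : ℚ) * n.descFactorial r = n.factorial := by
      exact_mod_cast Nat.factorial_mul_descFactorial h
    rw [div_eq_iff (mul_ne_zero h2 h1), ← h3]
    ring
  -- For `r > n` the character is zero by definition, and so is the bar sum: no part reaches `r`,
  -- and two distinct parts have sum at most `n`.
  · have hle : ∀ a ∈ lam.partSet, a ≤ n := fun a ha => by
      rw [← lam.sum_id_partSet]
      exact single_le_sum (f := fun a => a) (fun _ _ => Nat.zero_le _) ha
    rw [barSum, sum_eq_zero, sum_eq_zero, add_zero]
    · intro a ha
      rw [if_neg]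
      rintro ⟨h0, h1, h2⟩
      have hne : a ≠ r - a := by
        obtain ⟨q, hq⟩ := hr
        omega
      have h3 := sum_le_sum_of_subset (f := fun a : ℕ => a) (s := {a, r - a}) (t := lam.partSet)
        (by intro b hb; simp only [mem_insert, mem_singleton] at hb; rcases hb with rfl | rfl <;>
          assumption)
      rw [sum_pair hne, lam.sum_id_partSet] at h3
      omega
    · intro a ha
      rw [if_neg]
      have := hle a ha
      omega

/-! ### Sums of residues as coefficients at infinity -/

section Residues

variable {K : Type*} [Field K]

/-- The power series `1 / (1 - t X)`. -/
def geom (t : K) : PowerSeries K := PowerSeries.mk fun n => t ^ n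

/-- The power series `1 - t X`. -/
def lin (t : K) : PowerSeries K := 1 - PowerSeries.C t * PowerSeries.X

theorem coeff_succ_lin_mul (t : K) (F : PowerSeries K) (n : ℕ) :
    PowerSeries.coeff (n + 1) (lin t * F) =
      PowerSeries.coeff (n + 1) F - t * PowerSeries.coeff n F := by
  rw [lin, sub_mul, one_mul, map_sub, mul_assoc, PowerSeries.coeff_C_mul,
    PowerSeries.coeff_succ_X_mul]

theorem lin_mul_geom (t : K) : lin t * geom t = 1 := by
  ext n
  cases n with
  | zero => simp [lin, geom]
  | succ n =>
    rw [coeff_succ_lin_mul]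
    simp [geom, PowerSeries.coeff_one, pow_succ']

variable {κ : Type*} [DecidableEq κ]

/-- The right side is the sum of the residues of `z^e / ∏ (z - t v)`. Multiplying by `1 - t_a X`
removes the pole `t_a`, which gives a recursion in `e`; for `e = 0` the sum is the top coefficient
of the interpolation of the constant `1`. -/
theorem coeff_prod_geom (V : Finset κ) (t : κ → K) (ht : Set.InjOn t V) (e : ℕ) :
    PowerSeries.coeff (e + 1) (PowerSeries.X ^ V.card * ∏ v ∈ V, geom (t v)) =
      ∑ v ∈ V, t v ^ e / ∏ v' ∈ V.erase v, (t v - t v') := by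
  induction V using Finset.induction_on generalizing e with
  | empty => simp [PowerSeries.coeff_one]
  | insert a V ha ih =>
    have hsub : ∀ v ∈ V, t v - t a ≠ 0 := fun v hv => sub_ne_zero.2 fun h => ha
      (ht (by simp [hv]) (by simp) h ▸ hv)
    have ht' : Set.InjOn t V := ht.mono (by simp)
    induction e with
    | zero =>
      simp only [pow_zero]
      have hdeg : (1 : Polynomial K).degree < (insert a V).card := by
        rw [Polynomial.degree_one, card_insert_of_notMem ha]
        exact_mod_cast Nat.succ_pos _
      have h := Lagrange.coeff_eq_sum ht hdeg
      simp only [Polynomial.eval_one] at h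
      rw [← h, card_insert_of_notMem ha, add_tsub_cancel_right, Polynomial.coeff_one,
        pow_succ', mul_assoc, zero_add, ← zero_add 1, PowerSeries.coeff_succ_X_mul,
        PowerSeries.coeff_zero_eq_constantCoeff, map_mul, map_prod, map_pow,
        PowerSeries.constantCoeff_X]
      simp only [geom, ← PowerSeries.coeff_zero_eq_constantCoeff_apply, PowerSeries.coeff_mk,
        pow_zero, prod_const_one, mul_one, zero_pow_eq, eq_comm (a := V.card)]
    | succ e ihe =>
      have h1 : lin (t a) * (PowerSeries.X ^ (insert a V).card * ∏ v ∈ insert a V, geom (t v)) =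
          PowerSeries.X * (PowerSeries.X ^ V.card * ∏ v ∈ V, geom (t v)) := by
        rw [card_insert_of_notMem ha, prod_insert ha, pow_succ']
        linear_combination (PowerSeries.X * PowerSeries.X ^ V.card * ∏ v ∈ V, geom (t v)) *
          lin_mul_geom (t a)
      have h2 := congrArg (PowerSeries.coeff (e + 1 + 1)) h1
      rw [coeff_succ_lin_mul, PowerSeries.coeff_succ_X_mul, ih ht', ihe, sub_eq_iff_eq_add] at h2
      rw [h2, mul_sum, sum_insert ha, sum_insert ha]
      rw [add_left_comm, ← sum_add_distrib]
      congr 1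
      · ring
      · refine sum_congr rfl fun v hv => ?_
        have hv' : v ≠ a := fun h => ha (h ▸ hv)
        rw [erase_insert_of_ne hv'.symm, prod_insert (fun h => ha (mem_of_mem_erase h))]
        have := hsub v hv
        have : ∏ v' ∈ V.erase v, (t v - t v') ≠ 0 := prod_ne_zero_iff.2 fun v' h' =>
          sub_ne_zero.2 fun h => (mem_erase.1 h').1 (ht' (mem_erase.1 h').2 hv h.symm)
        field_simp
        ring

/-- The sum of the residues of a rational function with simple poles, as a coefficient of its
expansion at infinity. -/
theorem coeff_prod_lin_mul_prod_geom (S : Multiset K) (V : Finset κ) (t : κ → K)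
    (ht : Set.InjOn t V) (e : ℕ) :
    PowerSeries.coeff (S.card + 1 + e)
      (PowerSeries.X ^ V.card * ((S.map lin).prod * ∏ v ∈ V, geom (t v))) =
      ∑ v ∈ V, t v ^ e * (S.map fun s => t v - s).prod / ∏ v' ∈ V.erase v, (t v - t v') := by
  induction S using Multiset.induction_on generalizing e with
  | empty =>
    simp only [Multiset.map_zero, Multiset.prod_zero, one_mul, mul_one, Multiset.card_zero, zero_add]
    rw [add_comm, coeff_prod_geom V t ht]
  | cons s S ih =>
    have h1 := ih (e + 1)
    have h0 := ih e
    rw [Multiset.map_cons, Multiset.prod_cons, mul_assoc, mul_left_comm, Multiset.card_cons,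
      show S.card + 1 + 1 + e = S.card + 1 + e + 1 by omega, coeff_succ_lin_mul,
      show S.card + 1 + e + 1 = S.card + 1 + (e + 1) by omega, h0, h1, mul_sum, ← sum_sub_distrib]
    refine sum_congr rfl fun v _ => ?_
    rw [Multiset.map_cons, Multiset.prod_cons]
    ring

end Residues

/-! ### Pairing `j` with `r - j`, and the nodes -/

section Bars

theorem prod_Icc_reflect {M : Type*} [CommMonoid M] (q : ℕ) (H : ℕ → M) :
    ∏ i ∈ Icc 1 (2 * q), H i = ∏ j ∈ Icc 1 q, H j * H (2 * q + 1 - j) := by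
  rw [prod_mul_distrib, ← prod_filter_mul_prod_filter_not (Icc 1 (2 * q)) (fun i => i ≤ q)]
  congr 1
  · refine prod_congr ?_ fun _ _ => rfl
    ext i
    simp only [mem_filter, mem_Icc]
    omega
  · refine prod_bij' (fun i _ => 2 * q + 1 - i) (fun i _ => 2 * q + 1 - i) ?_ ?_ ?_ ?_ ?_
    · intro i hi
      simp only [mem_filter, mem_Icc] at hi ⊢
      omega
    · intro i hi
      simp only [mem_filter, mem_Icc] at hi ⊢
      omega
    · intro i hi
      simp only [mem_filter, mem_Icc] at hi
      omega
    · intro i hi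
      simp only [mem_Icc] at hi
      omega
    · intro i hi
      simp only [mem_filter, mem_Icc] at hi
      rw [show 2 * q + 1 - (2 * q + 1 - i) = i by omega]

/-- A product over a set of positive integers, with the elements `j` and `r - j` paired up. -/
theorem prod_eq_prod_pairs {M : Type*} [CommMonoid M] (q : ℕ) {A : Finset ℕ} (hA : 0 ∉ A)
    (G : ℕ → M) :
    ∏ b ∈ A, G b = (∏ b ∈ A.filter (fun b => 2 * q + 1 ≤ b), G b) *
      ∏ j ∈ Icc 1 q, (if j ∈ A then G j else 1) *
        (if 2 * q + 1 - j ∈ A then G (2 * q + 1 - j) else 1) := by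
  rw [← prod_filter_mul_prod_filter_not A (fun b => 2 * q + 1 ≤ b),
    ← prod_Icc_reflect q fun i => if i ∈ A then G i else 1, ← prod_filter]
  congr 1
  refine prod_congr ?_ fun _ _ => rfl
  ext i
  have : i ∈ A → i ≠ 0 := fun h h0 => hA (h0 ▸ h)
  simp only [mem_filter, mem_Icc]
  constructor
  · rintro ⟨h, h'⟩
    have := this h
    exact ⟨by omega, h⟩
  · rintro ⟨h, h'⟩
    exact ⟨h', by omega⟩

theorem sum_eq_sum_pairs {M : Type*} [AddCommMonoid M] (q : ℕ) {A : Finset ℕ} (hA : 0 ∉ A)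
    (G : ℕ → M) :
    ∑ b ∈ A, G b = (∑ b ∈ A.filter (fun b => 2 * q + 1 ≤ b), G b) +
      ∑ j ∈ Icc 1 q, ((if j ∈ A then G j else 0) +
        (if 2 * q + 1 - j ∈ A then G (2 * q + 1 - j) else 0)) :=
  prod_eq_prod_pairs (M := Multiplicative M) q hA G

/-- The node `b (b - r)`. -/
def node (r b : ℕ) : ℚ := (b : ℚ) * (b - r)

theorem node_sub_node (r a b : ℕ) : node r a - node r b = ((a : ℚ) - b) * (a + b - r) := by
  rw [node, node]; ring

theorem node_reflect {r b : ℕ} (h : b ≤ r) : node r (r - b) = node r b := by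
  rw [node, node]; push_cast [h]; ring

/-- The generating series `∏ (1 - b (b + r) X) / (1 - b (b - r) X)`. -/
def barSeries (r : ℕ) (A : Finset ℕ) : PowerSeries ℚ :=
  ∏ b ∈ A, lin ((b : ℚ) * (b + r)) * geom (node r b)

/-- Pair the factors `v - j` and `v - (r - j)` of the falling factorial: their product is a
difference of nodes. -/
theorem descFactorial_eq_prod (q v : ℕ) (hv : 2 * q + 1 ≤ v) :
    (v.descFactorial (2 * q + 1) : ℚ) =
      v * ∏ j ∈ Icc 1 q, (node (2 * q + 1) v - node (2 * q + 1) j) := by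
  have h : ∀ j ∈ Icc 1 q, node (2 * q + 1) v - node (2 * q + 1) j =
      ((v : ℚ) - j) * (v - (2 * q + 1 - j : ℕ)) := by
    intro j hj
    have := mem_Icc.1 hj
    rw [node_sub_node]
    push_cast [show j ≤ 2 * q + 1 by omega]
    ring
  rw [prod_congr rfl h, ← prod_Icc_reflect q fun i => (v : ℚ) - i, Nat.descFactorial_eq_prod_range,
    prod_range_succ']
  push_cast
  rw [Nat.sub_zero, mul_comm]
  congr 1
  refine prod_nbij' (fun i => i + 1) (fun i => i - 1) ?_ ?_ ?_ ?_ ?_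
  · intro i hi
    simp only [mem_range, mem_Icc] at hi ⊢
    omega
  · intro i hi
    simp only [mem_range, mem_Icc] at hi ⊢
    omega
  · intro i _
    simp
  · intro i hi
    have := mem_Icc.1 hi
    omega
  · intro i hi
    have := mem_range.1 hi
    rw [Nat.cast_sub (by omega)]

end Bars

/-! ### Residues of the bar series -/

section Bars

variable {ι : Type*}

/-- The product over the indices with none of two properties, against the product over the indices
with both. -/
theorem prod_none_mul_prod_ite {M : Type*} [CommMonoid M] (J : Finset ι) (P Q : ι → Prop)
    [DecidablePred P] [DecidablePred Q] (D : ι → M) :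
    (∏ j ∈ J.filter (fun j => ¬ P j ∧ ¬ Q j), D j) *
        ∏ j ∈ J, (if P j then D j else 1) * (if Q j then D j else 1) =
      (∏ j ∈ J, D j) * ∏ j ∈ J.filter (fun j => P j ∧ Q j), D j := by
  rw [prod_filter, prod_filter, ← prod_mul_distrib, ← prod_mul_distrib]
  refine prod_congr rfl fun j _ => ?_
  by_cases hP : P j <;> by_cases hQ : Q j <;> simp [hP, hQ]

/-- The nodes at which the generating series of a set of parts has poles. -/
def poleSet (q : ℕ) (A : Finset ℕ) : Finset ℕ :=
  A.filter (fun b => 2 * q + 1 ≤ b) ∪ (Icc 1 q).filter fun j => j ∈ A ∧ 2 * q + 1 - j ∈ A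

/-- The zeros of the generating series of a set of parts. -/
def zeroSet (q : ℕ) (A : Finset ℕ) : Multiset ℚ :=
  A.val.map (fun b : ℕ => (b : ℚ) * (b + (2 * q + 1 : ℕ))) +
    ((Icc 1 q).filter fun j => ¬ j ∈ A ∧ ¬ 2 * q + 1 - j ∈ A).val.map (node (2 * q + 1))

theorem disjoint_poleSet (q : ℕ) (A : Finset ℕ) :
    Disjoint (A.filter (fun b => 2 * q + 1 ≤ b))
      ((Icc 1 q).filter fun j => j ∈ A ∧ 2 * q + 1 - j ∈ A) := by
  rw [disjoint_left]
  intro x hx hx'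
  have := (mem_filter.1 hx).2
  have := mem_Icc.1 (mem_filter.1 hx').1
  omega

theorem node_sub_node_ne_zero {q a b : ℕ} (ha : 2 * q + 1 ≤ a ∨ (1 ≤ a ∧ a ≤ q))
    (hb : 2 * q + 1 ≤ b ∨ (1 ≤ b ∧ b ≤ q)) (hab : a ≠ b) :
    node (2 * q + 1) a - node (2 * q + 1) b ≠ 0 := by
  rw [node_sub_node]
  refine mul_ne_zero (sub_ne_zero.2 (by exact_mod_cast hab)) (sub_ne_zero.2 ?_)
  have : a + b ≠ 2 * q + 1 := by omega
  exact_mod_cast this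

theorem mem_poleSet_range {q : ℕ} {A : Finset ℕ} {a : ℕ} (ha : a ∈ poleSet q A) :
    2 * q + 1 ≤ a ∨ (1 ≤ a ∧ a ≤ q) := by
  rcases mem_union.1 ha with h | h
  · exact Or.inl (mem_filter.1 h).2
  · exact Or.inr (mem_Icc.1 (mem_filter.1 h).1)

theorem node_injOn_poleSet (q : ℕ) (A : Finset ℕ) :
    Set.InjOn (node (2 * q + 1)) (poleSet q A) := by
  intro a ha b hb hab
  by_contra hne
  exact node_sub_node_ne_zero (mem_poleSet_range ha) (mem_poleSet_range hb) hne
    (sub_eq_zero.2 hab)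

/-- In each pair `{j, r - j}`, the number of parts plus `1` if there is none equals `1` plus `1` if
both are parts. The `q` pairs give the excess `q`. -/
theorem card_zeroSet (q : ℕ) {A : Finset ℕ} (hA : 0 ∉ A) :
    (zeroSet q A).card = (poleSet q A).card + q := by
  have h := sum_eq_sum_pairs q hA fun _ => 1
  rw [zeroSet, Multiset.card_add, Multiset.card_map, Multiset.card_map, card_val, card_val, poleSet,
    card_union_of_disjoint (disjoint_poleSet q A), card_eq_sum_ones A, h, ← card_eq_sum_ones,
    add_assoc, add_assoc]
  congr 1
  rw [card_filter _ (Icc 1 q), card_filter _ (Icc 1 q), ← sum_add_distrib]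
  calc _ = ∑ j ∈ Icc 1 q, ((if j ∈ A ∧ 2 * q + 1 - j ∈ A then 1 else 0) + 1) := by
        refine sum_congr rfl fun j _ => ?_
        by_cases hP : j ∈ A <;> by_cases hQ : 2 * q + 1 - j ∈ A <;> simp [hP, hQ]
    _ = _ := by simp [sum_add_distrib]

/-- The factor `1 - j(j-r) X` stays as a zero if neither `j` nor `r - j` is a part, cancels the pole
if one is, and reduces a double pole to a simple one if both are. All poles are then simple. -/
theorem prod_lin_mul_barSeries (q : ℕ) {A : Finset ℕ} (hA : 0 ∉ A) :
    (∏ j ∈ Icc 1 q, lin (node (2 * q + 1) j)) * barSeries (2 * q + 1) A =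
      ((zeroSet q A).map lin).prod * ∏ v ∈ poleSet q A, geom (node (2 * q + 1) v) := by
  have h1 : (∏ j ∈ Icc 1 q, lin (node (2 * q + 1) j)) *
      ∏ j ∈ Icc 1 q, (if j ∈ A then geom (node (2 * q + 1) j) else 1) *
        (if 2 * q + 1 - j ∈ A then geom (node (2 * q + 1) (2 * q + 1 - j)) else 1) =
      (∏ j ∈ (Icc 1 q).filter fun j => ¬ j ∈ A ∧ ¬ 2 * q + 1 - j ∈ A, lin (node (2 * q + 1) j)) *
      ∏ j ∈ (Icc 1 q).filter fun j => j ∈ A ∧ 2 * q + 1 - j ∈ A, geom (node (2 * q + 1) j) := by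
    rw [prod_filter, prod_filter, ← prod_mul_distrib, ← prod_mul_distrib]
    refine prod_congr rfl fun j hj => ?_
    have hj := mem_Icc.1 hj
    rw [node_reflect (by omega)]
    have h := lin_mul_geom (node (2 * q + 1) j)
    by_cases hP : j ∈ A <;> by_cases hQ : 2 * q + 1 - j ∈ A <;> simp [hP, hQ, h, ← mul_assoc]
  rw [barSeries, prod_mul_distrib, prod_eq_prod_pairs q hA fun b => geom (node (2 * q + 1) b),
    poleSet, prod_union (disjoint_poleSet q A), zeroSet, Multiset.map_add, Multiset.prod_add,
    Multiset.map_map, Multiset.map_map]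
  have e1 : (A.val.map (lin ∘ fun b : ℕ => (b : ℚ) * (b + (2 * q + 1 : ℕ)))).prod =
      ∏ b ∈ A, lin ((b : ℚ) * (b + (2 * q + 1 : ℕ))) := rfl
  have e2 : (((Icc 1 q).filter fun j => ¬ j ∈ A ∧ ¬ 2 * q + 1 - j ∈ A).val.map
      (lin ∘ node (2 * q + 1))).prod =
      ∏ j ∈ (Icc 1 q).filter fun j => ¬ j ∈ A ∧ ¬ 2 * q + 1 - j ∈ A, lin (node (2 * q + 1) j) := rfl
  rw [e1, e2]
  linear_combination ((∏ b ∈ A, lin ((b : ℚ) * (b + (2 * q + 1 : ℕ)))) *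
    ∏ b ∈ A.filter (fun b => 2 * q + 1 ≤ b), geom (node (2 * q + 1) b)) * h1

/-- The residue at a pole. -/
def poleResidue (q : ℕ) (A : Finset ℕ) (v : ℕ) : ℚ :=
  (∏ b ∈ A, (node (2 * q + 1) v - (b : ℚ) * (b + (2 * q + 1 : ℕ)))) *
    (∏ j ∈ (Icc 1 q).filter fun j => ¬ j ∈ A ∧ ¬ 2 * q + 1 - j ∈ A,
      (node (2 * q + 1) v - node (2 * q + 1) j)) /
    ∏ v' ∈ (poleSet q A).erase v, (node (2 * q + 1) v - node (2 * q + 1) v')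

theorem coeff_prod_lin_mul_barSeries (q : ℕ) {A : Finset ℕ} (hA : 0 ∉ A) :
    PowerSeries.coeff (q + 1)
      ((∏ j ∈ Icc 1 q, lin (node (2 * q + 1) j)) * barSeries (2 * q + 1) A) =
      ∑ v ∈ poleSet q A, poleResidue q A v := by
  -- The exponent `e = 0` gives the plain sum of residues. The excess of `q` zeros over poles puts
  -- it at the coefficient of `X^(q+1)`.
  have h := coeff_prod_lin_mul_prod_geom (zeroSet q A) (poleSet q A) _ (node_injOn_poleSet q A) 0
  rw [← prod_lin_mul_barSeries q hA, card_zeroSet q hA, add_zero,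
    show (poleSet q A).card + q + 1 = q + 1 + (poleSet q A).card by ring,
    PowerSeries.coeff_X_pow_mul] at h
  rw [h]
  refine sum_congr rfl fun v _ => ?_
  rw [pow_zero, one_mul, poleResidue, zeroSet, Multiset.map_add, Multiset.prod_add,
    Multiset.map_map, Multiset.map_map]
  rfl

/-- The cancellation of `prod_lin_mul_barSeries`, evaluated at the node of `v` with the factor of
`v` removed. It rewrites the residue as products over all of `A` and all of `1, …, q`. -/
theorem prod_erase_big {q : ℕ} {A : Finset ℕ} (hA : 0 ∉ A) {v : ℕ}
    (hv' : 2 * q + 1 ≤ v) :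
    (∏ j ∈ (Icc 1 q).filter fun j => ¬ j ∈ A ∧ ¬ 2 * q + 1 - j ∈ A,
      (node (2 * q + 1) v - node (2 * q + 1) j)) *
      ∏ b ∈ A.erase v, (node (2 * q + 1) v - node (2 * q + 1) b) =
    (∏ j ∈ Icc 1 q, (node (2 * q + 1) v - node (2 * q + 1) j)) *
      ∏ v' ∈ (poleSet q A).erase v, (node (2 * q + 1) v - node (2 * q + 1) v') := by
  have h1 := prod_none_mul_prod_ite (Icc 1 q) (fun j => j ∈ A) (fun j => 2 * q + 1 - j ∈ A)
    fun j => node (2 * q + 1) v - node (2 * q + 1) j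
  have h2 := prod_eq_prod_pairs q (A := A.erase v) (fun h => hA (mem_of_mem_erase h))
    fun b => node (2 * q + 1) v - node (2 * q + 1) b
  have h3 : ∏ j ∈ Icc 1 q,
      (if j ∈ A.erase v then node (2 * q + 1) v - node (2 * q + 1) j else 1) *
      (if 2 * q + 1 - j ∈ A.erase v then
        node (2 * q + 1) v - node (2 * q + 1) (2 * q + 1 - j) else 1) =
      ∏ j ∈ Icc 1 q, (if j ∈ A then node (2 * q + 1) v - node (2 * q + 1) j else 1) *
      (if 2 * q + 1 - j ∈ A then node (2 * q + 1) v - node (2 * q + 1) j else 1) := by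
    refine prod_congr rfl fun j hj => ?_
    have hj := mem_Icc.1 hj
    rw [node_reflect (by omega)]
    simp only [mem_erase, show j ≠ v by omega, show 2 * q + 1 - j ≠ v by omega, ne_eq,
      not_false_eq_true, true_and]
  have h4 : (poleSet q A).erase v = (A.erase v).filter (fun b => 2 * q + 1 ≤ b) ∪
      (Icc 1 q).filter fun j => j ∈ A ∧ 2 * q + 1 - j ∈ A := by
    ext x
    simp only [poleSet, mem_erase, mem_union, mem_filter, mem_Icc]
    have : 1 ≤ x ∧ x ≤ q → x ≠ v := by omega
    tauto
  rw [h4, prod_union ((disjoint_poleSet q A).mono_left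
    (filter_subset_filter _ (erase_subset _ _))), h2, h3]
  linear_combination (∏ b ∈ (A.erase v).filter (fun b => 2 * q + 1 ≤ b),
    (node (2 * q + 1) v - node (2 * q + 1) b)) * h1

/-- The factor of `v` itself is `v(v-r) - v(v+r) = -2rv`. Its `v` completes the product over `1, …,
q` to the falling factorial, and the other factors are those of `oneTerm`. -/
theorem poleResidue_of_le {q : ℕ} {A : Finset ℕ} (hA : 0 ∉ A) {v : ℕ} (hv : v ∈ A)
    (hv' : 2 * q + 1 ≤ v) :
    poleResidue q A v = -(2 * (2 * q + 1 : ℕ)) * oneTerm (2 * q + 1) A v := by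
  have hmem : v ∈ poleSet q A := mem_union_left _ (mem_filter.2 ⟨hv, hv'⟩)
  have hpole : ∏ v' ∈ (poleSet q A).erase v, (node (2 * q + 1) v - node (2 * q + 1) v') ≠ 0 :=
    prod_ne_zero_iff.2 fun v' h => node_sub_node_ne_zero (Or.inl hv')
      (mem_poleSet_range (mem_of_mem_erase h)) (ne_of_mem_erase h).symm
  have hA' : ∏ b ∈ A.erase v, (node (2 * q + 1) v - node (2 * q + 1) b) ≠ 0 := by
    refine prod_ne_zero_iff.2 fun b h => ?_
    have hb0 : b ≠ 0 := fun h0 => hA (h0 ▸ mem_of_mem_erase h)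
    rw [node_sub_node]
    refine mul_ne_zero (sub_ne_zero.2 (by exact_mod_cast (ne_of_mem_erase h).symm))
      (sub_ne_zero.2 ?_)
    have : v + b ≠ 2 * q + 1 := by omega
    exact_mod_cast this
  have h1 := prod_erase_big hA hv'
  have h2 : poleResidue q A v =
      (∏ b ∈ A, (node (2 * q + 1) v - (b : ℚ) * (b + (2 * q + 1 : ℕ)))) *
        (∏ j ∈ Icc 1 q, (node (2 * q + 1) v - node (2 * q + 1) j)) /
        ∏ b ∈ A.erase v, (node (2 * q + 1) v - node (2 * q + 1) b) := by
    rw [poleResidue, div_eq_div_iff hpole hA', mul_assoc, h1]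
    ring
  rw [h2, oneTerm, descFactorial_eq_prod q v hv', ← mul_prod_erase A _ hv, mul_assoc, mul_div_assoc,
    mul_div_right_comm, ← prod_div_distrib]
  have h3 : ∏ b ∈ A.erase v, (node (2 * q + 1) v - (b : ℚ) * (b + (2 * q + 1 : ℕ))) /
      (node (2 * q + 1) v - node (2 * q + 1) b) =
      ∏ b ∈ A.erase v, ((v : ℚ) - (2 * q + 1 : ℕ) - b) * (v + b) /
        (((v : ℚ) - (2 * q + 1 : ℕ) + b) * (v - b)) := by
    refine prod_congr rfl fun b _ => ?_
    rw [node_sub_node, node]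
    congr 1 <;> ring
  rw [h3, node]
  ring

theorem twoTerm_symm {A : Finset ℕ} {a b : ℕ} (hab : Odd (a + b)) :
    twoTerm A a b = twoTerm A b a := by
  have hs : (-1 : ℚ) ^ a = -(-1) ^ b := by
    have h := hab.neg_one_pow (α := ℚ)
    rw [pow_add] at h
    rcases neg_one_pow_eq_or ℚ a with h1 | h1 <;> rcases neg_one_pow_eq_or ℚ b with h2 | h2 <;>
      rw [h1, h2] at h ⊢ <;> norm_num at h <;> norm_num
  rw [twoTerm, twoTerm, erase_right_comm, hs, add_comm (b : ℚ), ← neg_sub (a : ℚ) b, div_neg]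
  simp only [mul_comm ((b : ℚ) + _), mul_comm ((b : ℚ) - _)]
  ring

theorem prod_Icc_sub {a b : ℕ} (ha : 0 < a) (hb : 0 < b) :
    ∏ i ∈ (Icc 1 (a + b - 1)).erase a, ((a : ℚ) - i) =
      (-1) ^ (b - 1) * (a - 1).factorial * (b - 1).factorial := by
  have h1 : (Icc 1 (a + b - 1)).erase a = Ico 1 a ∪ Ioo a (a + b) := by
    ext i
    simp only [mem_erase, mem_Icc, mem_union, mem_Ico, mem_Ioo]
    omega
  have h2 : ∏ i ∈ Ico 1 a, ((a : ℚ) - i) = (a - 1).factorial := by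
    rw [← Finset.prod_range_add_one_eq_factorial]
    push_cast
    refine prod_nbij' (fun i => a - 1 - i) (fun i => a - 1 - i) ?_ ?_ ?_ ?_ ?_
    · intro i hi
      simp only [mem_range, mem_Ico] at hi ⊢
      omega
    · intro i hi
      simp only [mem_range, mem_Ico] at hi ⊢
      omega
    · intro i hi
      simp only [mem_Ico] at hi ⊢
      omega
    · intro i hi
      simp only [mem_range] at hi ⊢
      omega
    · intro i hi
      simp only [mem_Ico] at hi
      rw [Nat.sub_sub, Nat.cast_sub (by omega)]
      push_cast
      ring
  have h3 : ∏ i ∈ Ioo a (a + b), ((a : ℚ) - i) = (-1) ^ (b - 1) * (b - 1).factorial := by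
    rw [← Finset.prod_range_add_one_eq_factorial, ← card_range (b - 1), ← prod_const,
      card_range]
    push_cast
    rw [← prod_mul_distrib]
    refine prod_nbij' (fun i => i - a - 1) (fun i => a + 1 + i) ?_ ?_ ?_ ?_ ?_
    · intro i hi
      simp only [mem_range, mem_Ioo] at hi ⊢
      omega
    · intro i hi
      simp only [mem_range, mem_Ioo] at hi ⊢
      omega
    · intro i hi
      simp only [mem_Ioo] at hi ⊢
      omega
    · intro i hi
      simp only [mem_range] at hi ⊢
      omega
    · intro i hi
      simp only [mem_Ioo] at hi ⊢
      rw [Nat.sub_sub, Nat.cast_sub (by omega)]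
      push_cast
      ring
  rw [h1, prod_union, h2, h3]
  · ring
  · rw [disjoint_left]
    intro x hx hx'
    have := mem_Ico.1 hx
    have := mem_Ioo.1 hx'
    omega

/-- Split each difference of nodes into the factors of `j` and `r - j`. The only index of `1, …, 2q`
other than `a` still missing is `r - a`, and it is the prefactor. -/
theorem prod_erase_node {q a : ℕ} (ha : a ∈ Icc 1 q) :
    ((a : ℚ) - (2 * q + 1 - a : ℕ)) *
      ∏ j ∈ (Icc 1 q).erase a, (node (2 * q + 1) a - node (2 * q + 1) j) =
      (-1) ^ (2 * q + 1 - a - 1) * (a - 1).factorial * (2 * q + 1 - a - 1).factorial := by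
  have ha' := mem_Icc.1 ha
  rw [← prod_Icc_sub (by omega) (by omega), show a + (2 * q + 1 - a) - 1 = 2 * q by omega,
    ← prod_erase_mul _ _ (show 2 * q + 1 - a ∈ (Icc 1 (2 * q)).erase a by
      simp only [mem_erase, mem_Icc]; omega), mul_comm]
  congr 1
  have h1 : ∀ j ∈ (Icc 1 q).erase a, node (2 * q + 1) a - node (2 * q + 1) j =
      ((a : ℚ) - j) * (a - (2 * q + 1 - j : ℕ)) := by
    intro j hj
    have := mem_Icc.1 (mem_of_mem_erase hj)
    rw [node_sub_node]
    push_cast [show j ≤ 2 * q + 1 by omega]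
    ring
  rw [prod_congr rfl h1]
  -- Replacing the factors at `a` and `r - a` by `1` lets the pairing run over the whole interval.
  have h2 := prod_Icc_reflect q fun i => if i = a ∨ i = 2 * q + 1 - a then (1 : ℚ) else (a : ℚ) - i
  rw [← mul_prod_erase (Icc 1 q) _ ha] at h2
  rw [if_pos (Or.inl rfl), if_pos (Or.inr rfl), one_mul, one_mul] at h2
  have h3 : ∏ x ∈ (Icc 1 q).erase a,
      ((if x = a ∨ x = 2 * q + 1 - a then (1 : ℚ) else (a : ℚ) - x) *
      if 2 * q + 1 - x = a ∨ 2 * q + 1 - x = 2 * q + 1 - a then (1 : ℚ)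
        else (a : ℚ) - (2 * q + 1 - x : ℕ)) =
      ∏ j ∈ (Icc 1 q).erase a, ((a : ℚ) - j) * (a - (2 * q + 1 - j : ℕ)) := by
    refine prod_congr rfl fun j hj => ?_
    have hj1 := mem_Icc.1 (mem_of_mem_erase hj)
    have hj2 := ne_of_mem_erase hj
    rw [if_neg (by omega), if_neg (by omega)]
  rw [← h3, ← h2, ← prod_subset (s₁ := ((Icc 1 (2 * q)).erase a).erase (2 * q + 1 - a))
    ((erase_subset _ _).trans (erase_subset _ _))]
  · refine prod_congr rfl fun i hi => ?_
    simp only [mem_erase] at hi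
    rw [if_neg (by omega)]
  · intro i hi hi'
    simp only [mem_erase, not_and, hi, not_true_eq_false, imp_false] at hi'
    rw [if_pos (by tauto)]

theorem prod_erase_pair {q : ℕ} {A : Finset ℕ} (hA : 0 ∉ A) {a : ℕ} (ha : a ∈ Icc 1 q)
    (h1 : a ∈ A) :
    (∏ j ∈ (Icc 1 q).filter fun j => ¬ j ∈ A ∧ ¬ 2 * q + 1 - j ∈ A,
      (node (2 * q + 1) a - node (2 * q + 1) j)) *
      ∏ b ∈ (A.erase a).erase (2 * q + 1 - a), (node (2 * q + 1) a - node (2 * q + 1) b) =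
    (∏ j ∈ (Icc 1 q).erase a, (node (2 * q + 1) a - node (2 * q + 1) j)) *
      ∏ v' ∈ (poleSet q A).erase a, (node (2 * q + 1) a - node (2 * q + 1) v') := by
  have ha' := mem_Icc.1 ha
  have k1 := prod_none_mul_prod_ite ((Icc 1 q).erase a) (fun j => j ∈ A)
    (fun j => 2 * q + 1 - j ∈ A) fun j => node (2 * q + 1) a - node (2 * q + 1) j
  have k2 := prod_eq_prod_pairs q (A := (A.erase a).erase (2 * q + 1 - a))
    (fun h => hA (mem_of_mem_erase (mem_of_mem_erase h)))
    fun b => node (2 * q + 1) a - node (2 * q + 1) b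
  have k3 : ∏ j ∈ Icc 1 q,
      (if j ∈ (A.erase a).erase (2 * q + 1 - a) then
        node (2 * q + 1) a - node (2 * q + 1) j else 1) *
      (if 2 * q + 1 - j ∈ (A.erase a).erase (2 * q + 1 - a) then
        node (2 * q + 1) a - node (2 * q + 1) (2 * q + 1 - j) else 1) =
      ∏ j ∈ (Icc 1 q).erase a,
        (if j ∈ A then node (2 * q + 1) a - node (2 * q + 1) j else 1) *
        (if 2 * q + 1 - j ∈ A then node (2 * q + 1) a - node (2 * q + 1) j else 1) := by
    rw [← mul_prod_erase (Icc 1 q) _ ha, if_neg (by simp), if_neg (by simp), one_mul, one_mul]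
    refine prod_congr rfl fun j hj => ?_
    have hj1 := mem_Icc.1 (mem_of_mem_erase hj)
    have hj2 := ne_of_mem_erase hj
    rw [node_reflect (by omega)]
    simp only [mem_erase, show j ≠ a by omega, show j ≠ 2 * q + 1 - a by omega,
      show 2 * q + 1 - j ≠ a by omega, show 2 * q + 1 - j ≠ 2 * q + 1 - a by omega, ne_eq,
      not_false_eq_true, true_and]
  have k4 : (poleSet q A).erase a =
      ((A.erase a).erase (2 * q + 1 - a)).filter (fun b => 2 * q + 1 ≤ b) ∪
      ((Icc 1 q).erase a).filter fun j => j ∈ A ∧ 2 * q + 1 - j ∈ A := by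
    ext x
    simp only [poleSet, mem_erase, mem_union, mem_filter]
    have : 2 * q + 1 ≤ x → x ≠ a ∧ x ≠ 2 * q + 1 - a := by omega
    tauto
  have k5 : ((Icc 1 q).filter fun j => ¬ j ∈ A ∧ ¬ 2 * q + 1 - j ∈ A) =
      ((Icc 1 q).erase a).filter fun j => ¬ j ∈ A ∧ ¬ 2 * q + 1 - j ∈ A := by
    ext x
    simp only [mem_erase, mem_filter]
    constructor
    · rintro ⟨h, h'⟩
      exact ⟨⟨fun e => h'.1 (e ▸ h1), h⟩, h'⟩
    · rintro ⟨⟨-, h⟩, h'⟩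
      exact ⟨h, h'⟩
  rw [k4, prod_union ((disjoint_poleSet q A).mono
    (filter_subset_filter _ ((erase_subset _ _).trans (erase_subset _ _)))
    (filter_subset_filter _ (erase_subset _ _))), k2, k3, k5]
  linear_combination (∏ b ∈ ((A.erase a).erase (2 * q + 1 - a)).filter (fun b => 2 * q + 1 ≤ b),
    (node (2 * q + 1) a - node (2 * q + 1) b)) * k1

/-- With `b = r - a` the node is `-ab`, so the factors of the parts `a` and `b` are `-2ra` and
`-2rb`. Together with `prod_erase_node` they give the factorials, the sign and the factor `(a + b) /
(a - b)` of `twoTerm`. -/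
theorem poleResidue_of_pair {q : ℕ} {A : Finset ℕ} (hA : 0 ∉ A) {a : ℕ} (ha : a ∈ Icc 1 q)
    (h1 : a ∈ A) (h2 : 2 * q + 1 - a ∈ A) :
    poleResidue q A a = -(4 * (2 * q + 1 : ℕ)) * twoTerm A a (2 * q + 1 - a) := by
  have ha' := mem_Icc.1 ha
  have hpole : ∏ v' ∈ (poleSet q A).erase a, (node (2 * q + 1) a - node (2 * q + 1) v') ≠ 0 :=
    prod_ne_zero_iff.2 fun v' h => node_sub_node_ne_zero (Or.inr ha')
      (mem_poleSet_range (mem_of_mem_erase h)) (ne_of_mem_erase h).symm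
  have hA' : ∏ b ∈ (A.erase a).erase (2 * q + 1 - a),
      (node (2 * q + 1) a - node (2 * q + 1) b) ≠ 0 := by
    refine prod_ne_zero_iff.2 fun b h => ?_
    have hb1 := ne_of_mem_erase h
    have hb2 := ne_of_mem_erase (mem_of_mem_erase h)
    rw [node_sub_node]
    refine mul_ne_zero (sub_ne_zero.2 (by exact_mod_cast hb2.symm)) (sub_ne_zero.2 ?_)
    have : a + b ≠ 2 * q + 1 := by omega
    exact_mod_cast this
  have k1 := prod_erase_pair hA ha h1
  have k2 : poleResidue q A a =
      (∏ b ∈ A, (node (2 * q + 1) a - (b : ℚ) * (b + (2 * q + 1 : ℕ)))) *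
        (∏ j ∈ (Icc 1 q).erase a, (node (2 * q + 1) a - node (2 * q + 1) j)) /
        ∏ b ∈ (A.erase a).erase (2 * q + 1 - a), (node (2 * q + 1) a - node (2 * q + 1) b) := by
    rw [poleResidue, div_eq_div_iff hpole hA', mul_assoc, k1]
    ring
  have k3 := prod_erase_node ha
  have hb : 2 * q + 1 - a ∈ A.erase a := mem_erase.2 ⟨by omega, h2⟩
  rw [k2, twoTerm, ← mul_prod_erase A _ h1, ← mul_prod_erase (A.erase a) _ hb]
  generalize hbdef : 2 * q + 1 - a = b at *
  have hr : ((2 * q + 1 : ℕ) : ℚ) = a + b := by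
    rw [← Nat.cast_add]; congr 1; omega
  have k4 : (∏ c ∈ (A.erase a).erase b, (node (2 * q + 1) a - (c : ℚ) * (c + (2 * q + 1 : ℕ)))) /
      ∏ c ∈ (A.erase a).erase b, (node (2 * q + 1) a - node (2 * q + 1) c) =
      ∏ c ∈ (A.erase a).erase b, (((a : ℚ) + c) * (b + c)) / (((a : ℚ) - c) * (b - c)) := by
    rw [← prod_div_distrib]
    refine prod_congr rfl fun c _ => ?_
    rw [node_sub_node, node, hr, ← neg_div_neg_eq]
    congr 1 <;> ring
  have hab : (a : ℚ) - b ≠ 0 := sub_ne_zero.2 (by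
    have : a ≠ b := by omega
    exact_mod_cast this)
  have k5 := eq_div_of_mul_eq hab ((mul_comm _ _).trans k3)
  rw [mul_div_assoc, mul_comm _ (∏ j ∈ (Icc 1 q).erase a, _)] at *
  rw [← k4, k5, node, hr]
  obtain ⟨a', rfl⟩ : ∃ a', a = a' + 1 := ⟨a - 1, by omega⟩
  obtain ⟨b', rfl⟩ : ∃ b', b = b' + 1 := ⟨b - 1, by omega⟩
  simp only [Nat.add_sub_cancel, Nat.factorial_succ, pow_succ]
  push_cast
  field_simp
  ring

/-- The bar sum as a coefficient of the expansion at infinity of a rational function. -/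
theorem barSum_eq_coeff (q : ℕ) {A : Finset ℕ} (hA : 0 ∉ A) :
    -(2 * (2 * q + 1 : ℕ)) * barSum (2 * q + 1) A = PowerSeries.coeff (q + 1)
      ((∏ j ∈ Icc 1 q, lin (node (2 * q + 1) j)) * barSeries (2 * q + 1) A) := by
  rw [coeff_prod_lin_mul_barSeries q hA, poleSet, sum_union (disjoint_poleSet q A), barSum,
    mul_add, ← sum_filter, mul_sum]
  congr 1
  · refine sum_congr rfl fun v hv => ?_
    rw [poleResidue_of_le hA (mem_filter.1 hv).1 (mem_filter.1 hv).2]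
  -- The bar sum runs over ordered pairs and meets `{j, r - j}` twice, with equal terms by
  -- `twoTerm_symm`. This turns `-2r` into the `-4r` of the residue.
  · rw [sum_eq_sum_pairs q hA, sum_eq_zero, zero_add, mul_sum, sum_filter]
    · refine sum_congr rfl fun j hj => ?_
      have hj' := mem_Icc.1 hj
      by_cases hP : j ∈ A <;> by_cases hQ : 2 * q + 1 - j ∈ A
      · rw [if_pos hP, if_pos (And.intro hP hQ), poleResidue_of_pair hA hj hP hQ, if_pos hQ,
          if_pos ⟨by omega, by omega, hQ⟩, show 2 * q + 1 - (2 * q + 1 - j) = j by omega,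
          if_pos ⟨by omega, by omega, hP⟩, twoTerm_symm (a := 2 * q + 1 - j)]
        · ring
        · rw [show 2 * q + 1 - j + j = 2 * q + 1 by omega]
          exact odd_two_mul_add_one q
      · simp [hP, hQ]
      · simp [hP, hQ, show 2 * q + 1 - (2 * q + 1 - j) = j by omega]
      · simp [hP, hQ]
    · intro v hv
      have := (mem_filter.1 hv).2
      rw [if_neg (by omega)]

end Bars

/-! ### Logarithmic derivatives and Newton's identities -/

section LogDeriv

variable {K : Type*} [Field K]

/-- `P` is the logarithmic derivative `X F' / F`. -/
def IsLogDeriv (F P : PowerSeries K) : Prop :=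
  PowerSeries.X * PowerSeries.derivative K F = F * P

theorem IsLogDeriv.mul {F G P Q : PowerSeries K} (hF : IsLogDeriv F P) (hG : IsLogDeriv G Q) :
    IsLogDeriv (F * G) (P + Q) := by
  rw [IsLogDeriv] at *
  rw [Derivation.leibniz, smul_eq_mul, smul_eq_mul]
  linear_combination F * hG + G * hF

theorem IsLogDeriv.prod {κ : Type*} (s : Finset κ) {F P : κ → PowerSeries K}
    (h : ∀ i ∈ s, IsLogDeriv (F i) (P i)) : IsLogDeriv (∏ i ∈ s, F i) (∑ i ∈ s, P i) := by
  classical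
  induction s using Finset.induction_on with
  | empty => simp [IsLogDeriv]
  | insert a s ha ih =>
    rw [prod_insert ha, sum_insert ha]
    exact (h a (mem_insert_self _ _)).mul (ih fun i hi => h i (mem_insert_of_mem hi))

theorem derivative_lin (t : K) : PowerSeries.derivative K (lin t) = -PowerSeries.C t := by
  rw [lin, map_sub, Derivation.leibniz]
  simp

theorem isLogDeriv_lin (t : K) : IsLogDeriv (lin t) (1 - geom t) := by
  have h := lin_mul_geom t
  rw [IsLogDeriv, derivative_lin, mul_sub, h, lin]
  ring

theorem isLogDeriv_geom (t : K) : IsLogDeriv (geom t) (geom t - 1) := by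
  have h := lin_mul_geom t
  have h1 := congrArg (PowerSeries.derivative K) h
  rw [Derivation.leibniz, derivative_lin, Derivation.map_one_eq_zero, smul_eq_mul, smul_eq_mul] at h1
  rw [IsLogDeriv]
  rw [lin] at h h1
  linear_combination PowerSeries.X * geom t * h1 -
    (PowerSeries.X * PowerSeries.derivative K (geom t) + geom t) * h

theorem IsLogDeriv.mul_coeff {F P : PowerSeries K} (h : IsLogDeriv F P) (n : ℕ) :
    (n : K) * PowerSeries.coeff n F =
      ∑ p ∈ antidiagonal n, PowerSeries.coeff p.1 P * PowerSeries.coeff p.2 F := by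
  rw [← PowerSeries.coeff_mul, mul_comm P F, ← h]
  cases n with
  | zero => simp
  | succ n =>
    rw [PowerSeries.coeff_succ_X_mul, PowerSeries.coeff_derivative]
    push_cast
    ring

theorem constantCoeff_lin (t : K) : PowerSeries.coeff 0 (lin t) = 1 := by simp [lin]

theorem constantCoeff_geom (t : K) : PowerSeries.coeff 0 (geom t) = 1 := by simp [geom]

theorem coeff_geom (t : K) (n : ℕ) : PowerSeries.coeff n (geom t) = t ^ n := by simp [geom]

end LogDeriv

/-! ### Moments of the transition measure of the double diagram -/

section Moments

/-- The masses are residues of the Cauchy transform, so this is the residue formula with weight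
`z^n`. There is exactly one more minimum than maxima, which fixes the index. -/
theorem integral_pow_transitionMeasure (mu : YoungDiagram) (n : ℕ) :
    ∫ x, x ^ n ∂(transitionMeasure mu) = PowerSeries.coeff n
      ((∏ y ∈ maxima mu, lin (y : ℝ)) * ∏ x ∈ minima mu, geom (x : ℝ)) := by
  have h := coeff_prod_lin_mul_prod_geom ((maxima mu).val.map fun y : ℤ => (y : ℝ)) (minima mu)
    (fun x : ℤ => (x : ℝ)) (fun a _ b _ e => by simpa using e) n
  rw [Multiset.card_map, card_val, ← card_minima, add_comm _ n, PowerSeries.coeff_X_pow_mul,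
    Multiset.map_map] at h
  have e1 : ((maxima mu).val.map (lin ∘ fun y : ℤ => (y : ℝ))).prod =
    ∏ y ∈ maxima mu, lin (y : ℝ) := rfl
  rw [e1] at h
  rw [h, transitionMeasure, MeasureTheory.integral_finsetSum_measure]
  · refine sum_congr rfl fun x hx => ?_
    rw [MeasureTheory.integral_smul_measure, MeasureTheory.integral_dirac,
      ENNReal.toReal_ofReal (transitionWeight_nonneg mu hx), transitionWeight, Multiset.map_map]
    change _ * _ = _ * (∏ y ∈ maxima mu, ((x : ℝ) - (y : ℝ))) / _
    ring
  · intro x _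
    exact (MeasureTheory.integrable_dirac (by simp)).smul_measure ENNReal.ofReal_ne_top

/-- The second difference of the profile is `2` at a minimum, `-2` at a maximum and `0` elsewhere;
the term at `u = 0` comes from `|u|`. -/
theorem extrema_eq_contentCount (mu : YoungDiagram) (u : ℤ) :
    (if u ∈ maxima mu then 1 else 0) - (if u ∈ minima mu then 1 else 0) =
      -(if u = 0 then 1 else 0) - ((contentCount mu (u + 1) : ℤ) - 2 * contentCount mu u +
        contentCount mu (u - 1)) := by
  have hs : slope mu u = |u + 1| + 2 * (contentCount mu (u + 1) : ℤ) -
      (|u| + 2 * (contentCount mu u : ℤ)) := rfl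
  have hs' : slope mu (u - 1) = |u - 1 + 1| + 2 * (contentCount mu (u - 1 + 1) : ℤ) -
      (|u - 1| + 2 * (contentCount mu (u - 1) : ℤ)) := rfl
  rw [sub_add_cancel] at hs'
  have habs : |u + 1| - 2 * |u| + |u - 1| = 2 * if u = 0 then 1 else 0 := by
    split_ifs with h
    · subst h; norm_num
    · rcases lt_or_gt_of_ne h with h | h
      · rw [abs_of_nonpos (by omega), abs_of_neg h, abs_of_neg (by omega)]; ring
      · rw [abs_of_pos (by omega), abs_of_pos h, abs_of_nonneg (by omega)]; ring
  have m1 := mem_minima mu u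
  have m2 := mem_maxima mu u
  have s1 := slope_eq mu u
  have s2 := slope_eq mu (u - 1)
  by_cases hI : u ∈ Icc (-(mu.card : ℤ)) mu.card
  · simp only [hI, true_and] at m1 m2
    simp only [m1, m2]
    rcases s1 with h1 | h1 <;> rcases s2 with h2 | h2 <;> rw [h1] at hs ⊢ <;> rw [h2] at hs' ⊢ <;>
      norm_num <;> omega
  · simp only [hI, false_and, iff_false] at m1 m2
    rw [if_neg m1, if_neg m2]
    rw [mem_Icc, not_and_or, not_le, not_le] at hI
    have c0 : contentCount mu u = 0 := contentCount_eq_zero mu (by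
      rcases hI with h | h <;> rcases abs_cases u with h' | h' <;> omega)
    have c1 : contentCount mu (u + 1) = 0 := contentCount_eq_zero mu (by
      rcases hI with h | h <;> rcases abs_cases (u + 1) with h' | h' <;> omega)
    have c2 : contentCount mu (u - 1) = 0 := contentCount_eq_zero mu (by
      rcases hI with h | h <;> rcases abs_cases (u - 1) with h' | h' <;> omega)
    have hu : u ≠ 0 := by omega
    rw [c0, c1, c2, if_neg hu]
    norm_num

namespace StrictPartition

variable {n : ℕ}

/-- Decompose the diagram into its diagonal hooks. The hook of a part `b` has one cell of each
content from `1 - b` to `b`, and the smaller coordinate of a cell is the index of its hook. -/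
theorem contentCount_doubleDiagram (lam : StrictPartition n) (u : ℤ) :
    (contentCount (doubleDiagram lam) u : ℤ) =
      ∑ b ∈ lam.partSet, if 1 - (b : ℤ) ≤ u ∧ u ≤ b then 1 else 0 := by
  rw [sum_partSet lam fun b : ℕ => if 1 - (b : ℤ) ≤ u ∧ u ≤ b then (1 : ℤ) else 0, contentCount,
    Fin.sum_univ_eq_sum_range (fun i => if 1 - (lam.part i : ℤ) ≤ u ∧ u ≤ lam.part i then (1 : ℤ)
      else 0), ← sum_filter, ← Nat.cast_one, ← Nat.cast_sum, ← card_eq_sum_ones, Nat.cast_inj]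
  refine card_nbij' (fun c => min c.1 c.2) (fun i => (i + (-u).toNat, i + u.toNat)) ?_ ?_ ?_ ?_
  · rintro ⟨i, j⟩ hc
    simp only [coe_filter, YoungDiagram.mem_cells, Set.mem_ofPred_eq, mem_doubleDiagram,
      mem_range] at hc ⊢
    obtain ⟨⟨h1, h2, h3⟩ | ⟨h1, h2, h3⟩, h⟩ := hc
    · rw [min_eq_left h2.le]
      exact ⟨h1, by omega, by omega⟩
    · rw [min_eq_right h2]
      exact ⟨h1, by omega, by omega⟩
  · intro i hi
    simp only [coe_filter, YoungDiagram.mem_cells, Set.mem_ofPred_eq, mem_doubleDiagram,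
      mem_range] at hi ⊢
    obtain ⟨h1, h2, h3⟩ := hi
    refine ⟨?_, by omega⟩
    rcases lt_or_ge 0 u with hu | hu
    · rw [show (-u).toNat = 0 by omega]
      left
      simp only [add_zero]
      omega
    · rw [show u.toNat = 0 by omega]
      right
      simp only [add_zero]
      omega
  · rintro ⟨i, j⟩ hc
    simp only [coe_filter, YoungDiagram.mem_cells, Set.mem_ofPred_eq] at hc ⊢
    rw [Prod.mk.injEq]
    omega
  · intro i _
    simp only
    omega

theorem extrema_doubleDiagram (lam : StrictPartition n) (u : ℤ) :
    (if u ∈ maxima (doubleDiagram lam) then (1 : ℤ) else 0) -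
        (if u ∈ minima (doubleDiagram lam) then 1 else 0) =
      -(if u = 0 then 1 else 0) + ∑ b ∈ lam.partSet,
        ((if u = 1 - b then 1 else 0) + (if u = b then 1 else 0) -
          (if u = 1 + b then 1 else 0) - (if u = -b then 1 else 0)) := by
  rw [extrema_eq_contentCount, contentCount_doubleDiagram, contentCount_doubleDiagram,
    contentCount_doubleDiagram, mul_sum, ← sum_sub_distrib, ← sum_add_distrib, sub_eq_add_neg,
    ← sum_neg_distrib]
  congr 1
  refine sum_congr rfl fun b hb => ?_
  have hb0 : 0 < b := by
    obtain ⟨i, rfl⟩ := lam.mem_partSet.1 hb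
    exact lam.part_pos i.2
  split_ifs <;> omega

end StrictPartition

/-- The power series `1 - u X` as a unit. -/
def linUnit (u : ℤ) : (PowerSeries ℝ)ˣ where
  val := lin (u : ℝ)
  inv := geom (u : ℝ)
  val_inv := lin_mul_geom _
  inv_val := (mul_comm _ _).trans (lin_mul_geom _)

/-- The rational function with prescribed zeros and poles. -/
def divisorSeries : (ℤ →₀ ℤ) →+ Additive (PowerSeries ℝ)ˣ :=
  Finsupp.liftAddHom fun u => zmultiplesHom _ (Additive.ofMul (linUnit u))

theorem divisorSeries_single (u : ℤ) :
    divisorSeries (Finsupp.single u 1) = Additive.ofMul (linUnit u) := by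
  rw [divisorSeries, Finsupp.liftAddHom_apply_single]
  simp

/-- Contributions of different parts can cancel, so the equality is not one of sets of extrema. It
is proved for divisors and transported by the homomorphism `divisorSeries`; the point `0` drops out
because `lin 0 = 1`. -/
theorem prod_extrema_doubleDiagram {n : ℕ} (lam : StrictPartition n) :
    (∏ y ∈ maxima (doubleDiagram lam), lin (y : ℝ)) *
        ∏ x ∈ minima (doubleDiagram lam), geom (x : ℝ) =
      ∏ b ∈ lam.partSet, lin (1 - (b : ℝ)) * lin (b : ℝ) * geom (1 + (b : ℝ)) * geom (-(b : ℝ)) := by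
  have h : (∑ y ∈ maxima (doubleDiagram lam), Finsupp.single y (1 : ℤ)) -
      ∑ x ∈ minima (doubleDiagram lam), Finsupp.single x (1 : ℤ) =
      -Finsupp.single 0 1 + ∑ b ∈ lam.partSet,
        (Finsupp.single (1 - (b : ℤ)) (1 : ℤ) + Finsupp.single (b : ℤ) (1 : ℤ) -
          Finsupp.single (1 + (b : ℤ)) (1 : ℤ) - Finsupp.single (-(b : ℤ)) (1 : ℤ)) := by
    ext u
    have h1 := lam.extrema_doubleDiagram u
    simpa [Finsupp.single_apply, Finsupp.finsetSum_apply, eq_comm (b := u)] using h1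
  have h1 := congrArg divisorSeries h
  simp only [map_sub, map_add, map_neg, map_sum, divisorSeries_single] at h1
  have h2 := congrArg (fun z => ((Additive.toMul z : (PowerSeries ℝ)ˣ) : PowerSeries ℝ)) h1
  have h0 : lin (0 : ℝ) = 1 := by simp [lin]
  have h0' : geom (0 : ℝ) = 1 := by simpa [h0] using lin_mul_geom (0 : ℝ)
  simp only [sub_eq_add_neg, toMul_add, toMul_neg, toMul_sum, toMul_ofMul, Units.val_mul,
    ← prod_inv_distrib, Units.coe_prod] at h2
  simpa [linUnit, h0, h0', sub_eq_add_neg] using h2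

theorem integral_pow_doubleDiagram {n : ℕ} (lam : StrictPartition n) (m : ℕ) :
    ∫ x, x ^ m ∂(transitionMeasure (doubleDiagram lam)) = PowerSeries.coeff m
      (∏ b ∈ lam.partSet, lin (1 - (b : ℝ)) * lin (b : ℝ) * geom (1 + (b : ℝ)) * geom (-(b : ℝ))) := by
  rw [integral_pow_transitionMeasure, prod_extrema_doubleDiagram]

end Moments

/-- Real functions on the set of all strict partitions. -/
abbrev StrictFun : Type := (Σ n, StrictPartition n) → ℝ

/-! ### The degree filtration by spin free cumulants -/

section Filtration

/-- The polynomials over `ℚ` in the first `K` spin free cumulants, of degree at most `w`. -/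
def lowDegree (K w : ℕ) : Submodule ℚ StrictFun where
  carrier := {f | ∃ Q : MvPolynomial (Fin K) ℚ,
    (∀ m ∈ Q.support, Finsupp.weight (fun j : Fin K => 2 * (j : ℕ) + 1) m ≤ w) ∧
    ∀ p, f p = MvPolynomial.aeval (fun j : Fin K => spinFreeCumulant (2 * ((j : ℕ) + 1)) p.2) Q}
  zero_mem' := ⟨0, by simp, by simp⟩
  add_mem' := by
    classical
    rintro f g ⟨P, hP, hf⟩ ⟨Q, hQ, hg⟩
    refine ⟨P + Q, fun m hm => ?_, fun p => by rw [Pi.add_apply, hf, hg, map_add]⟩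
    rcases mem_union.1 (MvPolynomial.support_add hm) with h | h
    · exact hP m h
    · exact hQ m h
  smul_mem' := by
    rintro c f ⟨P, hP, hf⟩
    exact ⟨c • P, fun m hm => hP m (MvPolynomial.support_smul hm),
      fun p => by rw [Pi.smul_apply, hf, map_smul]⟩

variable {K : ℕ}

theorem lowDegree_mono {v w : ℕ} (h : v ≤ w) {f : StrictFun} (hf : f ∈ lowDegree K v) :
    f ∈ lowDegree K w := by
  obtain ⟨P, hP, hf⟩ := hf
  exact ⟨P, fun m hm => (hP m hm).trans h, hf⟩

theorem mul_mem_lowDegree {v w : ℕ} {f g : StrictFun} (hf : f ∈ lowDegree K v)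
    (hg : g ∈ lowDegree K w) : f * g ∈ lowDegree K (v + w) := by
  classical
  obtain ⟨P, hP, hf⟩ := hf
  obtain ⟨Q, hQ, hg⟩ := hg
  refine ⟨P * Q, fun m hm => ?_, fun p => by rw [Pi.mul_apply, hf, hg, map_mul]⟩
  obtain ⟨a, ha, b, hb, rfl⟩ := mem_add.1 (MvPolynomial.support_mul P Q hm)
  rw [map_add]
  exact add_le_add (hP a ha) (hQ b hb)

theorem one_mem_lowDegree (w : ℕ) : (1 : StrictFun) ∈ lowDegree K w := by
  refine ⟨1, fun m hm => ?_, fun p => by simp⟩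
  have : m = 0 := by
    rw [MvPolynomial.mem_support_iff, MvPolynomial.coeff_one] at hm
    by_contra h
    exact hm (if_neg fun h' => h h'.symm)
  simp [this]

theorem prod_mem_lowDegree {κ : Type*} (s : Finset κ) {f : κ → StrictFun} {w : κ → ℕ}
    (h : ∀ i ∈ s, f i ∈ lowDegree K (w i)) : ∏ i ∈ s, f i ∈ lowDegree K (∑ i ∈ s, w i) := by
  classical
  induction s using Finset.induction_on with
  | empty => exact one_mem_lowDegree _
  | insert a s ha ih =>
    rw [prod_insert ha, sum_insert ha]
    exact mul_mem_lowDegree (h a (mem_insert_self _ _))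
      (ih fun i hi => h i (mem_insert_of_mem hi))

theorem spinFreeCumulant_mem_lowDegree {j : ℕ} (hj : j < K) :
    (fun p : Σ n, StrictPartition n => spinFreeCumulant (2 * (j + 1)) p.2) ∈
      lowDegree K (2 * j + 1) := by
  refine ⟨MvPolynomial.X ⟨j, hj⟩, fun m hm => ?_, fun p => by simp⟩
  rw [MvPolynomial.support_X, mem_singleton] at hm
  simp [hm, Finsupp.weight_single]

end Filtration

/-! ### Moments and cumulants modulo lower degree -/

section Moments

/-- Twice the power sum of the parts for an odd exponent, and zero for an even one. -/
def oddSum (i : ℕ) : StrictFun := fun p => ∑ b ∈ p.2.partSet, ((b : ℝ) ^ i - (-(b : ℝ)) ^ i)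

theorem oddSum_of_even {i : ℕ} (h : Even i) : oddSum i = 0 := by
  ext p
  simp [oddSum, h.neg_pow]

/-- The moments of the transition measure of the double diagram. -/
def momentFun (m : ℕ) : StrictFun := fun p =>
  ∫ x, x ^ m ∂(transitionMeasure (doubleDiagram p.2))

/-- The free cumulants of the transition measure of the double diagram. -/
def cumulantFun (m : ℕ) : StrictFun := fun p =>
  freeCumulant (transitionMeasure (doubleDiagram p.2)) m

/-- The power sums of the poles minus the power sums of the zeros of the Cauchy transform. -/
def poleSum (i : ℕ) : StrictFun := ∑ l ∈ range i, (i.choose l : ℚ) • oddSum l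

theorem momentFun_zero : momentFun 0 = 1 := by
  ext p
  simp [momentFun]

/-- In the binomial expansion of `(1+b)^i - (1-b)^i` the term `l = i` is cancelled by `(-b)^i -
b^i`. The leading term is therefore `i` times `oddSum (i - 1)`. -/
theorem poleSum_apply (i : ℕ) (p : Σ n, StrictPartition n) :
    poleSum i p = ∑ b ∈ p.2.partSet,
      ((1 + (b : ℝ)) ^ i + (-(b : ℝ)) ^ i - (1 - (b : ℝ)) ^ i - (b : ℝ) ^ i) := by
  have h : ∀ b : ℝ, (1 + b) ^ i + (-b) ^ i - (1 - b) ^ i - b ^ i =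
      ∑ l ∈ range i, (i.choose l : ℝ) * (b ^ l - (-b) ^ l) := by
    intro b
    have h1 : (1 + b) ^ i - (1 - b) ^ i =
        ∑ l ∈ range (i + 1), (i.choose l : ℝ) * (b ^ l - (-b) ^ l) := by
      rw [sub_eq_add_neg 1 b, add_comm 1 b, add_comm 1 (-b), add_pow, add_pow, ← sum_sub_distrib]
      refine sum_congr rfl fun l _ => ?_
      rw [one_pow]
      ring
    rw [sum_range_succ, Nat.choose_self] at h1
    push_cast at h1
    linear_combination h1
  simp only [h]
  rw [sum_comm, poleSum, Finset.sum_apply]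
  refine sum_congr rfl fun l _ => ?_
  rw [Pi.smul_apply, oddSum, Rat.smul_def, mul_sum]
  push_cast
  rfl

theorem smul_momentFun (m : ℕ) :
    (m : ℚ) • momentFun m = ∑ i ∈ range (m + 1), poleSum i * momentFun (m - i) := by
  ext p
  have hF : IsLogDeriv
      (∏ b ∈ p.2.partSet, lin (1 - (b : ℝ)) * lin (b : ℝ) * geom (1 + (b : ℝ)) * geom (-(b : ℝ)))
      (∑ b ∈ p.2.partSet, ((1 - geom (1 - (b : ℝ))) + (1 - geom (b : ℝ)) +
        (geom (1 + (b : ℝ)) - 1) + (geom (-(b : ℝ)) - 1))) :=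
    IsLogDeriv.prod _ fun b _ => (((isLogDeriv_lin _).mul (isLogDeriv_lin _)).mul
      (isLogDeriv_geom _)).mul (isLogDeriv_geom _)
  have h := hF.mul_coeff m
  rw [Finset.Nat.sum_antidiagonal_eq_sum_range_succ
    (fun i j => PowerSeries.coeff i (∑ b ∈ p.2.partSet, ((1 - geom (1 - (b : ℝ))) +
      (1 - geom (b : ℝ)) + (geom (1 + (b : ℝ)) - 1) + (geom (-(b : ℝ)) - 1))) *
      PowerSeries.coeff j (∏ b ∈ p.2.partSet, lin (1 - (b : ℝ)) * lin (b : ℝ) *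
        geom (1 + (b : ℝ)) * geom (-(b : ℝ))))] at h
  rw [Pi.smul_apply, Rat.smul_def, Finset.sum_apply, momentFun, integral_pow_doubleDiagram]
  push_cast
  rw [h]
  refine sum_congr rfl fun i _ => ?_
  rw [Pi.mul_apply, momentFun, integral_pow_doubleDiagram, poleSum_apply, map_sum]
  congr 1
  refine sum_congr rfl fun b _ => ?_
  simp only [map_add, map_sub, coeff_geom]
  ring

theorem cumulantFun_eq (m : ℕ) :
    cumulantFun m = momentFun m -
      ∑ P ∈ noncrossingProper m, ∏ B ∈ P.parts, cumulantFun B.card := by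
  ext p
  rw [cumulantFun, freeCumulant, freeCumulantOfMoments, Pi.sub_apply, momentFun, Finset.sum_apply]
  congr 1
  rw [← Finset.sum_coe_sort (noncrossingProper m)]
  refine sum_congr rfl fun P _ => ?_
  rw [Finset.prod_apply, ← Finset.prod_coe_sort P.1.parts]
  rfl

variable {K : ℕ}

theorem smul_mem_iff_lowDegree {w : ℕ} {c : ℚ} (hc : c ≠ 0) {f : StrictFun} :
    c • f ∈ lowDegree K w ↔ f ∈ lowDegree K w :=
  Submodule.smul_mem_iff _ hc

/-- In Newton's identity for `(m+1) M_{m+1}` the top term of `poleSum (m + 1)` is `(m+1)` times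
`oddSum m`. A product `poleSum i * M_{m+1-i}` with `1 ≤ i ≤ m` has degree at most `(i - 1) + (m - i)
= m - 1`. -/
theorem momentFun_sub_mem {m : ℕ} (hM : ∀ l < m, momentFun (l + 1) ∈ lowDegree K l)
    (hE : ∀ l < m, oddSum l ∈ lowDegree K l) :
    momentFun (m + 1) - oddSum m ∈ lowDegree K (m - 1) := by
  have hc : ((m + 1 : ℕ) : ℚ) ≠ 0 := by exact_mod_cast Nat.succ_ne_zero m
  rw [← smul_mem_iff_lowDegree hc, smul_sub, smul_momentFun, sum_range_succ, Nat.sub_self,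
    momentFun_zero, mul_one, poleSum.eq_def (m + 1), sum_range_succ (fun l => ((m + 1).choose l : ℚ) • oddSum l),
    Nat.choose_succ_self_right, add_sub_assoc,
    add_sub_cancel_right]
  refine add_mem (sum_mem fun i hi => ?_) (sum_mem fun l hl => ?_)
  · have hi := mem_range.1 hi
    rcases Nat.eq_zero_or_pos i with rfl | h0
    · simp [poleSum]
    · have h1 : poleSum i ∈ lowDegree K (i - 1) := sum_mem fun l hl => by
        have hl := mem_range.1 hl
        exact Submodule.smul_mem _ _ (lowDegree_mono (by omega) (hE l (by omega)))
      have h2 := hM (m - i) (by omega)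
      rw [show m - i + 1 = m + 1 - i by omega] at h2
      exact lowDegree_mono (by omega) (mul_mem_lowDegree h1 h2)
  · have hl := mem_range.1 hl
    exact Submodule.smul_mem _ _ (lowDegree_mono (by omega) (hE l hl))

/-- A block `B` has degree `|B| - 1`, so a partition of `m + 1` points with at least two blocks has
degree at most `m - 1`. -/
theorem sum_noncrossingProper_mem {m : ℕ} (hR : ∀ l < m, cumulantFun (l + 1) ∈ lowDegree K l) :
    ∑ P ∈ noncrossingProper (m + 1), ∏ B ∈ P.parts, cumulantFun B.card ∈ lowDegree K (m - 1) := by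
  refine sum_mem fun P hP => ?_
  have hpos : ∀ B ∈ P.parts, 1 ≤ B.card := fun B hB =>
    card_pos.2 (P.nonempty_of_mem_parts hB)
  refine lowDegree_mono ?_ (prod_mem_lowDegree P.parts (w := fun B => B.card - 1) fun B hB => ?_)
  · have h1 : 1 < P.parts.card := (mem_filter.1 hP).2
    have h2 := P.sum_card_parts
    have h3 : ∑ B ∈ P.parts, (B.card - 1) + ∑ B ∈ P.parts, 1 = ∑ B ∈ P.parts, B.card := by
      rw [← sum_add_distrib]
      exact sum_congr rfl fun B hB => Nat.sub_add_cancel (hpos B hB)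
    rw [h2, ← card_eq_sum_ones, card_univ, Fintype.card_fin] at h3
    omega
  · have h1 := hpos B hB
    have h2 := card_block_lt hP hB
    have h3 := hR (B.card - 1) (by omega)
    rwa [Nat.sub_add_cancel h1] at h3

/-- Moments and free cumulants agree with the odd power sums of the parts up to lower degree. -/
theorem moments_and_cumulants {m : ℕ} (hm : m ≤ 2 * K + 1) :
    momentFun (m + 1) - oddSum m ∈ lowDegree K (m - 1) ∧
      cumulantFun (m + 1) - oddSum m ∈ lowDegree K (m - 1) ∧
      (m ≤ 2 * K → oddSum m ∈ lowDegree K m) := by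
  induction m using Nat.strong_induction_on with
  | _ m ih =>
    -- The range `m ≤ 2K + 1` is what the induction allows: only power sums of index `l < m`, hence
    -- `l ≤ 2K`, are used. At `m = 2K + 1` the differences still lie in the algebra of the first `K`
    -- cumulants, although `oddSum m` brings in a new one.
    have hE : ∀ l < m, oddSum l ∈ lowDegree K l := fun l hl =>
      (ih l hl (by omega)).2.2 (by omega)
    have hM : ∀ l < m, momentFun (l + 1) ∈ lowDegree K l := fun l hl => by
      simpa using add_mem (lowDegree_mono (Nat.sub_le l 1) (ih l hl (by omega)).1) (hE l hl)
    have hR : ∀ l < m, cumulantFun (l + 1) ∈ lowDegree K l := fun l hl => by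
      simpa using add_mem (lowDegree_mono (Nat.sub_le l 1) (ih l hl (by omega)).2.1) (hE l hl)
    have h1 := momentFun_sub_mem hM hE
    have h2 : cumulantFun (m + 1) - oddSum m ∈ lowDegree K (m - 1) := by
      rw [cumulantFun_eq, sub_right_comm]
      exact sub_mem h1 (sum_noncrossingProper_mem hR)
    refine ⟨h1, h2, fun hmK => ?_⟩
    rcases Nat.even_or_odd m with he | ⟨j, rfl⟩
    · rw [oddSum_of_even he]
      exact zero_mem _
    -- For odd `m = 2j + 1 ≤ 2K` the cumulant `R_{2j+2}` is twice a variable, so the congruence can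
    -- be solved for the power sum.
    · have h3 := Submodule.smul_mem (lowDegree K (2 * j + 1)) (2 : ℚ)
        (spinFreeCumulant_mem_lowDegree (K := K) (j := j) (by omega))
      have h4 : (2 : ℚ) • (fun p : Σ n, StrictPartition n => spinFreeCumulant (2 * (j + 1)) p.2) =
          cumulantFun (2 * j + 1 + 1) := by
        ext p
        rw [Pi.smul_apply, Rat.smul_def, spinFreeCumulant, cumulantFun]
        push_cast
        rw [show 2 * (j + 1) = 2 * j + 1 + 1 by ring]
        ring
      rw [h4] at h3
      simpa using sub_mem h3 (lowDegree_mono (Nat.sub_le _ 1) h2)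

end Moments

/-! ### The bar series modulo lower degree -/

section BarSeries

/-- The coefficients of the generating series of the parts. -/
def barCoeff (r i : ℕ) : StrictFun := fun p =>
  ((PowerSeries.coeff i (barSeries r p.2.partSet) : ℚ) : ℝ)

/-- The power sums of the poles minus the power sums of the zeros. -/
def barPoleSum (r i : ℕ) : StrictFun :=
  -∑ l ∈ range i, (i.choose l * (r : ℚ) ^ (i - l) : ℚ) • oddSum (l + i)

theorem isLogDeriv_barSeries (r : ℕ) (A : Finset ℕ) :
    IsLogDeriv (barSeries r A)
      (∑ b ∈ A, ((1 - geom ((b : ℚ) * (b + r))) + (geom (node r b) - 1))) :=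
  IsLogDeriv.prod _ fun _ _ => (isLogDeriv_lin _).mul (isLogDeriv_geom _)

theorem coeff_zero_barSeries (r : ℕ) (A : Finset ℕ) : PowerSeries.coeff 0 (barSeries r A) = 1 := by
  rw [barSeries, PowerSeries.coeff_zero_eq_constantCoeff_apply, map_prod]
  refine prod_eq_one fun b _ => ?_
  rw [map_mul, ← PowerSeries.coeff_zero_eq_constantCoeff_apply,
    ← PowerSeries.coeff_zero_eq_constantCoeff_apply, constantCoeff_lin, constantCoeff_geom, one_mul]

/-- For `q = 0` the prefactor is empty, and the first coefficient of the bar series is `∑ (b(b-1) -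
b(b+1)) = -2 ∑ b`. -/
theorem barSum_one {A : Finset ℕ} (hA : 0 ∉ A) : barSum 1 A = ∑ a ∈ A, (a : ℚ) := by
  have h := barSum_eq_coeff 0 hA
  have h1 := (isLogDeriv_barSeries 1 A).mul_coeff 1
  rw [Finset.Nat.sum_antidiagonal_eq_sum_range_succ (fun i j => PowerSeries.coeff i
    (∑ b ∈ A, ((1 - geom ((b : ℚ) * (b + (1 : ℕ)))) + (geom (node 1 b) - 1))) *
      PowerSeries.coeff j (barSeries 1 A)), Nat.succ_eq_add_one, sum_range_succ, sum_range_one,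
    Nat.sub_self, coeff_zero_barSeries] at h1
  simp only [map_sum, map_add, map_sub, coeff_geom] at h1
  simp only [Nat.cast_one, one_mul, mul_one, pow_zero, pow_one, sub_add_sub_cancel, sub_self,
    sum_const_zero, zero_mul, zero_add] at h1
  have h2 : ∑ b ∈ A, (node 1 b - (b : ℚ) * (b + 1)) = -2 * ∑ b ∈ A, (b : ℚ) := by
    rw [mul_sum]
    refine sum_congr rfl fun b _ => ?_
    rw [node]
    push_cast
    ring
  have h3 : PowerSeries.coeff 1 (barSeries 1 A) = -2 * ∑ b ∈ A, (b : ℚ) := by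
    rw [h1, ← h2]
    refine sum_congr rfl fun b _ => ?_
    ring
  norm_num at h
  linarith

/-- Since `b(b-r) = (-b)(-b+r)`, the difference is antisymmetric in `b` and only odd powers survive.
In particular the term `l = i` vanishes, which leaves degree at most `2i - 1`. -/
theorem barPoleSum_apply (r i : ℕ) (p : Σ n, StrictPartition n) :
    barPoleSum r i p = ∑ b ∈ p.2.partSet,
      (((b : ℝ) * (b - r)) ^ i - ((b : ℝ) * (b + r)) ^ i) := by
  have h : ∀ b : ℝ, (b * (b - r)) ^ i - (b * (b + r)) ^ i =
      -∑ l ∈ range i, (i.choose l * (r : ℝ) ^ (i - l)) * (b ^ (l + i) - (-b) ^ (l + i)) := by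
    intro b
    have h1 : (b * (b - r)) ^ i - (b * (b + r)) ^ i =
        -∑ l ∈ range (i + 1),
          (i.choose l * (r : ℝ) ^ (i - l)) * (b ^ (l + i) - (-b) ^ (l + i)) := by
      rw [show b * (b - r) = -b * (-b + r) by ring, mul_pow, mul_pow, add_pow, add_pow, mul_sum,
        mul_sum, ← sum_sub_distrib, ← sum_neg_distrib]
      refine sum_congr rfl fun l _ => ?_
      rw [pow_add, pow_add]
      ring
    have h2 : b ^ (i + i) - (-b) ^ (i + i) = 0 := by rw [(Even.add_self i).neg_pow, sub_self]
    rw [sum_range_succ, h2, mul_zero, add_zero] at h1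
    exact h1
  simp only [h]
  rw [sum_neg_distrib, sum_comm, barPoleSum, Pi.neg_apply, Finset.sum_apply]
  congr 1
  refine sum_congr rfl fun l _ => ?_
  rw [Pi.smul_apply, oddSum, Rat.smul_def, mul_sum]
  push_cast
  rfl

theorem smul_barCoeff (r m : ℕ) :
    (m : ℚ) • barCoeff r m = ∑ i ∈ range (m + 1), barPoleSum r i * barCoeff r (m - i) := by
  ext p
  have h := (isLogDeriv_barSeries r p.2.partSet).mul_coeff m
  rw [Finset.Nat.sum_antidiagonal_eq_sum_range_succ (fun i j => PowerSeries.coeff i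
    (∑ b ∈ p.2.partSet, ((1 - geom ((b : ℚ) * (b + r))) + (geom (node r b) - 1))) *
      PowerSeries.coeff j (barSeries r p.2.partSet))] at h
  have h' := congrArg (fun x : ℚ => (x : ℝ)) h
  simp only [Rat.cast_mul, Rat.cast_sum, Rat.cast_natCast] at h'
  rw [Pi.smul_apply, Rat.smul_def, Finset.sum_apply, barCoeff, Rat.cast_natCast, h']
  refine sum_congr rfl fun i _ => ?_
  rw [Pi.mul_apply, barPoleSum_apply, barCoeff, map_sum]
  congr 1
  rw [Rat.cast_sum]
  refine sum_congr rfl fun b _ => ?_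
  simp only [map_add, map_sub, coeff_geom, node]
  push_cast
  ring

variable {K : ℕ}

theorem barPoleSum_mem (r : ℕ) {i : ℕ} (hi : i ≤ K) : barPoleSum r i ∈ lowDegree K (2 * i - 1) := by
  refine neg_mem (sum_mem fun l hl => Submodule.smul_mem _ _ ?_)
  have hl := mem_range.1 hl
  exact lowDegree_mono (by omega) ((moments_and_cumulants (by omega)).2.2 (by omega))

theorem barPoleSum_add_mem (r : ℕ) {i : ℕ} (hi : i ≤ K) :
    barPoleSum r (i + 1) + ((i + 1 : ℕ) : ℚ) • (r : ℚ) • oddSum (2 * i + 1) ∈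
      lowDegree K (2 * i) := by
  rw [barPoleSum, sum_range_succ, neg_add, add_assoc, Nat.choose_succ_self_right, smul_smul,
    show i + 1 - i = 1 by omega, pow_one, show i + (i + 1) = 2 * i + 1 by ring, neg_add_cancel,
    add_zero]
  refine neg_mem (sum_mem fun l hl => Submodule.smul_mem _ _ ?_)
  have hl := mem_range.1 hl
  exact lowDegree_mono (by omega) ((moments_and_cumulants (by omega)).2.2 (by omega))

theorem barCoeff_zero (r : ℕ) : barCoeff r 0 = 1 := by
  ext p
  rw [barCoeff, coeff_zero_barSeries]
  simp

/-- The last term of Newton's identity for `(i+1)` times the coefficient has leading part `-(i+1) r`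
times `oddSum (2i+1)`. The mixed products have degree at most `(2l - 1) + (2(i-l) + 1) = 2i`. -/
theorem barCoeff_add_mem (r : ℕ) {i : ℕ} (hi : i ≤ K) :
    barCoeff r (i + 1) + (r : ℚ) • oddSum (2 * i + 1) ∈ lowDegree K (2 * i) := by
  induction i using Nat.strong_induction_on with
  | _ i ih =>
    have hA : ∀ l < i, barCoeff r (l + 1) ∈ lowDegree K (2 * l + 1) := fun l hl => by
      have h := sub_mem (lowDegree_mono (Nat.le_succ _) (ih l hl (by omega)))
        (Submodule.smul_mem _ (r : ℚ)
          ((moments_and_cumulants (K := K) (m := 2 * l + 1) (by omega)).2.2 (by omega)))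
      simpa using h
    have hc : ((i + 1 : ℕ) : ℚ) ≠ 0 := by exact_mod_cast Nat.succ_ne_zero i
    rw [← smul_mem_iff_lowDegree hc, smul_add, smul_barCoeff, sum_range_succ, Nat.sub_self,
      barCoeff_zero, mul_one, add_assoc]
    refine add_mem (sum_mem fun l hl => ?_) (barPoleSum_add_mem r hi)
    have hl := mem_range.1 hl
    rcases Nat.eq_zero_or_pos l with rfl | h0
    · simp [barPoleSum]
    · have h1 := barPoleSum_mem r (show l ≤ K by omega)
      have h2 := hA (i - l) (by omega)
      rw [show i - l + 1 = i + 1 - l by omega] at h2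
      exact lowDegree_mono (by omega) (mul_mem_lowDegree h1 h2)

theorem zero_notMem_partSet {n : ℕ} (lam : StrictPartition n) : 0 ∉ lam.partSet := by
  intro h
  obtain ⟨i, hi⟩ := lam.mem_partSet.1 h
  exact lam.part_ne_zero i hi

/-- The one-row characters agree with the odd power sums of the parts up to lower degree. -/
theorem oneRowSpinCharacter_sub_mem (q : ℕ) :
    (fun p : Σ n, StrictPartition n => ((oneRowSpinCharacter (2 * q + 1) p.2 : ℚ) : ℝ) -
      spinFreeCumulant (2 * (q + 1)) p.2) ∈ lowDegree q (2 * q) := by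
  -- The `c i` do not depend on `λ`, and `c 0 = 1`; the terms with `i ≥ 1` involve only earlier
  -- coefficients of the bar series and have lower degree.
  set c : ℕ → ℚ := fun i => PowerSeries.coeff i (∏ j ∈ Icc 1 q, lin (node (2 * q + 1) j)) with hc
  have hc0 : c 0 = 1 := by
    simp only [hc]
    rw [PowerSeries.coeff_zero_eq_constantCoeff_apply, map_prod]
    refine prod_eq_one fun b _ => ?_
    rw [← PowerSeries.coeff_zero_eq_constantCoeff_apply, constantCoeff_lin]
  have h1 : (-(2 * (2 * q + 1 : ℕ)) : ℚ) • (fun p : Σ n, StrictPartition n =>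
      ((oneRowSpinCharacter (2 * q + 1) p.2 : ℚ) : ℝ)) =
      ∑ i ∈ range (q + 1), c (i + 1) • barCoeff (2 * q + 1) (q - i) + barCoeff (2 * q + 1) (q + 1) := by
    ext p
    have h := barSum_eq_coeff q (zero_notMem_partSet p.2)
    rw [PowerSeries.coeff_mul, Finset.Nat.sum_antidiagonal_eq_sum_range_succ
      (fun i j => c i * PowerSeries.coeff j (barSeries (2 * q + 1) p.2.partSet)),
      Nat.succ_eq_add_one, sum_range_succ', hc0, one_mul, Nat.sub_zero] at h
    rw [Pi.smul_apply, oneRowSpinCharacter_eq_barSum (odd_two_mul_add_one q) fun _ => barSum_one,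
      Rat.smul_def, ← Rat.cast_mul, h, Pi.add_apply, Finset.sum_apply, barCoeff, Rat.cast_add,
      Rat.cast_sum]
    congr 1
    refine sum_congr rfl fun i _ => ?_
    rw [Pi.smul_apply, Rat.smul_def, barCoeff, Rat.cast_mul, Nat.add_sub_add_right]
  have h2 : ∑ i ∈ range (q + 1), c (i + 1) • barCoeff (2 * q + 1) (q - i) ∈
      lowDegree q (2 * q) := by
    refine sum_mem fun i _ => Submodule.smul_mem _ _ ?_
    rcases Nat.eq_zero_or_pos (q - i) with h0 | h0
    · rw [h0, barCoeff_zero]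
      exact one_mem_lowDegree _
    · have h := sub_mem (lowDegree_mono (Nat.le_succ _)
        (barCoeff_add_mem (K := q) (2 * q + 1) (i := q - i - 1) (by omega)))
        (Submodule.smul_mem _ ((2 * q + 1 : ℕ) : ℚ)
          ((moments_and_cumulants (K := q) (m := 2 * (q - i - 1) + 1) (by omega)).2.2 (by omega)))
      rw [add_sub_cancel_right, Nat.sub_add_cancel h0] at h
      exact lowDegree_mono (by omega) h
  have h3 := add_mem h2 (barCoeff_add_mem (K := q) (2 * q + 1) le_rfl)
  rw [← add_assoc, ← h1] at h3
  have h4 := Submodule.smul_mem _ ((2 * q + 1 : ℕ) : ℚ)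
    (moments_and_cumulants (K := q) (m := 2 * q + 1) le_rfl).2.1
  have h5 : (-(2 * (2 * q + 1 : ℕ)) : ℚ) ≠ 0 := by
    have : ((2 * q + 1 : ℕ) : ℚ) ≠ 0 := by exact_mod_cast Nat.succ_ne_zero (2 * q)
    exact neg_ne_zero.2 (mul_ne_zero two_ne_zero this)
  rw [Nat.add_sub_cancel] at h4
  rw [← smul_mem_iff_lowDegree h5]
  -- With `r = 2q + 1`: `h3` bounds `-2r` times the character plus `r` times `oddSum r`, and `h4`
  -- bounds `r (R_{2q+2} - oddSum r)`. The power sum cancels in the sum, leaving `-2r` times the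
  -- character minus `R_{2q+2} / 2`.
  convert add_mem h3 h4 using 1
  ext p
  simp only [Pi.smul_apply, Pi.add_apply, Pi.sub_apply, Rat.smul_def, cumulantFun, spinFreeCumulant]
  push_cast
  rw [show 2 * (q + 1) = 2 * q + 1 + 1 by ring]
  ring

end BarSeries

end SpinKerov

end

/-! ### The theorem -/

theorem theorem1p4 (k : ℕ) (hk : 1 ≤ k) :
    ∃ K : MvPolynomial (Fin k) ℚ,
      (∀ (n : ℕ) (lam : SpinKerov.StrictPartition n),
        ((SpinKerov.oneRowSpinCharacter (2 * k - 1) lam : ℚ) : ℝ) =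
          MvPolynomial.aeval
            (fun j : Fin k => SpinKerov.spinFreeCumulant (2 * ((j : ℕ) + 1)) lam) K) ∧
      ∃ Q : MvPolynomial (Fin (k - 1)) ℚ,
        MvPolynomial.weightedTotalDegree (fun j : Fin (k - 1) => 2 * (j : ℕ) + 1) Q ≤ 2 * k - 2 ∧
        K = MvPolynomial.X ⟨k - 1, Nat.sub_lt hk Nat.one_pos⟩ +
          MvPolynomial.rename (Fin.castLE (Nat.sub_le k 1)) Q := by
  obtain ⟨q, rfl⟩ : ∃ q, k = q + 1 := ⟨k - 1, by omega⟩
  -- Membership in `lowDegree q (2q)` provides `Q` in the first `q = k - 1` variables, of degree at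
  -- most `2k - 2`.
  obtain ⟨Q, hQ, h⟩ := SpinKerov.oneRowSpinCharacter_sub_mem q
  refine ⟨_, fun n lam => ?_, Q, Finset.sup_le fun m hm => (hQ m hm).trans (by omega), rfl⟩
  have h1 := h ⟨n, lam⟩
  rw [map_add, MvPolynomial.aeval_X, MvPolynomial.aeval_rename]
  exact sub_eq_iff_eq_add'.1 h1
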